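/- Let $0<b<1$, $Q=b+b^{-1}$, $\boldsymbol\theta=(\theta_0,\theta_t,\theta_1,\theta_\infty)\in\mathbb R^4$ and $\sigma_t\in\mathbb R$. Let $E$ be the entire function determined, for $\operatorname{Im}z<Q/2$, by $$E(z)=\exp\left[\frac14\int_0^\infty\frac{dy}{y}\left(\frac{1-e^{-2iyz}}{\sinh(by)\sinh(b^{-1}y)}-\frac{2iz}{y}-z^2\left(e^{-2by}+e^{-2b^{-1}y}\right)\right)\right],$$ and put $g_b(z)=1/E(-z)$, $s_b(z)=g_b(z)/g_b(-z)$. For $\sigma_s\in\mathbb R$ the Virasoro fusion kernel is given by the Ponsot–Teschner formula $$F(b,\boldsymbol\theta,\sigma_s,\sigma_t)=\prod_{\epsilon,\epsilon'=\pm1}\frac{g_b(\epsilon\theta_1+\theta_t+\epsilon'\sigma_t)\,g_b(\epsilon\theta_0-\theta_\infty+\epsilon'\sigma_t)}{g_b(\epsilon\theta_0+\theta_t+\epsilon'\sigma_s)\,g_b(\epsilon\theta_1-\theta_\infty+\epsilon'\sigma_s)}\prod_{\epsilon=\pm1}\frac{g_b(\frac{iQ}2+2\epsilon\sigma_s)}{g_b(-\frac{iQ}2+2\epsilon\sigma_t)}\int_{\mathsf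 F}dx\prod_{\epsilon=\pm1}\frac{s_b(x+\epsilon\theta_1)\,s_b(x+\epsilon\theta_0+\theta_\infty+\theta_t)}{s_b(x+\frac{iQ}2+\theta_\infty+\epsilon\sigma_s)\,s_b(x+\frac{iQ}2+\theta_t+\epsilon\sigma_t)},$$ where $\mathsf F$ is a horizontal line $\operatorname{Im}x=-h$ with $0<h<Q/2$, oriented from $-\infty$ to $+\infty$, and $1/g_b(w)$ is read as $E(-w)$ (so that $F=0$ when $\sigma_t=0$). The integral converges absolutely, $F$ does not depend on $h$, and $F$ extends to a meromorphic function of $\sigma_s\in\mathbb C$, again denoted $F$. For $\beta\in\{b,b^{-1}\}$ define the difference operator $$H_F(\beta,\boldsymbol\theta,\sigma_s)=H_F^+(\beta,\boldsymbol\theta,\sigma_s)\,e^{i\beta\partial_{\sigma_s}}+H_F^+(\beta,\boldsymbol\theta,-\sigma_s)\,e^{-i\beta\partial_{\sigma_s}}+H_F^0(\beta,\boldsymbol\theta,\sigma_s),$$ where $e^{\pm i\beta\partial_{\sigma}}f(\sigma)=f(\sigma\pm i\beta)$, $$H_F^+(\beta,\boldsymbol\theta,\sigma_s)=4\pi^2\frac{\Gamma(1+2\beta^2-2i\beta\sigma_s)\,\Gamma(\beta^2-2i\beta\sigma_s)\,\Gamma(-2i\beta\sigma_s)\,\Gamma(1+\beta^2-2i\beta\sigma_s)}{\prod_{\epsilon,\epsilon'=\pm1}\Gamma\left(\frac{\beta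 Q}2-i\beta(\sigma_s+\epsilon\theta_1+\epsilon'\theta_\infty)\right)\Gamma\left(\frac{\beta Q}2-i\beta(\sigma_s+\epsilon\theta_0+\epsilon'\theta_t)\right)},$$ $$H_F^0(\beta,\boldsymbol\theta,\sigma_s)=-2\cosh\left(2\pi\beta(\theta_1+\theta_t+\tfrac{i\beta}2)\right)+4\sum_{k=\pm1}\frac{\prod_{\epsilon=\pm1}\cosh\left(\pi\beta(\epsilon\theta_\infty-\frac{i\beta}2-\theta_1-k\sigma_s)\right)\cosh\left(\pi\beta(\epsilon\theta_0-\frac{i\beta}2-\theta_t-k\sigma_s)\right)}{\sinh\left(2\pi\beta(k\sigma_s+\frac{i\beta}2)\right)\sinh(2\pi\beta k\sigma_s)}.$$ Then, for every real $\sigma_s\ne0$, $$H_F(b,\boldsymbol\theta,\sigma_s)F(b,\boldsymbol\theta,\sigma_s,\sigma_t)=2\cosh(2\pi b\sigma_t)\,F(b,\boldsymbol\theta,\sigma_s,\sigma_t),$$ $$H_F(b^{-1},\boldsymbol\theta,\sigma_s)F(b,\boldsymbol\theta,\sigma_s,\sigma_t)=2\cosh(2\pi b^{-1}\sigma_t)\,F(b,\boldsymbol\theta,\sigma_s,\sigma_t).$$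 -/

import Mathlib

open MeasureTheory

noncomputable section

namespace VirasoroFusion

/-- The meromorphic continuation to the whole complex plane of `f`, initially given on `U`: the
function `g`, meromorphic on `ℂ` and in normal form (the analytic value at every regular point, the
value `0` at every pole), that agrees with `f` on `U`. When `U` has an accumulation point such a `g`
is unique. If there is none, the value is `f` itself, by convention. -/
def meromorphicContinuation (U : Set ℂ) (f : ℂ → ℂ) : ℂ → ℂ :=
  open Classical in
  if h : ∃ g : ℂ → ℂ, MeromorphicNFOn g Set.univ ∧ Set.EqOn g f U then h.choose else f

/-- The integral formula for Ruijsenaars' function `E(a₋, a₊, z)`; the integral converges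
absolutely when `Im z < (a₋ + a₊) / 2`. -/
def hyperbolicEIntegral (am ap : ℝ) (z : ℂ) : ℂ :=
  Complex.exp ((1 / 4 : ℂ) * ∫ y in Set.Ioi (0 : ℝ),
    (1 / (y : ℂ)) *
      ((1 - Complex.exp (-2 * Complex.I * y * z)) /
          (Complex.sinh (ap * y) * Complex.sinh (am * y))
        - 2 * Complex.I * z / (ap * am * y)
        - z ^ 2 / (ap * am) * (Complex.exp (-2 * ap * y) + Complex.exp (-2 * am * y))))

/-- Ruijsenaars' entire function `E(a₋, a₊, z)`, the building block of the hyperbolic gamma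
function `G(z) = E(z) / E(-z)`. -/
def hyperbolicE (am ap : ℝ) : ℂ → ℂ :=
  meromorphicContinuation {z | z.im < (am + ap) / 2} (hyperbolicEIntegral am ap)

/-- `g_b(z) = 1 / E(b, b⁻¹, -z)`. (`E` is entire; `g_b` has poles and no zeros, and its value at
its poles is `0` here, so that `1 / g_b(z) = E(b, b⁻¹, -z)` at every `z`.) -/
def gFun (b : ℝ) (z : ℂ) : ℂ := 1 / hyperbolicE b b⁻¹ (-z)

/-- `s_b(z) = g_b(z) / g_b(-z)`. -/
def sFun (b : ℝ) (z : ℂ) : ℂ := gFun b z / gFun b (-z)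

/-- The set of signs `{+1, -1}`. -/
def signs : Finset ℤ := {1, -1}

/-- The vector of external momenta `(θ₀, θ_t, θ₁, θ_∞)`. -/
structure Momenta where
  th0 : ℝ
  tht : ℝ
  th1 : ℝ
  thinf : ℝ

/-- `Q = b + b⁻¹`. -/
def Qpar (b : ℝ) : ℝ := b + b⁻¹

/-- The factor in front of the integral in the Ponsot–Teschner formula. -/
def fusionPrefactor (b : ℝ) (θ : Momenta) (σs σt : ℂ) : ℂ :=
  (∏ ε ∈ signs, ∏ ε' ∈ signs,
    (gFun b (ε * θ.th1 + θ.tht + ε' * σt) * gFun b (ε * θ.th0 - θ.thinf + ε' * σt)) /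
      (gFun b (ε * θ.th0 + θ.tht + ε' * σs) * gFun b (ε * θ.th1 - θ.thinf + ε' * σs))) *
  ∏ ε ∈ signs,
    gFun b (Complex.I * Qpar b / 2 + 2 * ε * σs) / gFun b (-(Complex.I * Qpar b / 2) + 2 * ε * σt)

/-- The integrand in the Ponsot–Teschner formula. -/
def fusionIntegrand (b : ℝ) (θ : Momenta) (σs σt x : ℂ) : ℂ :=
  ∏ ε ∈ signs,
    (sFun b (x + ε * θ.th1) * sFun b (x + ε * θ.th0 + θ.thinf + θ.tht)) /
      (sFun b (x + Complex.I * Qpar b / 2 + θ.thinf + ε * σs) *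
        sFun b (x + Complex.I * Qpar b / 2 + θ.tht + ε * σt))

/-- The Ponsot–Teschner formula, with the horizontal line `Im x = -h` as integration contour. For
real momenta and `0 < h < Q / 2` this line separates the upper from the lower sequences of poles. -/
def ponsotTeschner (b : ℝ) (θ : Momenta) (h : ℝ) (σs σt : ℂ) : ℂ :=
  fusionPrefactor b θ σs σt * ∫ x : ℝ, fusionIntegrand b θ σs σt (x - Complex.I * h)

/-- The Virasoro fusion kernel `F(b, θ, σ_s, σ_t)`, for real `σ_t`, as a meromorphic function of
`σ_s ∈ ℂ`: the continuation of the Ponsot–Teschner formula from real `σ_s`. -/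
def fusionKernel (b : ℝ) (θ : Momenta) (σs : ℂ) (σt : ℝ) : ℂ :=
  meromorphicContinuation {σ | σ.im = 0}
    (fun σ => ponsotTeschner b θ (Qpar b / 4) σ σt) σs

/-- The coefficient `H_F^+(b, θ, σ)`. -/
def HFplus (b : ℝ) (θ : Momenta) (σ : ℂ) : ℂ :=
  4 * (Real.pi : ℂ) ^ 2 *
    (Complex.Gamma (1 + 2 * b ^ 2 - 2 * Complex.I * b * σ) *
      Complex.Gamma (b ^ 2 - 2 * Complex.I * b * σ) *
      Complex.Gamma (-2 * Complex.I * b * σ) *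
      Complex.Gamma (1 + b ^ 2 - 2 * Complex.I * b * σ)) /
    ∏ ε ∈ signs, ∏ ε' ∈ signs,
      (Complex.Gamma (b * Qpar b / 2 - Complex.I * b * (σ + ε * θ.th1 + ε' * θ.thinf)) *
        Complex.Gamma (b * Qpar b / 2 - Complex.I * b * (σ + ε * θ.th0 + ε' * θ.tht)))

/-- The potential `H_F^0(b, θ, σ)`. -/
def HFzero (b : ℝ) (θ : Momenta) (σ : ℂ) : ℂ :=
  -2 * Complex.cosh (2 * Real.pi * b * (θ.th1 + θ.tht + Complex.I * b / 2)) +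
  4 * ∑ k ∈ signs,
    (∏ ε ∈ signs,
      (Complex.cosh (Real.pi * b * (ε * θ.thinf - Complex.I * b / 2 - θ.th1 - k * σ)) *
        Complex.cosh (Real.pi * b * (ε * θ.th0 - Complex.I * b / 2 - θ.tht - k * σ)))) /
      (Complex.sinh (2 * Real.pi * b * (k * σ + Complex.I * b / 2)) *
        Complex.sinh (2 * Real.pi * b * k * σ))

/-- The difference operator `H_F(b, θ, σ) = H_F^+(b, θ, σ) e^{ib∂_σ} + H_F^+(b, θ, -σ) e^{-ib∂_σ}
+ H_F^0(b, θ, σ)`, where `e^{±ib∂_σ}` acts on functions of a complex variable by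
`f(σ) ↦ f(σ ± ib)`. -/
def HF (b : ℝ) (θ : Momenta) (f : ℂ → ℂ) (σ : ℂ) : ℂ :=
  HFplus b θ σ * f (σ + Complex.I * b) + HFplus b θ (-σ) * f (σ - Complex.I * b) +
    HFzero b θ σ * f σ

end VirasoroFusion

end

noncomputable section

namespace VirasoroFusion

open Filter Topology Set

/-! Everything rests on one difference equation: E(z + ib/2) / E(z - ib/2) is an exponential times
1/Γ(1/2 + ibz). For real x = 1/2 + ibz, minus the logarithm of this quotient is convex in x and, by
Frullani's integral, increases by log x - log b under x ↦ x + 1. So Bohr–Mollerup identifies it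
(`exp_neg_eStepLog`), and the identity theorem extends the formula (`hyperbolicEIntegral_step`). The
equation makes E entire and, by Euler reflection, gives s_b(z + ib) = k cosh(πb(z + ib/2)) s_b(z)
(`sFun_step`). Since |s_b(z)| is at most of order exp(π |Re z| Im z) (`norm_sFun_le`), the
Ponsot–Teschner integrand decays like exp(-2πQ |Re x|), and the contour may move freely between the
two sequences of poles.

Equation in b. Conjugation by the σ_s-dependent prefactor turns the Gamma quotients of H_F into
hyperbolic functions (`shiftCoeff_mul_edgeFactor`). The conjugated operator minus 2cosh(2πbσ_t),
applied to the integrand, is then a multiple of a discrete derivative J(x + ib) - J(x)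
(`trig_telescoping`, `sProd_telescoping`), whose integral vanishes on moving the contour by b
(`fusionInt_difference`). This needs one line Im x = -h that separates the poles for σ_s and σ_s ±
ib at once, that is b < h < Q/2, which is possible because b < 1.

Equation in 1/b. The kernel is symmetric in b and 1/b (`kernelFun_inv`), but the same argument would
need 1/b < h < Q/2, which is impossible. Replacing θ_t, θ_∞ by θ_t + w, θ_∞ - w relaxes the
requirement to 1/b - Im w < h and Im w < h, which holds near w = i/(2b) once 1/(2b) < h. The dual
equation holds there and is continued in w to w = 0. For this, the value of the kernel at σ_s + i/b
must be holomorphic in w; it is obtained by iterating the equation in b as a three-term recurrence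
from points with |Im σ| ≤ b (`dualShift`), where the integral formula remains valid down to w = 0.

The same recurrence realises the meromorphic continuation in σ_s (`stepExtend`). By uniqueness this
is `fusionKernel`, and it has no poles off the imaginary axis, so its values at σ_s ± iβ are the
expected ones. -/

/-! ### Holomorphy of parameter integrals -/

/-- A parameter integral of functions holomorphic in the parameter, locally uniformly dominated,
is holomorphic. -/
theorem differentiableOn_integral_of_dominated {α : Type*} [MeasurableSpace α] {μ : Measure α}
    {F : ℂ → α → ℂ} {U : Set ℂ} (hU : IsOpen U)
    (hm : ∀ z ∈ U, AEStronglyMeasurable (F z) μ)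
    (hd : ∀ᵐ a ∂μ, DifferentiableOn ℂ (fun z => F z a) U)
    (hb : ∀ z₀ ∈ U, ∃ r > 0, ∃ g : α → ℝ, Integrable g μ ∧
      ∀ᵐ a ∂μ, ∀ z ∈ Metric.ball z₀ r ∩ U, ‖F z a‖ ≤ g a) :
    DifferentiableOn ℂ (fun z => ∫ a, F z a ∂μ) U := by
  intro z₀ hz₀
  obtain ⟨r₁, hr₁, g, hg, hbd⟩ := hb z₀ hz₀
  obtain ⟨r₂, hr₂, hsub⟩ := Metric.isOpen_iff.1 hU z₀ hz₀
  set r := min r₁ r₂ with hr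
  have hr0 : 0 < r := lt_min hr₁ hr₂
  have hball : Metric.ball z₀ r ⊆ Metric.ball z₀ r₁ ∩ U := fun z hz =>
    ⟨Metric.ball_subset_ball (min_le_left _ _) hz,
      hsub (Metric.ball_subset_ball (min_le_right _ _) hz)⟩
  have hz₀b : z₀ ∈ Metric.ball z₀ (r / 4) := Metric.mem_ball_self (by positivity)
  have hderiv : ∀ᵐ a ∂μ, ∀ z ∈ Metric.ball z₀ (r / 4),
      HasDerivAt (fun z => F z a) (deriv (fun z => F z a) z) z := by
    filter_upwards [hd] with a ha z hz
    exact ((ha z (hball (Metric.ball_subset_ball (by linarith) hz)).2).differentiableAt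
      (hU.mem_nhds (hball (Metric.ball_subset_ball (by linarith) hz)).2)).hasDerivAt
  have hbound : ∀ᵐ a ∂μ, ∀ z ∈ Metric.ball z₀ (r / 4),
      ‖deriv (fun z => F z a) z‖ ≤ g a / (r / 4) := by
    filter_upwards [hd, hbd] with a ha hga z hz
    have hcl : Metric.closedBall z (r / 4) ⊆ Metric.ball z₀ r := by
      intro w hw
      rw [Metric.mem_closedBall] at hw
      rw [Metric.mem_ball] at hz ⊢
      linarith [dist_triangle w z z₀]
    -- Cauchy's estimate on circles of radius r/4 turns the bound on F into a bound on its
    -- derivative in the parameter.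
    refine Complex.norm_deriv_le_of_forall_mem_sphere_norm_le (by positivity) ?_ ?_
    · refine DifferentiableOn.diffContOnCl (ha.mono ?_)
      exact (Metric.closure_ball_subset_closedBall.trans hcl).trans fun w hw => (hball hw).2
    · intro w hw
      exact hga w (hball (hcl (Metric.sphere_subset_closedBall hw)))
  -- The derivative is a pointwise limit of difference quotients along a sequence, hence measurable;
  -- the offset n + 2 keeps the increments nonzero and the points in the ball.
  have hmeas : AEStronglyMeasurable (fun a => deriv (fun z => F z a) z₀) μ := by
    set t : ℕ → ℂ := fun n => ((r / 4 / (n + 2) : ℝ) : ℂ) with ht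
    have htlim : Tendsto t atTop (𝓝[≠] 0) := by
      rw [tendsto_nhdsWithin_iff]
      constructor
      · have h1 : Tendsto (fun n : ℕ => r / 4 / ((n : ℝ) + 2)) atTop (𝓝 0) :=
          tendsto_const_nhds.div_atTop
            (tendsto_atTop_add_const_right _ _ tendsto_natCast_atTop_atTop)
        have := (Complex.continuous_ofReal.tendsto 0).comp h1
        simpa [ht, Function.comp_def] using this
      · refine Eventually.of_forall fun n => ?_
        simp only [ht, mem_compl_iff, mem_singleton_iff, Complex.ofReal_eq_zero]
        positivity
    have hmem : ∀ n, z₀ + t n ∈ U := by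
      intro n
      refine (hball ?_).2
      rw [Metric.mem_ball, dist_eq_norm, add_sub_cancel_left, ht, Complex.norm_real,
        Real.norm_of_nonneg (by positivity), div_lt_iff₀ (by positivity)]
      nlinarith [Nat.cast_nonneg (α := ℝ) n]
    refine aestronglyMeasurable_of_tendsto_ae atTop
      (f := fun n a => (t n)⁻¹ • (F (z₀ + t n) a - F z₀ a)) ?_ ?_
    · intro n
      exact ((hm _ (hmem n)).sub (hm _ hz₀)).const_mul (t n)⁻¹
    · filter_upwards [hderiv] with a ha
      exact (hasDerivAt_iff_tendsto_slope_zero.1 (ha z₀ hz₀b)).comp htlim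
  have hint : Integrable (F z₀) μ := by
    refine hg.mono' (hm _ hz₀) ?_
    filter_upwards [hbd] with a ha
    exact ha z₀ (hball (Metric.mem_ball_self hr0))
  have hev : ∀ᶠ z in 𝓝 z₀, AEStronglyMeasurable (F z) μ := by
    filter_upwards [hU.mem_nhds hz₀] with z hz using hm z hz
  exact (hasDerivAt_integral_of_dominated_loc_of_deriv_le
    (Metric.ball_mem_nhds z₀ (by positivity : 0 < r / 4)) hev hint hmeas hbound
    (hg.div_const _) hderiv).2.differentiableAt.differentiableWithinAt

/-! ### The integral for log E: convergence and holomorphy -/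

/-- The weight `1 / (sinh (b⁻¹ y) sinh (b y))`. -/
def sinhWeight (b y : ℝ) : ℝ := 1 / (Real.sinh (b⁻¹ * y) * Real.sinh (b * y))

/-- The integrand of `log E` for the periods `b, b⁻¹`. -/
def eKernel (b : ℝ) (z : ℂ) (y : ℝ) : ℂ :=
  (1 / (y : ℂ)) * ((1 - Complex.exp (-2 * Complex.I * y * z)) * sinhWeight b y
    - 2 * Complex.I * z / y
    - z ^ 2 * (Real.exp (-2 * b⁻¹ * y) + Real.exp (-2 * b * y) : ℝ))

theorem hyperbolicEIntegral_eq {b : ℝ} (hb : 0 < b) (z : ℂ) :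
    hyperbolicEIntegral b b⁻¹ z =
      Complex.exp ((1 / 4 : ℂ) * ∫ y in Ioi (0 : ℝ), eKernel b z y) := by
  have hb' : (b : ℂ) ≠ 0 := by exact_mod_cast hb.ne'
  unfold hyperbolicEIntegral eKernel sinhWeight
  congr 3
  ext y
  push_cast
  rw [inv_mul_cancel₀ hb']
  simp only [one_mul, div_one, mul_one_div]

theorem hyperbolicE_inv (b : ℝ) : hyperbolicE b⁻¹ b⁻¹⁻¹ = hyperbolicE b b⁻¹ := by
  have h : hyperbolicEIntegral b⁻¹ b⁻¹⁻¹ = hyperbolicEIntegral b b⁻¹ := by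
    ext z
    unfold hyperbolicEIntegral
    rw [inv_inv]
    congr 3
    ext y
    rw [mul_comm (Complex.sinh (b * y)), mul_comm (b : ℂ) ((b⁻¹ : ℝ) : ℂ),
      add_comm (Complex.exp (-2 * b * y))]
  unfold hyperbolicE
  rw [h, inv_inv, add_comm b⁻¹ b]

theorem sinh_le_mul_cosh {x : ℝ} (hx : 0 ≤ x) : Real.sinh x ≤ x * Real.cosh x := by
  have h : MonotoneOn (fun x => x * Real.cosh x - Real.sinh x) (Ici 0) := by
    refine monotoneOn_of_deriv_nonneg (convex_Ici 0) (by fun_prop) (by fun_prop) ?_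
    intro y hy
    rw [interior_Ici, mem_Ioi] at hy
    have : HasDerivAt (fun x => x * Real.cosh x - Real.sinh x)
        (1 * Real.cosh y + y * Real.sinh y - Real.cosh y) y :=
      ((hasDerivAt_id y).mul (Real.hasDerivAt_cosh y)).sub (Real.hasDerivAt_sinh y)
    rw [this.deriv]
    have := Real.sinh_nonneg_iff.2 hy.le
    nlinarith [mul_nonneg hy.le this]
  have := h (mem_Ici.2 le_rfl) (mem_Ici.2 hx) hx
  simp at this
  linarith

/-- Combines sinh x ≤ x cosh x, cosh x ≤ exp(x²/2) and 1 - x²/2 ≤ exp(-x²/2). The quadratic order of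
the error is what keeps 1/y² - `sinhWeight b y` bounded near 0. -/
theorem one_sub_sq_le_div_sinh {x : ℝ} (hx : 0 < x) : 1 - x ^ 2 / 2 ≤ x / Real.sinh x := by
  have h1 := sinh_le_mul_cosh hx.le
  have h2 := Real.cosh_le_exp_half_sq x
  have hs := Real.sinh_pos_iff.2 hx
  rw [le_div_iff₀ hs]
  have h3 : 1 - x ^ 2 / 2 ≤ Real.exp (-(x ^ 2 / 2)) := by
    linarith [Real.add_one_le_exp (-(x ^ 2 / 2))]
  calc (1 - x ^ 2 / 2) * Real.sinh x ≤ Real.exp (-(x ^ 2 / 2)) * Real.sinh x := by gcongr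
    _ ≤ Real.exp (-(x ^ 2 / 2)) * (x * Real.exp (x ^ 2 / 2)) := by
        gcongr
        exact h1.trans (by gcongr)
    _ = x := by
        rw [mul_left_comm, ← Real.exp_add]
        simp

theorem sinhWeight_nonneg {b y : ℝ} (hb : 0 < b) (hy : 0 < y) : 0 ≤ sinhWeight b y := by
  have := Real.sinh_nonneg_iff.2 (by positivity : 0 ≤ b⁻¹ * y)
  have := Real.sinh_nonneg_iff.2 (by positivity : 0 ≤ b * y)
  unfold sinhWeight
  positivity

theorem div_sinh_le_one {x : ℝ} (hx : 0 < x) : x / Real.sinh x ≤ 1 := by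
  rw [div_le_one (Real.sinh_pos_iff.2 hx)]
  exact Real.self_le_sinh_iff.2 hx.le

theorem abs_sinhWeight_sub_le {b y : ℝ} (hb : 0 < b) (hy : 0 < y) :
    |1 / y ^ 2 - sinhWeight b y| ≤ (b ^ 2 + b⁻¹ ^ 2) / 2 := by
  have h1 := one_sub_sq_le_div_sinh (by positivity : 0 < b * y)
  have h2 := one_sub_sq_le_div_sinh (by positivity : 0 < b⁻¹ * y)
  have h3 := div_sinh_le_one (by positivity : 0 < b * y)
  have h4 := div_sinh_le_one (by positivity : 0 < b⁻¹ * y)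
  have s1 := Real.sinh_pos_iff.2 (by positivity : 0 < b * y)
  have s2 := Real.sinh_pos_iff.2 (by positivity : 0 < b⁻¹ * y)
  set p := b * y / Real.sinh (b * y) with hp
  set q := b⁻¹ * y / Real.sinh (b⁻¹ * y) with hq
  have hp0 : 0 ≤ p := by positivity
  have hq0 : 0 ≤ q := by positivity
  have key : 1 / y ^ 2 - sinhWeight b y = (1 - p * q) / y ^ 2 := by
    unfold sinhWeight
    rw [hp, hq]
    field_simp
  rw [key, abs_of_nonneg (by have : p * q ≤ 1 := mul_le_one₀ h3 hq0 h4
                             have : 0 ≤ 1 - p * q := by linarith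
                             positivity), div_le_iff₀ (by positivity)]
  have : 1 - p * q = (1 - p) + p * (1 - q) := by ring
  have h5 : p * (1 - q) ≤ 1 * (1 - q) := mul_le_mul_of_nonneg_right h3 (by linarith)
  nlinarith

theorem sinh_ge_mul_exp {c y : ℝ} (hc : 0 < c) (hy : 1 ≤ y) :
    (1 - Real.exp (-2 * c)) / 2 * Real.exp (c * y) ≤ Real.sinh (c * y) := by
  rw [Real.sinh_eq]
  have h : Real.exp (-(c * y)) ≤ Real.exp (-2 * c) * Real.exp (c * y) := by
    rw [← Real.exp_add]
    apply Real.exp_le_exp.2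
    nlinarith
  linarith

theorem sinhWeight_le_exp {b : ℝ} (hb : 0 < b) :
    ∃ C > 0, ∀ y, 1 ≤ y → sinhWeight b y ≤ C * Real.exp (-(b + b⁻¹) * y) := by
  have hb' : 0 < b⁻¹ := inv_pos.2 hb
  set A := (1 - Real.exp (-2 * b)) / 2 with hA
  set B := (1 - Real.exp (-2 * b⁻¹)) / 2 with hB
  have hA0 : 0 < A := by
    have : Real.exp (-2 * b) < 1 := Real.exp_lt_one_iff.mpr (by linarith)
    rw [hA]; linarith
  have hB0 : 0 < B := by
    have : Real.exp (-2 * b⁻¹) < 1 := Real.exp_lt_one_iff.mpr (by linarith)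
    rw [hB]; linarith
  refine ⟨1 / (B * A), by positivity, fun y hy => ?_⟩
  have h1 := sinh_ge_mul_exp hb hy
  have h2 := sinh_ge_mul_exp hb' hy
  unfold sinhWeight
  calc 1 / (Real.sinh (b⁻¹ * y) * Real.sinh (b * y))
      ≤ 1 / ((B * Real.exp (b⁻¹ * y)) * (A * Real.exp (b * y))) := by gcongr
    _ = 1 / (B * A) * Real.exp (-(b + b⁻¹) * y) := by
      rw [show -(b + b⁻¹) * y = -(b⁻¹ * y + b * y) by ring, Real.exp_neg, Real.exp_add]
      field_simp

theorem exp_neg_le_inv {t : ℝ} (ht : 0 < t) : Real.exp (-t) ≤ 1 / t := by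
  rw [Real.exp_neg, ← one_div]
  gcongr
  linarith [Real.add_one_le_exp t]

theorem norm_two_I_mul_le {R y : ℝ} {z : ℂ} (hz : ‖z‖ ≤ R) (hy : 0 < y) :
    ‖-2 * Complex.I * y * z‖ ≤ 2 * R * y := by
  simp only [norm_mul, norm_neg, Complex.norm_I, Complex.norm_real, Real.norm_of_nonneg hy.le,
    Complex.norm_ofNat]
  nlinarith

/-- With u = -2iyz, write exp u = 1 + u + u²/2 + r and the weight as 1/y² - q. The terms in u and u²
cancel the two subtractions in the integrand, leaving z² e - q(1 - exp u) - r/y². Each summand is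
O(y), which absorbs the factor 1/y. -/
theorem norm_eKernel_le_of_le_one {b : ℝ} (hb : 0 < b) {R : ℝ} (hR : 0 ≤ R) {z : ℂ} (hz : ‖z‖ ≤ R)
    {y : ℝ} (hy : 0 < y) (hy1 : y ≤ 1) :
    ‖eKernel b z y‖ ≤ R ^ 2 * (2 * (b + b⁻¹)) +
      (b ^ 2 + b⁻¹ ^ 2) / 2 * (2 * R * Real.exp (2 * R)) + (2 * R) ^ 3 * Real.exp (2 * R) := by
  have hb' : 0 < b⁻¹ := inv_pos.2 hb
  have hyC : (y : ℂ) ≠ 0 := by exact_mod_cast hy.ne'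
  have hu := norm_two_I_mul_le hz hy
  set u := -2 * Complex.I * y * z with hu'
  set q := 1 / y ^ 2 - sinhWeight b y with hq
  have hqb : |q| ≤ (b ^ 2 + b⁻¹ ^ 2) / 2 := abs_sinhWeight_sub_le hb hy
  have hwq : (sinhWeight b y : ℂ) = 1 / (y : ℂ) ^ 2 - q := by
    rw [hq]; push_cast; ring
  set r := Complex.exp u - (1 + u + u ^ 2 / 2) with hr
  have hunorm : ‖u‖ ≤ 2 * R :=
    hu.trans (mul_le_of_le_one_right (by positivity) hy1)
  have hexpu : Real.exp ‖u‖ ≤ Real.exp (2 * R) := Real.exp_le_exp.2 hunorm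
  have hrb : ‖r‖ ≤ (2 * R * y) ^ 3 * Real.exp (2 * R) := by
    have := Complex.norm_exp_sub_sum_le_norm_mul_exp u 3
    simp only [Finset.sum_range_succ, Finset.sum_range_zero] at this
    norm_num at this
    refine this.trans ?_
    gcongr
  have heb : ‖1 - Complex.exp u‖ ≤ 2 * R * y * Real.exp (2 * R) := by
    have := Complex.norm_exp_sub_sum_le_norm_mul_exp u 1
    simp only [Finset.sum_range_succ, Finset.sum_range_zero] at this
    norm_num at this
    rw [norm_sub_rev]
    refine this.trans ?_
    gcongr
  set e := 2 - (Real.exp (-2 * b⁻¹ * y) + Real.exp (-2 * b * y)) with he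
  have heb2 : |e| ≤ 2 * (b + b⁻¹) * y := by
    have p1 : 0 < b * y := by positivity
    have p2 : 0 < b⁻¹ * y := by positivity
    have h1 := Real.add_one_le_exp (-2 * b⁻¹ * y)
    have h2 := Real.add_one_le_exp (-2 * b * y)
    have h3 : Real.exp (-2 * b⁻¹ * y) ≤ 1 := Real.exp_le_one_iff.2 (by linarith)
    have h4 : Real.exp (-2 * b * y) ≤ 1 := Real.exp_le_one_iff.2 (by linarith)
    rw [abs_le]
    constructor <;> rw [he] <;> linarith
  have key : eKernel b z y = (1 / (y : ℂ)) * (z ^ 2 * e - q * (1 - Complex.exp u)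
      - r / (y : ℂ) ^ 2) := by
    unfold eKernel
    rw [hwq, ← hu', show Complex.exp u = r + (1 + u + u ^ 2 / 2) by rw [hr]; ring, he, hu']
    push_cast
    field_simp
    ring_nf
    simp only [Complex.I_sq]
    ring
  rw [key, norm_mul, norm_div, norm_one, Complex.norm_real, Real.norm_of_nonneg hy.le,
    one_div_mul_eq_div, div_le_iff₀ hy]
  refine (norm_sub_le _ _).trans ((add_le_add (norm_sub_le _ _) le_rfl).trans ?_)
  rw [norm_mul, norm_mul, norm_div, norm_pow, norm_pow, Complex.norm_real, Complex.norm_real,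
    Complex.norm_real, Real.norm_of_nonneg hy.le, Real.norm_eq_abs, Real.norm_eq_abs]
  have t1 : ‖z‖ ^ 2 * |e| ≤ R ^ 2 * (2 * (b + b⁻¹) * y) := by gcongr
  have t2 : |q| * ‖1 - Complex.exp u‖ ≤
      (b ^ 2 + b⁻¹ ^ 2) / 2 * (2 * R * y * Real.exp (2 * R)) := by gcongr
  have t3 : ‖r‖ / y ^ 2 ≤ (2 * R) ^ 3 * Real.exp (2 * R) * y := by
    rw [div_le_iff₀ (by positivity)]
    refine hrb.trans (le_of_eq ?_)
    ring
  linarith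

/-- The weight is O(exp(-Qy)) while |exp(-2iyz)| is at most exp(2vy), so the product decays at the
rate Q - 2v > 0. Every term in the bracket is then O(1/y). -/
theorem norm_eKernel_le_of_one_le {b : ℝ} (hb : 0 < b) {R v : ℝ} (hR : 0 ≤ R)
    (hv : v < (b + b⁻¹) / 2) :
    ∃ C, 0 ≤ C ∧ ∀ z : ℂ, ‖z‖ ≤ R → z.im ≤ v → ∀ y, 1 ≤ y → ‖eKernel b z y‖ ≤ C / y ^ 2 := by
  have hb' : 0 < b⁻¹ := inv_pos.2 hb
  obtain ⟨C₀, hC₀, hw⟩ := sinhWeight_le_exp hb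
  set Q := b + b⁻¹ with hQ
  have hQ0 : 0 < Q := by positivity
  set c := Q - 2 * v with hc
  have hc0 : 0 < c := by linarith
  set C₂ := C₀ * (1 / Q) + C₀ * (1 / c) + 2 * R + R ^ 2 * (1 / (2 * b⁻¹) + 1 / (2 * b)) with hC₂
  refine ⟨C₂, by positivity, fun z hz hzv y hy1 => ?_⟩
  have hy : 0 < y := by linarith
  have hw0 := sinhWeight_nonneg hb hy
  have hexp : ‖Complex.exp (-2 * Complex.I * y * z)‖ ≤ Real.exp (2 * v * y) := by
    rw [Complex.norm_exp]
    apply Real.exp_le_exp.2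
    simp
    nlinarith
  have t1 : sinhWeight b y ≤ C₀ * (1 / Q) / y := by
    refine (hw y hy1).trans ?_
    rw [mul_div_assoc, div_div]
    gcongr
    rw [neg_mul]
    exact exp_neg_le_inv (by positivity)
  have t2 : Real.exp (2 * v * y) * sinhWeight b y ≤ C₀ * (1 / c) / y := by
    have : Real.exp (2 * v * y) * sinhWeight b y ≤ C₀ * Real.exp (-(c * y)) := by
      calc _ ≤ Real.exp (2 * v * y) * (C₀ * Real.exp (-Q * y)) := by
            gcongr; exact hw y hy1
        _ = C₀ * Real.exp (-(c * y)) := by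
            rw [mul_left_comm, ← Real.exp_add, hc]; ring_nf
    refine this.trans ?_
    rw [mul_div_assoc, div_div]
    gcongr
    exact exp_neg_le_inv (by positivity)
  have t3 : Real.exp (-2 * b⁻¹ * y) ≤ 1 / (2 * b⁻¹) / y := by
    rw [div_div, show -2 * b⁻¹ * y = -(2 * b⁻¹ * y) by ring]
    exact exp_neg_le_inv (by positivity)
  have t4 : Real.exp (-2 * b * y) ≤ 1 / (2 * b) / y := by
    rw [div_div, show -2 * b * y = -(2 * b * y) by ring]
    exact exp_neg_le_inv (by positivity)
  unfold eKernel
  rw [norm_mul, norm_div, norm_one, Complex.norm_real, Real.norm_of_nonneg hy.le,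
    one_div_mul_eq_div, div_le_iff₀ hy, show C₂ / y ^ 2 * y = C₂ / y by field_simp]
  refine (norm_sub_le _ _).trans ((add_le_add (norm_sub_le _ _) le_rfl).trans ?_)
  rw [norm_mul, norm_mul, Complex.norm_real, Complex.norm_real, norm_pow, norm_div,
    Complex.norm_real, Real.norm_of_nonneg hy.le, Real.norm_of_nonneg hw0,
    Real.norm_of_nonneg (by positivity)]
  have s1 : ‖1 - Complex.exp (-2 * Complex.I * y * z)‖ * sinhWeight b y ≤
      (1 + Real.exp (2 * v * y)) * sinhWeight b y := by
    gcongr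
    exact (norm_sub_le _ _).trans (by simpa using hexp)
  have s2 : ‖2 * Complex.I * z‖ / y ≤ 2 * R / y := by
    gcongr
    simpa using hz
  have s3 : ‖z‖ ^ 2 * (Real.exp (-2 * b⁻¹ * y) + Real.exp (-2 * b * y)) ≤
      R ^ 2 * (1 / (2 * b⁻¹) / y + 1 / (2 * b) / y) := by gcongr
  have : C₂ / y = C₀ * (1 / Q) / y + C₀ * (1 / c) / y + 2 * R / y +
    R ^ 2 * (1 / (2 * b⁻¹) / y + 1 / (2 * b) / y) := by rw [hC₂]; ring
  rw [this]
  linarith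

theorem norm_eKernel_le {b : ℝ} (hb : 0 < b) {R v : ℝ} (hR : 0 ≤ R) (hv : v < (b + b⁻¹) / 2) :
    ∃ C, ∀ z : ℂ, ‖z‖ ≤ R → z.im ≤ v → ∀ y, 0 < y → ‖eKernel b z y‖ ≤ C * (1 + y ^ 2)⁻¹ := by
  obtain ⟨C₂, hC₂, h₂⟩ := norm_eKernel_le_of_one_le hb hR hv
  have h₁ := fun (z : ℂ) (hz : ‖z‖ ≤ R) (y : ℝ) (hy : 0 < y) =>
    norm_eKernel_le_of_le_one hb hR hz hy
  have hC₁ : 0 ≤ R ^ 2 * (2 * (b + b⁻¹)) +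
      (b ^ 2 + b⁻¹ ^ 2) / 2 * (2 * R * Real.exp (2 * R)) + (2 * R) ^ 3 * Real.exp (2 * R) := by
    positivity
  generalize R ^ 2 * (2 * (b + b⁻¹)) + (b ^ 2 + b⁻¹ ^ 2) / 2 * (2 * R * Real.exp (2 * R)) +
    (2 * R) ^ 3 * Real.exp (2 * R) = C₁ at h₁ hC₁
  refine ⟨2 * (C₁ + C₂), fun z hz hzv y hy => ?_⟩
  rcases le_total y 1 with hy1 | hy1
  · refine (h₁ z hz y hy hy1).trans ?_
    rw [← div_eq_mul_inv, le_div_iff₀ (by positivity)]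
    nlinarith [mul_nonneg hC₁ (by nlinarith : 0 ≤ 1 - y ^ 2)]
  · refine (h₂ z hz hzv y hy1).trans ?_
    rw [← div_eq_mul_inv, div_le_div_iff₀ (by positivity) (by positivity)]
    nlinarith [mul_nonneg hC₂ (by nlinarith : 0 ≤ y ^ 2 - 1), mul_nonneg hC₁ (sq_nonneg y)]

theorem continuousOn_eKernel {b : ℝ} (hb : 0 < b) (z : ℂ) :
    ContinuousOn (eKernel b z) (Ioi 0) := by
  unfold eKernel sinhWeight
  have hb' : 0 < b⁻¹ := inv_pos.2 hb
  have h0 : ∀ y ∈ Ioi (0 : ℝ), (y : ℂ) ≠ 0 := fun y hy => by exact_mod_cast (mem_Ioi.1 hy).ne'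
  have h1 : ∀ y ∈ Ioi (0 : ℝ), Real.sinh (b⁻¹ * y) * Real.sinh (b * y) ≠ 0 := fun y hy => by
    have hy : 0 < y := hy
    have := Real.sinh_pos_iff.2 (by positivity : 0 < b⁻¹ * y)
    have := Real.sinh_pos_iff.2 (by positivity : 0 < b * y)
    positivity
  have h2 : ContinuousOn (fun y : ℝ => 1 / (Real.sinh (b⁻¹ * y) * Real.sinh (b * y))) (Ioi 0) :=
    ContinuousOn.div (by fun_prop) (by fun_prop) h1
  have h3 : ContinuousOn (fun y : ℝ =>
      ((1 / (Real.sinh (b⁻¹ * y) * Real.sinh (b * y)) : ℝ) : ℂ)) (Ioi 0) :=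
    Complex.continuous_ofReal.comp_continuousOn h2
  have h4 : ContinuousOn (fun y : ℝ => 1 / (y : ℂ)) (Ioi 0) :=
    ContinuousOn.div (by fun_prop) (by fun_prop) h0
  have h5 : ContinuousOn (fun y : ℝ => 2 * Complex.I * z / (y : ℂ)) (Ioi 0) :=
    ContinuousOn.div (by fun_prop) (by fun_prop) h0
  exact h4.mul ((((by fun_prop : Continuous fun y : ℝ =>
    1 - Complex.exp (-2 * Complex.I * y * z)).continuousOn.mul h3).sub h5).sub
    (Continuous.continuousOn (by fun_prop)))

theorem integrableOn_inv_one_add_sq (C : ℝ) :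
    IntegrableOn (fun y : ℝ => C * (1 + y ^ 2)⁻¹) (Ioi 0) :=
  (integrable_inv_one_add_sq.const_mul C).integrableOn

theorem integrableOn_eKernel {b : ℝ} (hb : 0 < b) {z : ℂ} (hz : z.im < (b + b⁻¹) / 2) :
    IntegrableOn (eKernel b z) (Ioi 0) := by
  obtain ⟨C, hC⟩ := norm_eKernel_le hb (norm_nonneg z) hz
  refine (integrableOn_inv_one_add_sq C).mono'
    ((continuousOn_eKernel hb z).aestronglyMeasurable measurableSet_Ioi) ?_
  filter_upwards [ae_restrict_mem measurableSet_Ioi] with y hy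
  exact hC z le_rfl le_rfl y hy

theorem isOpen_im_lt (c : ℝ) : IsOpen {z : ℂ | z.im < c} :=
  isOpen_lt Complex.continuous_im continuous_const

theorem differentiableOn_integral_eKernel {b : ℝ} (hb : 0 < b) :
    DifferentiableOn ℂ (fun z => ∫ y in Ioi (0 : ℝ), eKernel b z y)
      {z | z.im < (b + b⁻¹) / 2} := by
  refine differentiableOn_integral_of_dominated (isOpen_im_lt _) ?_ ?_ ?_
  · exact fun z _ => (continuousOn_eKernel hb z).aestronglyMeasurable measurableSet_Ioi
  · refine Eventually.of_forall fun y => Differentiable.differentiableOn ?_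
    unfold eKernel
    fun_prop
  · intro z₀ hz₀
    rw [mem_ofPred_eq] at hz₀
    obtain ⟨C, hC⟩ := norm_eKernel_le hb (R := ‖z₀‖ + ((b + b⁻¹) / 2 - z₀.im) / 2)
      (v := z₀.im + ((b + b⁻¹) / 2 - z₀.im) / 2) (by have := norm_nonneg z₀; linarith)
      (by linarith)
    refine ⟨((b + b⁻¹) / 2 - z₀.im) / 2, by linarith, _, integrableOn_inv_one_add_sq C, ?_⟩
    filter_upwards [ae_restrict_mem measurableSet_Ioi] with y hy z hz
    have h1 : ‖z - z₀‖ < ((b + b⁻¹) / 2 - z₀.im) / 2 := by rw [← dist_eq_norm]; exact hz.1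
    refine hC z ?_ ?_ y hy
    · linarith [norm_le_norm_add_norm_sub' z z₀]
    · have := (le_abs_self _).trans (Complex.abs_im_le_norm (z - z₀))
      rw [Complex.sub_im] at this
      linarith

theorem differentiableOn_hyperbolicEIntegral {b : ℝ} (hb : 0 < b) :
    DifferentiableOn ℂ (hyperbolicEIntegral b b⁻¹) {z | z.im < (b + b⁻¹) / 2} := by
  have h : hyperbolicEIntegral b b⁻¹ =
      fun z => Complex.exp ((1 / 4 : ℂ) * ∫ y in Ioi (0 : ℝ), eKernel b z y) :=
    funext fun z => hyperbolicEIntegral_eq hb z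
  rw [h]
  exact ((differentiableOn_integral_eKernel hb).const_mul _).cexp

theorem hyperbolicEIntegral_ne_zero {b : ℝ} (hb : 0 < b) (z : ℂ) :
    hyperbolicEIntegral b b⁻¹ z ≠ 0 := by
  rw [hyperbolicEIntegral_eq hb]
  exact Complex.exp_ne_zero _

/-! ### Difference equation of E, by Frullani and Bohr–Mollerup -/

theorem exp_sub_exp_div_nonneg_le {p q y : ℝ} (hpq : p ≤ q) (hy : 0 < y) :
    0 ≤ y⁻¹ * (Real.exp (-(p * y)) - Real.exp (-(q * y))) ∧
      y⁻¹ * (Real.exp (-(p * y)) - Real.exp (-(q * y))) ≤ (q - p) * Real.exp (-p * y) := by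
  have h1 : Real.exp (-(q * y)) ≤ Real.exp (-(p * y)) := Real.exp_le_exp.2 (by nlinarith)
  refine ⟨mul_nonneg (by positivity) (by linarith), ?_⟩
  rw [inv_mul_le_iff₀ hy]
  have h2 : Real.exp (-(q * y)) = Real.exp (-p * y) * Real.exp (-((q - p) * y)) := by
    rw [← Real.exp_add]; ring_nf
  have h3 := Real.add_one_le_exp (-((q - p) * y))
  rw [h2, ← neg_mul]
  nlinarith [Real.exp_pos (-p * y)]

theorem integrableOn_exp_sub_exp_div {p q : ℝ} (hp : 0 < p) (hq : 0 < q) :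
    IntegrableOn (fun y : ℝ => y⁻¹ * (Real.exp (-(p * y)) - Real.exp (-(q * y)))) (Ioi 0) := by
  wlog hpq : p ≤ q generalizing p q
  · refine (this hq hp (by linarith)).neg.congr (Eventually.of_forall fun y => ?_)
    simp only [Pi.neg_apply]
    ring
  have hm : AEStronglyMeasurable (fun y : ℝ => y⁻¹ * (Real.exp (-(p * y)) - Real.exp (-(q * y))))
      (volume.restrict (Ioi 0)) := by
    refine Measurable.aestronglyMeasurable ?_
    fun_prop
  refine ((integrableOn_exp_mul_Ioi (neg_lt_zero.2 hp) 0).const_mul (q - p)).mono' hm ?_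
  filter_upwards [ae_restrict_mem measurableSet_Ioi] with y hy
  obtain ⟨h1, h2⟩ := exp_sub_exp_div_nonneg_le hpq hy
  rwa [Real.norm_of_nonneg h1]

theorem integral_exp_sub_exp_div {p q : ℝ} (hp : 0 < p) (hq : 0 < q) :
    ∫ y in Ioi (0 : ℝ), y⁻¹ * (Real.exp (-(p * y)) - Real.exp (-(q * y))) = Real.log (q / p) := by
  have h := Frullani.integral_Ioi_eq (f := fun x : ℝ => Real.exp (-x)) (L := 1) (R := 0)
    (by exact (Continuous.locallyIntegrable (by fun_prop)).locallyIntegrableOn _) hp hq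
    (by
      have : Continuous fun x : ℝ => Real.exp (-x) := by fun_prop
      simpa using (this.tendsto 0).mono_left nhdsWithin_le_nhds)
    (Real.tendsto_exp_neg_atTop_nhds_zero) (integrableOn_exp_sub_exp_div hp hq)
  simpa using h

/-- The integrand of `log E(z + ib/2) - log E(z - ib/2)` at `z = -i (x - 1/2) / b`. -/
def eStepKernel (b x y : ℝ) : ℝ :=
  1 / y * (-(2 * (Real.exp (-(2 * y * (x - 1 / 2) / b)) / Real.sinh (b⁻¹ * y))) + 2 * b / y
    - 2 * (x - 1 / 2) * (Real.exp (-2 * b⁻¹ * y) + Real.exp (-2 * b * y)))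

/-- The point of the imaginary axis with `1/2 + i b z = s`. -/
def eStepPoint (b : ℝ) (s : ℂ) : ℂ := -Complex.I * (s - 1 / 2) / b

theorem ofReal_eStepKernel {b : ℝ} (hb : 0 < b) (x : ℝ) {y : ℝ} (hy : 0 < y) :
    (eStepKernel b x y : ℂ) = eKernel b (eStepPoint b x + Complex.I * b / 2) y -
      eKernel b (eStepPoint b x - Complex.I * b / 2) y := by
  have hb' : (b : ℂ) ≠ 0 := by exact_mod_cast hb.ne'
  have hy' : (y : ℂ) ≠ 0 := by exact_mod_cast hy.ne'
  have e1 : Complex.exp (-2 * Complex.I * y * (eStepPoint b x + Complex.I * b / 2)) =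
      Complex.exp (-(2 * y * (x - 1 / 2) / b)) * Complex.exp (b * y) := by
    rw [← Complex.exp_add]
    congr 1
    unfold eStepPoint
    field_simp
    ring_nf
    simp only [Complex.I_sq]
    ring
  have e2 : Complex.exp (-2 * Complex.I * y * (eStepPoint b x - Complex.I * b / 2)) =
      Complex.exp (-(2 * y * (x - 1 / 2) / b)) * Complex.exp (-(b * y)) := by
    rw [← Complex.exp_add]
    congr 1
    unfold eStepPoint
    field_simp
    ring_nf
    simp only [Complex.I_sq]
    ring
  have hs1 : Complex.sinh (b * y) ≠ 0 := by
    rw [← Complex.ofReal_mul, ← Complex.ofReal_sinh]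
    exact_mod_cast (Real.sinh_pos_iff.2 (by positivity)).ne'
  have hs2 : Complex.sinh ((b : ℂ)⁻¹ * y) ≠ 0 := by
    rw [← Complex.ofReal_inv, ← Complex.ofReal_mul, ← Complex.ofReal_sinh]
    exact_mod_cast (Real.sinh_pos_iff.2 (by positivity)).ne'
  have e3 : Complex.exp (b * y) = Complex.exp (-(b * y)) + 2 * Complex.sinh (b * y) := by
    rw [Complex.sinh]; ring
  unfold eKernel eStepKernel sinhWeight
  rw [e1, e2, e3]
  push_cast
  generalize Complex.exp (-2 * (b : ℂ)⁻¹ * y) = A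
  generalize Complex.exp (-2 * (b : ℂ) * y) = B
  generalize Complex.exp (-(2 * (y : ℂ) * (x - 1 / 2) / b)) = W
  generalize Complex.exp (-((b : ℂ) * y)) = V
  generalize Complex.sinh ((b : ℂ) * y) = s1 at *
  generalize Complex.sinh ((b : ℂ)⁻¹ * y) = s2 at *
  unfold eStepPoint
  field_simp
  ring_nf
  simp only [Complex.I_sq]
  ring

theorem eStepPoint_im {b : ℝ} (s : ℂ) : (eStepPoint b s).im = -((s.re - 1 / 2) / b) := by
  unfold eStepPoint
  rw [Complex.div_ofReal_im]
  simp
  ring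

theorem eStepPoint_add_im_lt {b : ℝ} (hb : 0 < b) {s : ℂ} (hs : 0 < s.re) :
    (eStepPoint b s + Complex.I * b / 2).im < (b + b⁻¹) / 2 := by
  have h : (Complex.I * b / 2 : ℂ).im = b / 2 := by simp
  rw [Complex.add_im, eStepPoint_im, h]
  have : -((s.re - 1 / 2) / b) = b⁻¹ / 2 - s.re / b := by field_simp; ring
  have h2 : 0 < s.re / b := by positivity
  linarith

theorem eStepPoint_sub_im_lt {b : ℝ} (hb : 0 < b) {s : ℂ} (hs : 0 < s.re) :
    (eStepPoint b s - Complex.I * b / 2).im < (b + b⁻¹) / 2 := by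
  have h : (Complex.I * b / 2 : ℂ).im = b / 2 := by simp
  have := eStepPoint_add_im_lt hb hs
  rw [Complex.add_im] at this
  rw [Complex.sub_im]
  linarith

theorem integrableOn_eStepKernel {b : ℝ} (hb : 0 < b) {x : ℝ} (hx : 0 < x) :
    IntegrableOn (eStepKernel b x) (Ioi 0) := by
  have h := (integrableOn_eKernel hb (eStepPoint_add_im_lt hb (s := x) (by simpa))).sub
    (integrableOn_eKernel hb (eStepPoint_sub_im_lt hb (s := x) (by simpa)))
  refine h.re.congr ?_
  filter_upwards [ae_restrict_mem measurableSet_Ioi] with y hy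
  rw [Pi.sub_apply, ← ofReal_eStepKernel hb x hy]
  exact Complex.ofReal_re _

/-- Minus the logarithm of `E(z + ib/2) / E(z - ib/2)` at `z = -i (x - 1/2) / b`. -/
def eStepLog (b x : ℝ) : ℝ := -(1 / 4 * ∫ y in Ioi (0 : ℝ), eStepKernel b x y)

theorem hyperbolicEIntegral_step_real {b : ℝ} (hb : 0 < b) {x : ℝ} (hx : 0 < x) :
    hyperbolicEIntegral b b⁻¹ (eStepPoint b x + Complex.I * b / 2) =
      Real.exp (-eStepLog b x) *
        hyperbolicEIntegral b b⁻¹ (eStepPoint b x - Complex.I * b / 2) := by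
  have h1 := integrableOn_eKernel hb (eStepPoint_add_im_lt hb (s := x) (by simpa))
  have h2 := integrableOn_eKernel hb (eStepPoint_sub_im_lt hb (s := x) (by simpa))
  have h3 : ((∫ y in Ioi (0 : ℝ), eStepKernel b x y : ℝ) : ℂ) =
      (∫ y in Ioi (0 : ℝ), eKernel b (eStepPoint b x + Complex.I * b / 2) y) -
        ∫ y in Ioi (0 : ℝ), eKernel b (eStepPoint b x - Complex.I * b / 2) y := by
    rw [← integral_sub h1 h2, ← integral_complex_ofReal]
    refine setIntegral_congr_fun measurableSet_Ioi fun y hy => ?_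
    exact ofReal_eStepKernel hb x hy
  rw [hyperbolicEIntegral_eq hb, hyperbolicEIntegral_eq hb, Complex.ofReal_exp, ← Complex.exp_add,
    eStepLog, neg_neg, Complex.ofReal_mul, h3]
  congr 1
  push_cast
  ring

/-- Up to terms affine in x, minus the kernel is a positive multiple of an exponential of an affine
function of x. -/
theorem convexOn_neg_eStepKernel {b : ℝ} (hb : 0 < b) {y : ℝ} (hy : 0 < y) :
    ConvexOn ℝ univ (fun x => -eStepKernel b x y) := by
  have hs := Real.sinh_pos_iff.2 (by positivity : 0 < b⁻¹ * y)
  have h1 : ConvexOn ℝ univ (fun x : ℝ => Real.exp (-(2 * y * (x - 1 / 2) / b))) := by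
    have := convexOn_exp.comp_affineMap (AffineMap.lineMap (y / b) (-y / b) : ℝ →ᵃ[ℝ] ℝ)
    refine this.congr ?_
    intro x _
    simp only [Function.comp, AffineMap.lineMap_apply, vsub_eq_sub, smul_eq_mul, vadd_eq_add]
    congr 1
    field_simp
    ring
  have h2 := (h1.smul (by positivity : 0 ≤ 1 / y * (2 / Real.sinh (b⁻¹ * y))))
  have h3 : ConvexOn ℝ univ (fun x : ℝ => 2 / y * (Real.exp (-2 * b⁻¹ * y) +
      Real.exp (-2 * b * y)) * x + (-(2 * b / y ^ 2) - 1 / y * (Real.exp (-2 * b⁻¹ * y) +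
      Real.exp (-2 * b * y)))) := by
    refine ⟨convex_univ, fun x _ x' _ p q _ _ hpq => le_of_eq ?_⟩
    simp only [smul_eq_mul]
    obtain rfl : q = 1 - p := by linarith
    ring
  refine (h2.add h3).congr fun x _ => ?_
  simp only [Pi.add_apply, smul_eq_mul, eStepKernel]
  field_simp
  ring

theorem convexOn_eStepLog {b : ℝ} (hb : 0 < b) : ConvexOn ℝ (Ioi 0) (eStepLog b) := by
  refine ⟨convex_Ioi 0, fun x hx x' hx' p q hp hq hpq => ?_⟩
  have i1 := integrableOn_eStepKernel hb hx
  have i2 := integrableOn_eStepKernel hb hx'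
  have i3 := integrableOn_eStepKernel hb (convex_Ioi (0 : ℝ) hx hx' hp hq hpq)
  have : ∫ y in Ioi (0 : ℝ), -eStepKernel b (p • x + q • x') y ≤
      ∫ y in Ioi (0 : ℝ), (p * -eStepKernel b x y + q * -eStepKernel b x' y) := by
    refine setIntegral_mono_on i3.neg ((i1.neg.const_mul p).add (i2.neg.const_mul q))
      measurableSet_Ioi fun y hy => ?_
    exact (convexOn_neg_eStepKernel hb hy).2 (mem_univ x) (mem_univ x') hp hq hpq
  have hi := integral_add (i1.neg.const_mul p) (i2.neg.const_mul q)
  simp only [Pi.neg_apply] at hi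
  rw [hi, integral_const_mul, integral_const_mul, integral_neg, integral_neg, integral_neg] at this
  simp only [eStepLog, smul_eq_mul] at this ⊢
  linarith

/-- Since exp(y/b) - exp(-y/b) = 2 sinh(y/b), the hyperbolic denominator cancels in the difference
of the two kernels. Two Frullani integrands remain, contributing 2 log x and 2(log x - 2 log b). -/
theorem eStepLog_add_one {b : ℝ} (hb : 0 < b) {x : ℝ} (hx : 0 < x) :
    eStepLog b (x + 1) = eStepLog b x + Real.log x - Real.log b := by
  have i1 := integrableOn_eStepKernel hb hx
  have i2 := integrableOn_eStepKernel hb (by linarith : 0 < x + 1)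
  have hb' : 0 < b⁻¹ := inv_pos.2 hb
  have p1 : 0 < 2 * x * b⁻¹ := by positivity
  have p2 : 0 < 2 * b⁻¹ := by positivity
  have p3 : 0 < 2 * b := by positivity
  have key : ∫ y in Ioi (0 : ℝ), (eStepKernel b x y - eStepKernel b (x + 1) y) =
      ∫ y in Ioi (0 : ℝ), (2 * (y⁻¹ * (Real.exp (-(2 * b⁻¹ * y)) - Real.exp (-(2 * x * b⁻¹ * y)))) +
        2 * (y⁻¹ * (Real.exp (-(2 * b * y)) - Real.exp (-(2 * x * b⁻¹ * y))))) := by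
    refine setIntegral_congr_fun measurableSet_Ioi fun y hy => ?_
    have hy : 0 < y := hy
    have hs := Real.sinh_pos_iff.2 (by positivity : 0 < b⁻¹ * y)
    have e1 : Real.exp (-(2 * y * (x - 1 / 2) / b)) =
        Real.exp (-(2 * x * b⁻¹ * y)) * Real.exp (b⁻¹ * y) := by
      rw [← Real.exp_add]; congr 1; field_simp; ring
    have e2 : Real.exp (-(2 * y * (x + 1 - 1 / 2) / b)) =
        Real.exp (-(2 * x * b⁻¹ * y)) * Real.exp (-(b⁻¹ * y)) := by
      rw [← Real.exp_add]; congr 1; field_simp; ring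
    have e3 : Real.exp (b⁻¹ * y) = Real.exp (-(b⁻¹ * y)) + 2 * Real.sinh (b⁻¹ * y) := by
      rw [Real.sinh_eq]; ring
    simp only [eStepKernel]
    rw [e1, e2, e3]
    simp only [neg_mul]
    field_simp
    ring
  have hi := integral_add ((integrableOn_exp_sub_exp_div p2 p1).const_mul 2)
    ((integrableOn_exp_sub_exp_div p3 p1).const_mul 2)
  rw [integral_sub i1 i2, hi, integral_const_mul, integral_const_mul,
    integral_exp_sub_exp_div p2 p1, integral_exp_sub_exp_div p3 p1] at key
  have l1 : Real.log (2 * x * b⁻¹ / (2 * b⁻¹)) = Real.log x := by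
    congr 1; field_simp
  have l2 : Real.log (2 * x * b⁻¹ / (2 * b)) = Real.log x - 2 * Real.log b := by
    rw [show 2 * x * b⁻¹ / (2 * b) = x / b ^ 2 by field_simp, Real.log_div hx.ne' (by positivity),
      Real.log_pow]
    norm_num
  rw [l1, l2] at key
  unfold eStepLog
  linarith

/-- Bohr–Mollerup for `eStepLog` corrected by an affine function of x: the correction removes log b
from the functional equation and normalises the value at 1. The constant `eStepLog b 1` is never
evaluated, as it only enters through the constant k of s_b, which cancels in the end. -/
theorem exp_neg_eStepLog {b : ℝ} (hb : 0 < b) {x : ℝ} (hx : 0 < x) :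
    Real.exp (-eStepLog b x) =
      Real.exp (x * Real.log b - (eStepLog b 1 + Real.log b)) * (Real.Gamma x)⁻¹ := by
  set f : ℝ → ℝ := fun x => Real.exp (eStepLog b x + (x * Real.log b -
    (eStepLog b 1 + Real.log b))) with hf
  have h := Real.eq_Gamma_of_log_convex (f := f) ?_ ?_ (fun _ => Real.exp_pos _) ?_
  · rw [← h hx, hf, ← Real.exp_neg, ← Real.exp_add]
    congr 1
    ring
  · have h1 : ConvexOn ℝ (Ioi (0 : ℝ)) (fun x : ℝ => x * Real.log b -
        (eStepLog b 1 + Real.log b)) := by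
      refine ⟨convex_Ioi 0, fun x _ x' _ p q _ _ hpq => le_of_eq ?_⟩
      simp only [smul_eq_mul]
      obtain rfl : q = 1 - p := by linarith
      ring
    refine ((convexOn_eStepLog hb).add h1).congr fun x _ => ?_
    simp [hf]
  · intro y hy
    simp only [hf]
    rw [eStepLog_add_one hb hy, ← Real.exp_log hy, ← Real.exp_add, Real.exp_log hy]
    congr 1
    ring
  · simp [hf]

theorem frequently_nhdsNE_of_real {P : ℂ → Prop} {x₀ : ℝ} (h : ∀ᶠ x : ℝ in 𝓝 x₀, P x) :
    ∃ᶠ z in 𝓝[≠] (x₀ : ℂ), P z := by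
  have ht : Tendsto (fun x : ℝ => (x : ℂ)) (𝓝[≠] x₀) (𝓝[≠] (x₀ : ℂ)) := by
    refine tendsto_nhdsWithin_of_tendsto_nhds_of_eventually_within _
      ((Complex.continuous_ofReal.tendsto x₀).mono_left nhdsWithin_le_nhds) ?_
    filter_upwards [self_mem_nhdsWithin] with x hx
    simpa using hx
  exact ht.frequently (h.filter_mono nhdsWithin_le_nhds).frequently

/-- The exponential factor in the difference equation of `E`. -/
def eStepFactor (b : ℝ) (z : ℂ) : ℂ :=
  Complex.exp ((1 / 2 + Complex.I * b * z) * Real.log b - (eStepLog b 1 + Real.log b : ℝ))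

/-- In the variable s = 1/2 + ibz the condition on Im z is Re s > 0. Both sides are holomorphic in
this half-plane and agree at positive real s. -/
theorem hyperbolicEIntegral_step {b : ℝ} (hb : 0 < b) {z : ℂ} (hz : z.im < b⁻¹ / 2) :
    hyperbolicEIntegral b b⁻¹ (z + Complex.I * b / 2) =
      eStepFactor b z * (Complex.Gamma (1 / 2 + Complex.I * b * z))⁻¹ *
        hyperbolicEIntegral b b⁻¹ (z - Complex.I * b / 2) := by
  have hbC : (b : ℂ) ≠ 0 := by exact_mod_cast hb.ne'
  set U : Set ℂ := {s | 0 < s.re} with hU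
  have hUo : IsOpen U := isOpen_lt continuous_const Complex.continuous_re
  have hUc : IsPreconnected U := (convex_halfSpace_re_gt 0).isPreconnected
  have hpt : Differentiable ℂ (eStepPoint b) := by unfold eStepPoint; fun_prop
  have hE := differentiableOn_hyperbolicEIntegral hb
  have hf : AnalyticOnNhd ℂ (fun s => hyperbolicEIntegral b b⁻¹
      (eStepPoint b s + Complex.I * b / 2)) U := by
    refine DifferentiableOn.analyticOnNhd (hE.comp (by fun_prop) fun s hs => ?_) hUo
    exact eStepPoint_add_im_lt hb hs
  have hg : AnalyticOnNhd ℂ (fun s => eStepFactor b (eStepPoint b s) *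
      (Complex.Gamma (1 / 2 + Complex.I * b * eStepPoint b s))⁻¹ * hyperbolicEIntegral b b⁻¹
      (eStepPoint b s - Complex.I * b / 2)) U := by
    refine DifferentiableOn.analyticOnNhd (DifferentiableOn.mul ?_ (hE.comp (by fun_prop)
      fun s hs => ?_)) hUo
    · refine Differentiable.differentiableOn ?_
      refine Differentiable.mul ?_ ?_
      · unfold eStepFactor; fun_prop
      · exact Complex.differentiable_one_div_Gamma.comp (by fun_prop :
          Differentiable ℂ fun s => 1 / 2 + Complex.I * b * eStepPoint b s)
    · exact eStepPoint_sub_im_lt hb hs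
  have hinv : ∀ s, 1 / 2 + Complex.I * b * eStepPoint b s = s := by
    intro s
    unfold eStepPoint
    field_simp
    ring_nf
    simp only [Complex.I_sq]
    ring
  have heq := hf.eqOn_of_preconnected_of_frequently_eq hg hUc (z₀ := ((1 : ℝ) : ℂ))
    (by simp [hU]) ?_
  · have hs : 1 / 2 + Complex.I * b * z ∈ U := by
      simp only [hU, mem_ofPred_eq]
      have : (Complex.I * b * z).re = -(b * z.im) := by simp
      rw [Complex.add_re, this]
      have : b * z.im < b * (b⁻¹ / 2) := by gcongr
      have h2 : b * (b⁻¹ / 2) = 1 / 2 := by field_simp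
      norm_num
      linarith
    have h := heq hs
    have hz' : eStepPoint b (1 / 2 + Complex.I * b * z) = z := by
      unfold eStepPoint
      field_simp
      ring_nf
      simp only [Complex.I_sq]
      ring
    simpa only [hz'] using h
  · refine frequently_nhdsNE_of_real ?_
    filter_upwards [lt_mem_nhds (zero_lt_one (α := ℝ))] with x hx
    rw [hyperbolicEIntegral_step_real hb hx, exp_neg_eStepLog hb hx, hinv]
    simp only [eStepFactor, hinv]
    push_cast [Complex.Gamma_ofReal]
    rfl

/-! ### Uniqueness of the meromorphic continuation; E is entire -/

/-- The difference has infinite order at one point, hence at every point of the connected plane.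
Normal forms that agree on a punctured neighbourhood also agree at its centre. -/
theorem eq_of_meromorphicNFOn_of_frequently_eq {f g : ℂ → ℂ} (hf : MeromorphicNFOn f univ)
    (hg : MeromorphicNFOn g univ) {z₀ : ℂ} (h : ∃ᶠ z in 𝓝[≠] z₀, f z = g z) : f = g := by
  have hd : MeromorphicOn (f - g) univ := hf.meromorphicOn.sub hg.meromorphicOn
  have h₀ : meromorphicOrderAt (f - g) z₀ = ⊤ := by
    rw [meromorphicOrderAt_eq_top_iff]
    have := ((hf.meromorphicOn z₀ trivial).frequently_eq_iff_eventuallyEq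
      (hg.meromorphicOn z₀ trivial)).1 h
    filter_upwards [this] with z hz
    simp [hz]
  ext z
  have h₁ : meromorphicOrderAt (f - g) z = ⊤ := by
    by_contra hne
    exact hd.meromorphicOrderAt_ne_top_of_isPreconnected isPreconnected_univ (mem_univ z)
      (mem_univ z₀) hne h₀
  rw [meromorphicOrderAt_eq_top_iff] at h₁
  have h₂ : f =ᶠ[𝓝[≠] z] g := by
    filter_upwards [h₁] with w hw
    simpa [sub_eq_zero] using hw
  exact (((hf trivial).eventuallyEq_nhdsNE_iff_eventuallyEq_nhds (hg trivial)).1 h₂).eq_of_nhds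

theorem meromorphicContinuation_eq {U : Set ℂ} {f g : ℂ → ℂ} (hg : MeromorphicNFOn g univ)
    (hfg : EqOn g f U) {z₀ : ℂ} (hU : ∃ᶠ z in 𝓝[≠] z₀, z ∈ U) :
    meromorphicContinuation U f = g := by
  have h : ∃ g : ℂ → ℂ, MeromorphicNFOn g univ ∧ EqOn g f U := ⟨g, hg, hfg⟩
  unfold meromorphicContinuation
  rw [dif_pos h]
  refine eq_of_meromorphicNFOn_of_frequently_eq h.choose_spec.1 hg (z₀ := z₀) (hU.mono ?_)
  intro z hz
  rw [h.choose_spec.2 hz, hfg hz]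

/-- The quotient `E(z + ib/2) / E(z - ib/2)`. -/
def eStep (b : ℝ) (z : ℂ) : ℂ :=
  eStepFactor b z * (Complex.Gamma (1 / 2 + Complex.I * b * z))⁻¹

theorem differentiable_eStep (b : ℝ) : Differentiable ℂ (eStep b) := by
  refine Differentiable.mul (by unfold eStepFactor; fun_prop) ?_
  exact Complex.differentiable_one_div_Gamma.comp (by fun_prop :
    Differentiable ℂ fun z : ℂ => 1 / 2 + Complex.I * b * z)

/-- The continuation of `E` to `Im z < Q / 2 + n b` by means of its difference equation. -/
def eExtend (b : ℝ) : ℕ → ℂ → ℂ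
  | 0, z => hyperbolicEIntegral b b⁻¹ z
  | n + 1, z => eStep b (z - Complex.I * b / 2) * eExtend b n (z - Complex.I * b)

theorem differentiableOn_eExtend {b : ℝ} (hb : 0 < b) (n : ℕ) :
    DifferentiableOn ℂ (eExtend b n) {z | z.im < (b + b⁻¹) / 2 + n * b} := by
  induction n with
  | zero =>
    simpa [eExtend] using differentiableOn_hyperbolicEIntegral hb
  | succ n ih =>
    refine DifferentiableOn.mul ?_ (ih.comp (by fun_prop) ?_)
    · exact ((differentiable_eStep b).comp (by fun_prop :
        Differentiable ℂ fun z : ℂ => z - Complex.I * b / 2)).differentiableOn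
    · intro z hz
      simp only [mem_ofPred_eq] at hz ⊢
      push_cast at hz
      simp
      linarith

theorem eExtend_succ_eq {b : ℝ} (hb : 0 < b) (n : ℕ) {z : ℂ}
    (hz : z.im < (b + b⁻¹) / 2 + n * b) : eExtend b (n + 1) z = eExtend b n z := by
  induction n generalizing z with
  | zero =>
    have h := hyperbolicEIntegral_step hb (z := z - Complex.I * b / 2) (by
      simp at hz ⊢
      linarith)
    rw [sub_add_cancel, sub_sub, add_halves] at h
    exact h.symm
  | succ n ih =>
    have : (z - Complex.I * b).im < (b + b⁻¹) / 2 + n * b := by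
      push_cast at hz
      simp
      linarith
    rw [eExtend, ih this]
    rfl

theorem eExtend_eq_of_le {b : ℝ} (hb : 0 < b) {m n : ℕ} (hmn : m ≤ n) {z : ℂ}
    (hz : z.im < (b + b⁻¹) / 2 + m * b) : eExtend b n z = eExtend b m z := by
  induction n, hmn using Nat.le_induction with
  | base => rfl
  | succ n hmn ih =>
    rw [eExtend_succ_eq hb n, ih]
    refine hz.trans_le ?_
    have : (m : ℝ) ≤ n := by exact_mod_cast hmn
    gcongr

theorem im_lt_ceil {b : ℝ} (hb : 0 < b) (z : ℂ) :
    z.im < (b + b⁻¹) / 2 + (⌈z.im / b⌉₊ : ℝ) * b := by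
  have h := Nat.le_ceil (z.im / b)
  rw [div_le_iff₀ hb] at h
  have : 0 < b⁻¹ := inv_pos.2 hb
  linarith

theorem eExtend_ceil_eq {b : ℝ} (hb : 0 < b) {n : ℕ} {z : ℂ} (hz : z.im ≤ n * b) :
    eExtend b ⌈z.im / b⌉₊ z = eExtend b n z := by
  refine (eExtend_eq_of_le hb ?_ (im_lt_ceil hb z)).symm
  rw [Nat.ceil_le, div_le_iff₀ hb]
  exact hz

/-- The number of steps jumps with Im z, but by `eExtend_eq_of_le` taking more steps does not change
the value, so near each point a single `eExtend b n` describes the function. -/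
theorem hyperbolicE_eq_eExtend_ceil {b : ℝ} (hb : 0 < b) :
    hyperbolicE b b⁻¹ = fun z => eExtend b ⌈z.im / b⌉₊ z := by
  have hb' : 0 < b⁻¹ := inv_pos.2 hb
  refine meromorphicContinuation_eq (z₀ := 0) ?_ ?_ ?_
  · refine AnalyticOnNhd.meromorphicNFOn fun z₀ _ => ?_
    -- One more than the ceiling, so that the same n serves a whole neighbourhood of z₀.
    set n := ⌈z₀.im / b⌉₊ + 1 with hn
    have hz₀ : z₀.im < n * b := by
      have h := Nat.le_ceil (z₀.im / b)
      rw [div_le_iff₀ hb] at h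
      rw [hn]; push_cast; linarith
    have han : AnalyticAt ℂ (eExtend b n) z₀ :=
      (differentiableOn_eExtend hb n).analyticAt ((isOpen_im_lt _).mem_nhds
        (by rw [mem_ofPred_eq]; linarith))
    refine han.congr ?_
    filter_upwards [(isOpen_im_lt (n * b)).mem_nhds hz₀] with z hz
    exact (eExtend_ceil_eq hb (le_of_lt hz)).symm
  · intro z hz
    refine eExtend_eq_of_le hb (Nat.zero_le _) ?_
    simpa [add_comm] using hz
  · refine Eventually.frequently ?_
    refine Eventually.filter_mono nhdsWithin_le_nhds ((isOpen_im_lt _).mem_nhds ?_)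
    simp only [mem_ofPred_eq, Complex.zero_im]
    positivity

theorem hyperbolicE_eq_eExtend {b : ℝ} (hb : 0 < b) {n : ℕ} {z : ℂ} (hz : z.im ≤ n * b) :
    hyperbolicE b b⁻¹ z = eExtend b n z := by
  rw [hyperbolicE_eq_eExtend_ceil hb, ← eExtend_ceil_eq hb hz]

theorem exists_nat_im_le {b : ℝ} (hb : 0 < b) (c : ℝ) : ∃ n : ℕ, c < n * b := by
  obtain ⟨n, hn⟩ := exists_nat_gt (c / b)
  exact ⟨n, by rwa [div_lt_iff₀ hb] at hn⟩

theorem differentiable_hyperbolicE {b : ℝ} (hb : 0 < b) :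
    Differentiable ℂ (hyperbolicE b b⁻¹) := by
  have hb' : 0 < b⁻¹ := inv_pos.2 hb
  intro z₀
  obtain ⟨n, hn⟩ := exists_nat_im_le hb z₀.im
  have h := (differentiableOn_eExtend hb n).differentiableAt ((isOpen_im_lt _).mem_nhds
        (by rw [mem_ofPred_eq]; linarith) : _ ∈ 𝓝 z₀)
  refine h.congr_of_eventuallyEq ?_
  filter_upwards [(isOpen_im_lt (n * b)).mem_nhds hn] with z hz
  exact hyperbolicE_eq_eExtend hb (le_of_lt hz)

theorem hyperbolicE_eq_integral {b : ℝ} (hb : 0 < b) {z : ℂ} (hz : z.im < (b + b⁻¹) / 2) :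
    hyperbolicE b b⁻¹ z = hyperbolicEIntegral b b⁻¹ z := by
  rw [hyperbolicE_eq_eExtend_ceil hb]
  exact eExtend_eq_of_le hb (Nat.zero_le _) (by simpa using hz)

theorem hyperbolicE_ne_zero_of_im_lt {b : ℝ} (hb : 0 < b) {z : ℂ} (hz : z.im < (b + b⁻¹) / 2) :
    hyperbolicE b b⁻¹ z ≠ 0 := by
  rw [hyperbolicE_eq_integral hb hz]
  exact hyperbolicEIntegral_ne_zero hb z

theorem hyperbolicE_step {b : ℝ} (hb : 0 < b) (z : ℂ) :
    hyperbolicE b b⁻¹ (z + Complex.I * b / 2) =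
      eStep b z * hyperbolicE b b⁻¹ (z - Complex.I * b / 2) := by
  obtain ⟨n, hn⟩ := exists_nat_im_le hb z.im
  rw [hyperbolicE_eq_eExtend hb (n := n + 1), hyperbolicE_eq_eExtend hb (n := n), eExtend]
  · congr 2 <;> ring
  · simp; linarith
  · simp; linarith

/-! ### The function s_b and its difference equation -/

theorem sFun_eq (b : ℝ) (z : ℂ) : sFun b z = hyperbolicE b b⁻¹ z / hyperbolicE b b⁻¹ (-z) := by
  unfold sFun gFun
  rw [neg_neg, one_div, one_div, div_inv_eq_mul, mul_comm, div_eq_mul_inv]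

/-- Valid at zeros and poles too, because 0⁻¹ = 0. It lets the denominators of the integrand be
written as factors in -x. -/
theorem sFun_neg (b : ℝ) (z : ℂ) : sFun b (-z) = (sFun b z)⁻¹ := by
  rw [sFun_eq, sFun_eq, neg_neg, inv_div]

theorem sFun_inv (b : ℝ) : sFun b⁻¹ = sFun b := by
  ext z
  rw [sFun_eq, sFun_eq, hyperbolicE_inv]

theorem Qpar_inv (b : ℝ) : Qpar b⁻¹ = Qpar b := by
  unfold Qpar
  rw [inv_inv, add_comm]

theorem Qpar_pos {b : ℝ} (hb : 0 < b) : 0 < Qpar b := by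
  have : 0 < b⁻¹ := inv_pos.2 hb
  unfold Qpar; positivity

theorem sFun_ne_zero {b : ℝ} (hb : 0 < b) {z : ℂ} (h1 : -(Qpar b / 2) < z.im)
    (h2 : z.im < Qpar b / 2) : sFun b z ≠ 0 := by
  rw [sFun_eq]
  refine div_ne_zero (hyperbolicE_ne_zero_of_im_lt hb h2) (hyperbolicE_ne_zero_of_im_lt hb ?_)
  rw [Complex.neg_im]
  unfold Qpar at h1
  linarith

theorem isOpen_im_gt (c : ℝ) : IsOpen {z : ℂ | c < z.im} :=
  isOpen_lt continuous_const Complex.continuous_im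

theorem differentiableAt_sFun {b : ℝ} (hb : 0 < b) {z : ℂ} (hz : -(Qpar b / 2) < z.im) :
    DifferentiableAt ℂ (sFun b) z := by
  rw [show sFun b = fun z => hyperbolicE b b⁻¹ z / hyperbolicE b b⁻¹ (-z) from
    funext (sFun_eq b)]
  have hE := differentiable_hyperbolicE hb
  refine (hE z).div ((hE.comp differentiable_neg) z) (hyperbolicE_ne_zero_of_im_lt hb ?_)
  rw [Complex.neg_im]
  unfold Qpar at hz
  linarith

/-- The constant `k` in `s_b(z + ib/2) = k cosh(π b z) s_b(z - ib/2)`. -/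
def sStepConst (b : ℝ) : ℂ :=
  Complex.exp (Real.log b - 2 * (eStepLog b 1 + Real.log b : ℝ)) / Real.pi

theorem sStepConst_ne_zero (b : ℝ) : sStepConst b ≠ 0 :=
  div_ne_zero (Complex.exp_ne_zero _) (by exact_mod_cast Real.pi_ne_zero)

theorem Gamma_inv_mul_Gamma_inv (u : ℂ) :
    (Complex.Gamma (1 / 2 + u))⁻¹ * (Complex.Gamma (1 / 2 - u))⁻¹ =
      Complex.cos (Real.pi * u) / Real.pi := by
  have h := Complex.Gamma_mul_Gamma_one_sub (1 / 2 + u)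
  rw [show 1 - (1 / 2 + u) = 1 / 2 - u by ring] at h
  rw [← mul_inv, h, inv_div]
  congr 1
  rw [← Complex.sin_add_pi_div_two]
  congr 1
  ring

theorem eStep_mul_eStep_neg (b : ℝ) (u : ℂ) :
    eStep b u * eStep b (-u) = sStepConst b * Complex.cosh (Real.pi * b * u) := by
  unfold eStep
  have h := Gamma_inv_mul_Gamma_inv (Complex.I * b * u)
  rw [show (1 / 2 - Complex.I * b * u) = 1 / 2 + Complex.I * b * (-u) by ring] at h
  rw [mul_mul_mul_comm, h, eStepFactor, eStepFactor, ← Complex.exp_add, sStepConst,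
    show (Real.pi : ℂ) * (Complex.I * b * u) = Real.pi * b * u * Complex.I by ring,
    Complex.cos_mul_I, mul_div_assoc', div_mul_eq_mul_div]
  congr 3
  ring

/-- Divide the equation of E centred at z + ib/2 by the one centred at the opposite point;
reflection turns the product of reciprocal Gamma values into a hyperbolic cosine. -/
theorem sFun_step {b : ℝ} (hb : 0 < b) {z : ℂ} (hz : -(Qpar b / 2) < z.im) :
    sFun b (z + Complex.I * b) =
      sStepConst b * Complex.cosh (Real.pi * b * (z + Complex.I * b / 2)) * sFun b z := by
  have h1 := hyperbolicE_step hb (z + Complex.I * b / 2)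
  have h2 := hyperbolicE_step hb (-(z + Complex.I * b / 2))
  rw [show z + Complex.I * b / 2 + Complex.I * b / 2 = z + Complex.I * b by ring,
    show z + Complex.I * b / 2 - Complex.I * b / 2 = z by ring] at h1
  rw [show -(z + Complex.I * b / 2) + Complex.I * b / 2 = -z by ring,
    show -(z + Complex.I * b / 2) - Complex.I * b / 2 = -(z + Complex.I * b) by ring] at h2
  have h3 : hyperbolicE b b⁻¹ (-z) ≠ 0 := by
    refine hyperbolicE_ne_zero_of_im_lt hb ?_
    rw [Complex.neg_im]
    unfold Qpar at hz
    linarith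
  -- E(-z) is nonzero and contains the step factor at -(z + ib/2), so this factor may be cancelled.
  have h4 := h3
  rw [h2] at h4
  rw [sFun_eq, sFun_eq, h1, h2, ← eStep_mul_eStep_neg]
  have h5 := left_ne_zero_of_mul h4
  have h6 := right_ne_zero_of_mul h4
  rw [mul_div_assoc, mul_assoc]
  congr 1
  rw [mul_div_assoc', mul_div_mul_left _ _ h5]

/-! ### Growth of s_b in horizontal strips -/

theorem one_sub_cos_div_sq_nonneg_le (x : ℝ) {y : ℝ} (hy : 0 < y) :
    0 ≤ (1 - Real.cos (2 * x * y)) / y ^ 2 ∧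
      (1 - Real.cos (2 * x * y)) / y ^ 2 ≤ (2 * x ^ 2 + 2) * (1 + y ^ 2)⁻¹ := by
  have h1 := Real.cos_le_one (2 * x * y)
  have h2 := Real.neg_one_le_cos (2 * x * y)
  have h3 := Real.one_sub_sq_div_two_le_cos (x := 2 * x * y)
  refine ⟨div_nonneg (by linarith) (by positivity), ?_⟩
  rw [← div_eq_mul_inv, div_le_div_iff₀ (by positivity) (by positivity)]
  nlinarith [sq_nonneg y]

theorem integrableOn_one_sub_cos_div_sq (x : ℝ) :
    IntegrableOn (fun y : ℝ => (1 - Real.cos (2 * x * y)) / y ^ 2) (Ioi 0) := by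
  refine (integrableOn_inv_one_add_sq (2 * x ^ 2 + 2)).mono'
    (Measurable.aestronglyMeasurable (by fun_prop)) ?_
  filter_upwards [ae_restrict_mem measurableSet_Ioi] with y hy
  obtain ⟨h1, h2⟩ := one_sub_cos_div_sq_nonneg_le x hy
  rwa [Real.norm_of_nonneg h1]

/-- The integral `∫₀^∞ (1 - cos 2y) / y² dy`. -/
def cosIntegral : ℝ := ∫ y in Ioi (0 : ℝ), (1 - Real.cos (2 * y)) / y ^ 2

theorem integral_one_sub_cos_div_sq (x : ℝ) :
    ∫ y in Ioi (0 : ℝ), (1 - Real.cos (2 * x * y)) / y ^ 2 = cosIntegral * |x| := by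
  have hpos : ∀ x : ℝ, 0 < x → ∫ y in Ioi (0 : ℝ), (1 - Real.cos (2 * x * y)) / y ^ 2 =
      cosIntegral * x := by
    intro x hx
    have h := integral_comp_mul_left_Ioi (fun y : ℝ => (1 - Real.cos (2 * y)) / y ^ 2) 0 hx
    rw [mul_zero, smul_eq_mul] at h
    rw [cosIntegral]
    calc _ = ∫ y in Ioi (0 : ℝ), x ^ 2 * ((1 - Real.cos (2 * (x * y))) / (x * y) ^ 2) := by
          refine setIntegral_congr_fun measurableSet_Ioi fun y hy => ?_
          have hy : 0 < y := hy
          simp only [mul_assoc]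
          field_simp
      _ = _ := by
          rw [integral_const_mul, h]
          field_simp
  rcases lt_trichotomy x 0 with hx | hx | hx
  · rw [abs_of_neg hx, ← hpos (-x) (by linarith)]
    simp only [mul_neg, neg_mul, Real.cos_neg]
  · simp [hx]
  · rw [abs_of_pos hx, hpos x hx]

/-- Re z enters only through cos(2xy). Splitting off (1 - cos 2xy)/y² isolates the part that grows
linearly in |Re z|; the rest is the kernel on the imaginary axis times a cosine, so its integral is
bounded uniformly in Re z. -/
theorem re_eKernel_sub {b : ℝ} (z : ℂ) (y : ℝ) :
    (eKernel b z y - eKernel b (-z) y).re / 4 = z.im * ((1 - Real.cos (2 * z.re * y)) / y ^ 2) +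
      Real.cos (2 * z.re * y) *
        ((eKernel b (z.im * Complex.I) y - eKernel b (-(z.im * Complex.I)) y).re / 4) := by
  have key : ∀ x v : ℝ, (eKernel b (x + v * Complex.I) y - eKernel b (-(x + v * Complex.I)) y).re =
      1 / y * ((Real.exp (-(2 * v * y)) - Real.exp (2 * v * y)) * Real.cos (2 * x * y) *
        sinhWeight b y + 4 * v / y) := by
    intro x v
    have e : eKernel b (x + v * Complex.I) y - eKernel b (-(x + v * Complex.I)) y =
        ((1 / y : ℝ) : ℂ) * ((Complex.exp (-2 * Complex.I * y * -(x + v * Complex.I)) -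
          Complex.exp (-2 * Complex.I * y * (x + v * Complex.I))) * (sinhWeight b y : ℝ) -
          4 * Complex.I * (x + v * Complex.I) * ((1 / y : ℝ) : ℂ)) := by
      unfold eKernel
      push_cast
      ring
    rw [e, Complex.re_ofReal_mul, Complex.sub_re, Complex.re_mul_ofReal, Complex.re_mul_ofReal,
      Complex.sub_re, Complex.exp_re, Complex.exp_re]
    simp
    ring_nf
    simp
  have h1 := key z.re z.im
  have h2 := key 0 z.im
  rw [Complex.re_add_im] at h1
  simp only [Complex.ofReal_zero, zero_add] at h2
  rw [h1, h2]
  simp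
  ring

theorem norm_sFun_eq {b : ℝ} (hb : 0 < b) {z : ℂ} (h1 : -(Qpar b / 2) < z.im)
    (h2 : z.im < Qpar b / 2) :
    ‖sFun b z‖ = Real.exp (∫ y in Ioi (0 : ℝ), (eKernel b z y - eKernel b (-z) y).re / 4) := by
  have h1' : (-z).im < (b + b⁻¹) / 2 := by
    rw [Complex.neg_im]; unfold Qpar at h1; linarith
  have i1 := integrableOn_eKernel hb h2
  have i2 := integrableOn_eKernel hb h1'
  rw [sFun_eq, hyperbolicE_eq_integral hb h2, hyperbolicE_eq_integral hb h1',
    hyperbolicEIntegral_eq hb, hyperbolicEIntegral_eq hb, ← Complex.exp_sub, Complex.norm_exp,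
    ← mul_sub, ← integral_sub i1 i2]
  congr 1
  have h3 := integral_re (𝕜 := ℂ) (i1.sub i2)
  simp only [Pi.sub_apply, RCLike.re_to_complex] at h3
  rw [integral_div, h3, show (1 / 4 : ℂ) = ((1 / 4 : ℝ) : ℂ) by norm_num, Complex.re_ofReal_mul]
  ring

theorem abs_log_norm_sFun_sub_le {b : ℝ} (hb : 0 < b) {c : ℝ} (hc0 : 0 ≤ c) (hc : c < Qpar b / 2) :
    ∃ C, ∀ z : ℂ, -c ≤ z.im → z.im ≤ c →
      |Real.log ‖sFun b z‖ - cosIntegral * |z.re| * z.im| ≤ C := by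
  obtain ⟨C, hC⟩ := norm_eKernel_le hb hc0 hc
  refine ⟨∫ y in Ioi (0 : ℝ), C * (1 + y ^ 2)⁻¹, fun z hz1 hz2 => ?_⟩
  set g : ℝ → ℝ := fun y =>
    (eKernel b (z.im * Complex.I) y - eKernel b (-(z.im * Complex.I)) y).re / 4 with hg
  have hgb : ∀ y, 0 < y → |g y| ≤ C * (1 + y ^ 2)⁻¹ := by
    intro y hy
    have hn : ‖(z.im * Complex.I : ℂ)‖ ≤ c := by
      simpa using abs_le.2 ⟨hz1, hz2⟩
    have e1 := hC (z.im * Complex.I) hn (by simpa using hz2) y hy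
    have e2 := hC (-(z.im * Complex.I)) (by simpa using hn) (by simp; linarith) y hy
    have e3 := (Complex.abs_re_le_norm
      (eKernel b (z.im * Complex.I) y - eKernel b (-(z.im * Complex.I)) y)).trans (norm_sub_le _ _)
    rw [hg]
    simp only
    rw [abs_div, abs_of_pos (by norm_num : (0 : ℝ) < 4), div_le_iff₀ (by norm_num)]
    have := (norm_nonneg _).trans e1
    linarith
  have him : (z.im * Complex.I : ℂ).im < (b + b⁻¹) / 2 := by
    simp; unfold Qpar at hc; linarith
  have him' : (-(z.im * Complex.I) : ℂ).im < (b + b⁻¹) / 2 := by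
    simp; unfold Qpar at hc; linarith
  have hgm : IntegrableOn (fun y => Real.cos (2 * z.re * y) * g y) (Ioi 0) := by
    have hgi : IntegrableOn g (Ioi 0) :=
      ((integrableOn_eKernel hb him).sub (integrableOn_eKernel hb him')).re.div_const 4
    refine (integrableOn_inv_one_add_sq C).mono'
      ((Measurable.aestronglyMeasurable (by fun_prop)).mul hgi.aestronglyMeasurable) ?_
    filter_upwards [ae_restrict_mem measurableSet_Ioi] with y hy
    rw [norm_mul]
    exact (mul_le_of_le_one_left (norm_nonneg _) (Real.abs_cos_le_one _)).trans (hgb y hy)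
  rw [norm_sFun_eq hb (by linarith) (by linarith), Real.log_exp]
  simp_rw [re_eKernel_sub z]
  rw [integral_add ((integrableOn_one_sub_cos_div_sq _).const_mul _) hgm, integral_const_mul,
    integral_one_sub_cos_div_sq, show z.im * (cosIntegral * |z.re|) = cosIntegral * |z.re| * z.im by
    ring, add_sub_cancel_left, ← Real.norm_eq_abs]
  refine norm_integral_le_of_norm_le (integrableOn_inv_one_add_sq C) ?_
  filter_upwards [ae_restrict_mem measurableSet_Ioi] with y hy
  rw [norm_mul]
  exact (mul_le_of_le_one_left (norm_nonneg _) (Real.abs_cos_le_one _)).trans (hgb y hy)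

/-- Follows from the difference equation at b = 1: in s(x + i/2) = k cosh(πx) s(x - i/2) the
logarithms of the moduli differ by `cosIntegral` |x| up to a bounded term on one account, and by π
|x| on the other. -/
theorem cosIntegral_eq_pi : cosIntegral = Real.pi := by
  have hQ : Qpar 1 = 2 := by unfold Qpar; norm_num
  obtain ⟨C, hC⟩ := abs_log_norm_sFun_sub_le one_pos (c := 1 / 2) (by norm_num)
    (by rw [hQ]; norm_num)
  have hk := sStepConst_ne_zero 1
  have key : ∀ x : ℝ, |(cosIntegral - Real.pi) * (|x|)| ≤
      2 * C + |Real.log ‖sStepConst 1‖| + Real.log 2 := by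
    intro x
    have him : ((x : ℂ) - Complex.I / 2).im = -(1 / 2) := by simp
    have him' : ((x : ℂ) + Complex.I / 2).im = 1 / 2 := by simp
    have hre : ((x : ℂ) - Complex.I / 2).re = x := by simp
    have hre' : ((x : ℂ) + Complex.I / 2).re = x := by simp
    have h := sFun_step one_pos (z := (x : ℂ) - Complex.I / 2) (by rw [him, hQ]; norm_num)
    have hS := sFun_ne_zero one_pos (z := (x : ℂ) - Complex.I / 2) (by rw [him, hQ]; norm_num)
      (by rw [him, hQ]; norm_num)
    rw [show (x : ℂ) - Complex.I / 2 + Complex.I * (1 : ℝ) = x + Complex.I / 2 by push_cast; ring,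
      show (Real.pi : ℂ) * (1 : ℝ) * ((x : ℂ) - Complex.I / 2 + Complex.I * (1 : ℝ) / 2) =
        ((Real.pi * x : ℝ) : ℂ) by push_cast; ring, ← Complex.ofReal_cosh] at h
    have hn := congrArg (fun w => Real.log ‖w‖) h
    simp only [norm_mul, Complex.norm_real, Real.norm_of_nonneg (Real.cosh_pos _).le] at hn
    rw [Real.log_mul (mul_ne_zero (norm_ne_zero_iff.2 hk) (Real.cosh_pos _).ne')
      (norm_ne_zero_iff.2 hS), Real.log_mul (norm_ne_zero_iff.2 hk) (Real.cosh_pos _).ne'] at hn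
    have b1 := hC ((x : ℂ) - Complex.I / 2) (by rw [him]) (by rw [him]; norm_num)
    have b2 := hC ((x : ℂ) + Complex.I / 2) (by rw [him']; norm_num) (by rw [him'])
    rw [him, hre] at b1
    rw [him', hre'] at b2
    have c1 : Real.log (Real.cosh (Real.pi * x)) ≤ Real.pi * |x| := by
      rw [← Real.log_exp (Real.pi * |x|)]
      refine Real.log_le_log (Real.cosh_pos _) ?_
      rw [← Real.cosh_abs, abs_mul, abs_of_pos Real.pi_pos, Real.cosh_eq]
      have : Real.exp (-(Real.pi * |x|)) ≤ Real.exp (Real.pi * |x|) :=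
        Real.exp_le_exp.2 (by have := Real.pi_pos; nlinarith [abs_nonneg x, mul_nonneg this.le (abs_nonneg x)])
      linarith
    have c2 : Real.pi * |x| - Real.log 2 ≤ Real.log (Real.cosh (Real.pi * x)) := by
      rw [← Real.log_exp (Real.pi * |x|), ← Real.log_div (Real.exp_pos _).ne' two_ne_zero]
      refine Real.log_le_log (by positivity) ?_
      rw [← Real.cosh_abs (Real.pi * x), abs_mul, abs_of_pos Real.pi_pos, Real.cosh_eq]
      have := Real.exp_pos (-(Real.pi * |x|))
      linarith
    rw [abs_le] at b1 b2 ⊢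
    have d1 := le_abs_self (Real.log ‖sStepConst 1‖)
    have d2 := neg_abs_le (Real.log ‖sStepConst 1‖)
    have d3 := Real.log_pos (by norm_num : (1 : ℝ) < 2)
    constructor <;> linarith [b1.1, b1.2, b2.1, b2.2]
  by_contra hne
  have hpos : 0 < |cosIntegral - Real.pi| := abs_pos.2 (sub_ne_zero.2 hne)
  set B := 2 * C + |Real.log ‖sStepConst 1‖| + Real.log 2 with hB
  have hB0 : 0 ≤ B := (abs_nonneg _).trans (key 0)
  -- At this x the left side of `key` equals B + 1, which exceeds the bound B.
  have h := key ((B + 1) / |cosIntegral - Real.pi|)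
  rw [abs_mul, abs_abs, abs_div, abs_abs, abs_of_nonneg (by linarith : 0 ≤ B + 1),
    mul_div_cancel₀ _ hpos.ne'] at h
  linarith

theorem norm_cosh_le (w : ℂ) : ‖Complex.cosh w‖ ≤ Real.exp |w.re| := by
  rw [Complex.cosh, norm_div, Complex.norm_ofNat, div_le_iff₀ (by norm_num)]
  refine (norm_add_le _ _).trans ?_
  rw [Complex.norm_exp, Complex.norm_exp, Complex.neg_re]
  have h1 := Real.exp_le_exp.2 (le_abs_self w.re)
  have h2 := Real.exp_le_exp.2 (neg_le_abs w.re)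
  linarith

/-- In a symmetric strip inside |Im z| < Q/2 this is the logarithmic estimate. Each step up by b
multiplies s_b by a hyperbolic cosine of size exp(πb |Re z|), exactly the growth that the bound
allows. -/
theorem norm_sFun_le {b : ℝ} (hb : 0 < b) {v₀ : ℝ} (hv₀ : -(Qpar b / 2) < v₀) (v₁ : ℝ) :
    ∃ C, 0 ≤ C ∧ ∀ z : ℂ, v₀ ≤ z.im → z.im ≤ v₁ →
      ‖sFun b z‖ ≤ C * Real.exp (Real.pi * |z.re| * z.im) := by
  -- The strip |Im z| ≤ c must reach down to v₀ and have height at least b, so that stepping down by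
  -- b from above lands in the range already treated.
  set c := max (-v₀) (b / 2) with hc
  have hb' : 0 < b⁻¹ := inv_pos.2 hb
  have hcQ : c < Qpar b / 2 := max_lt (by linarith) (by unfold Qpar; linarith)
  have hcb : b / 2 ≤ c := le_max_right _ _
  have hcv : -v₀ ≤ c := le_max_left _ _
  have main : ∀ n : ℕ, ∃ C, 0 ≤ C ∧ ∀ z : ℂ, -c ≤ z.im → z.im ≤ c + n * b →
      ‖sFun b z‖ ≤ C * Real.exp (Real.pi * |z.re| * z.im) := by
    intro n
    induction n with
    | zero =>
      obtain ⟨C, hC⟩ := abs_log_norm_sFun_sub_le hb (by linarith : 0 ≤ c) hcQ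
      refine ⟨Real.exp C, (Real.exp_pos _).le, fun z h1 h2 => ?_⟩
      simp only [Nat.cast_zero, zero_mul, add_zero] at h2
      have h3 := hC z h1 h2
      have hS := sFun_ne_zero hb (z := z) (by linarith) (by linarith)
      rw [cosIntegral_eq_pi] at h3
      rw [← Real.exp_add, ← Real.log_le_iff_le_exp (norm_pos_iff.2 hS)]
      linarith [(abs_le.1 h3).2]
    | succ n ih =>
      obtain ⟨C, hC0, hC⟩ := ih
      refine ⟨max C (‖sStepConst b‖ * C), le_max_of_le_left hC0, fun z h1 h2 => ?_⟩
      rcases le_total z.im (c + n * b) with h3 | h3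
      · refine (hC z h1 h3).trans ?_
        gcongr
        exact le_max_left _ _
      · have him : (z - Complex.I * b).im = z.im - b := by simp
        have hre : (z - Complex.I * b).re = z.re := by simp
        have hn : (0 : ℝ) ≤ n * b := by positivity
        push_cast at h2
        have h4 := sFun_step hb (z := z - Complex.I * b) (by rw [him]; linarith)
        rw [sub_add_cancel] at h4
        have h5 := hC (z - Complex.I * b) (by rw [him]; linarith) (by rw [him]; linarith)
        rw [him, hre] at h5
        have h6 := norm_cosh_le (Real.pi * b * (z - Complex.I * b + Complex.I * b / 2))
        have h7 : (Real.pi * b * (z - Complex.I * b + Complex.I * b / 2) : ℂ).re =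
            Real.pi * b * z.re := by
          rw [← Complex.ofReal_mul, Complex.re_ofReal_mul]
          simp
        rw [h7, abs_mul, abs_of_pos (by positivity)] at h6
        rw [h4, norm_mul, norm_mul]
        calc _ ≤ ‖sStepConst b‖ * Real.exp (Real.pi * b * |z.re|) *
              (C * Real.exp (Real.pi * |z.re| * (z.im - b))) := by gcongr
          _ = ‖sStepConst b‖ * C * Real.exp (Real.pi * |z.re| * z.im) := by
              rw [mul_mul_mul_comm, ← Real.exp_add]
              ring_nf
          _ ≤ _ := by
              gcongr
              exact le_max_right _ _
  obtain ⟨n, hn⟩ := exists_nat_im_le hb (v₁ - c)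
  obtain ⟨C, hC0, hC⟩ := main n
  exact ⟨C, hC0, fun z h1 h2 => hC z (by linarith) (by linarith)⟩

/-! ### Contour shifts and integrals of products of s_b -/

theorem integrable_exp_neg_mul_abs {c : ℝ} (hc : 0 < c) :
    Integrable (fun x : ℝ => Real.exp (-c * |x|)) := by
  rw [← integrableOn_univ, ← Iic_union_Ioi (a := (0 : ℝ))]
  refine IntegrableOn.union ?_ ?_
  · refine (integrableOn_exp_mul_Iic hc 0).congr_fun (fun x hx => ?_) measurableSet_Iic
    rw [abs_of_nonpos hx]
    simp
  · refine (integrableOn_exp_mul_Ioi (neg_lt_zero.2 hc) 0).congr_fun (fun x hx => ?_)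
      measurableSet_Ioi
    rw [abs_of_pos hx]

theorem integrable_horizontal {f : ℂ → ℂ} {y C c : ℝ} (hc : 0 < c)
    (hf : ∀ z : ℂ, z.im = y → DifferentiableAt ℂ f z)
    (hb : ∀ z : ℂ, z.im = y → ‖f z‖ ≤ C * Real.exp (-c * |z.re|)) :
    Integrable (fun x : ℝ => f (x + y * Complex.I)) := by
  have hcont : Continuous fun x : ℝ => f (x + y * Complex.I) := by
    rw [continuous_iff_continuousAt]
    intro x
    exact ContinuousAt.comp (f := fun x : ℝ => (x + y * Complex.I : ℂ))
      (hf (x + y * Complex.I) (by simp)).continuousAt (by fun_prop)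
  refine ((integrable_exp_neg_mul_abs hc).const_mul C).mono' hcont.aestronglyMeasurable
    (Eventually.of_forall fun x => ?_)
  simpa using hb (x + y * Complex.I) (by simp)

/-- Cauchy's theorem on the rectangles |Re z| ≤ T: the vertical sides contribute O(exp(-cT)). -/
theorem integral_horizontal_eq {f : ℂ → ℂ} {y₀ y₁ C c : ℝ} (hc : 0 < c)
    (hf : ∀ z : ℂ, z.im ∈ uIcc y₀ y₁ → DifferentiableAt ℂ f z)
    (hb : ∀ z : ℂ, z.im ∈ uIcc y₀ y₁ → ‖f z‖ ≤ C * Real.exp (-c * |z.re|)) :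
    ∫ x : ℝ, f (x + y₀ * Complex.I) = ∫ x : ℝ, f (x + y₁ * Complex.I) := by
  have i₀ : Integrable (fun x : ℝ => f (x + y₀ * Complex.I)) :=
    integrable_horizontal hc (fun z hz => hf z (hz ▸ left_mem_uIcc))
      (fun z hz => hb z (hz ▸ left_mem_uIcc))
  have i₁ : Integrable (fun x : ℝ => f (x + y₁ * Complex.I)) :=
    integrable_horizontal hc (fun z hz => hf z (hz ▸ right_mem_uIcc))
      (fun z hz => hb z (hz ▸ right_mem_uIcc))
  have t₀ := intervalIntegral_tendsto_integral i₀ tendsto_neg_atTop_atBot tendsto_id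
  have t₁ := intervalIntegral_tendsto_integral i₁ tendsto_neg_atTop_atBot tendsto_id
  have side : ∀ s : ℝ → ℝ, (∀ T, |s T| = |T|) →
      Tendsto (fun T : ℝ => ∫ y in y₀..y₁, f (s T + y * Complex.I)) atTop (𝓝 0) := by
    intro s hs
    have hlim : Tendsto (fun T : ℝ => C * Real.exp (-c * T) * |y₁ - y₀|) atTop (𝓝 0) := by
      have : Tendsto (fun T : ℝ => Real.exp (-c * T)) atTop (𝓝 0) := by
        refine Real.tendsto_exp_atBot.comp ?_
        exact tendsto_id.const_mul_atTop_of_neg (neg_lt_zero.2 hc)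
      simpa using (this.const_mul C).mul_const (|y₁ - y₀|)
    refine squeeze_zero_norm' ?_ hlim
    filter_upwards [eventually_ge_atTop 0] with T hT
    refine intervalIntegral.norm_integral_le_of_norm_le_const fun y hy => ?_
    have h := hb (s T + y * Complex.I) (by simpa using uIoc_subset_uIcc hy)
    have hre : ((s T : ℂ) + y * Complex.I).re = s T := by simp
    rwa [hre, hs, abs_of_nonneg hT] at h
  have s₁ := side (fun T => T) fun _ => rfl
  have s₂ := side (fun T => -T) fun T => abs_neg T
  have hrect : ∀ T : ℝ, ((∫ x in (-T)..T, f (x + y₀ * Complex.I)) -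
      ∫ x in (-T)..T, f (x + y₁ * Complex.I)) +
      Complex.I • (∫ y in y₀..y₁, f (T + y * Complex.I)) -
      Complex.I • (∫ y in y₀..y₁, f ((-T : ℝ) + y * Complex.I)) = 0 := by
    intro T
    have h := Complex.integral_boundary_rect_eq_zero_of_differentiableOn f ⟨-T, y₀⟩ ⟨T, y₁⟩
      (fun z hz => (hf z hz.2).differentiableWithinAt)
    simpa using h
  have ht := ((t₀.sub t₁).add (s₁.const_smul Complex.I)).sub (s₂.const_smul Complex.I)
  simp only [id] at ht
  have h0 := tendsto_nhds_unique (ht.congr hrect) tendsto_const_nhds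
  simpa [sub_eq_zero] using h0

/-- A product of eight hyperbolic gamma functions: the general shape of the integrands. -/
def sProd (b : ℝ) (a c : Fin 4 → ℂ) (x : ℂ) : ℂ :=
  ∏ j, (sFun b (x + a j) * sFun b (-x + c j))

/-- Replacing each |Re(±x + shift)| by |Re x| costs at most R, hence a factor exp(πRM). After that
the terms ±Im x cancel in the total exponent and only the imaginary parts of the shifts remain. -/
theorem norm_sProd_le {b : ℝ} (hb : 0 < b) {v₀ : ℝ} (hv₀ : -(Qpar b / 2) < v₀) (v₁ R : ℝ) :
    ∃ C, ∀ (a c : Fin 4 → ℂ) (x : ℂ),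
      (∀ j, v₀ ≤ (x + a j).im ∧ (x + a j).im ≤ v₁ ∧ v₀ ≤ (-x + c j).im ∧ (-x + c j).im ≤ v₁ ∧
        |(a j).re| ≤ R ∧ |(c j).re| ≤ R) →
      ‖sProd b a c x‖ ≤ C * Real.exp (Real.pi * |x.re| * ∑ j, ((a j).im + (c j).im)) := by
  obtain ⟨C, hC0, hC⟩ := norm_sFun_le hb hv₀ v₁
  set M := max (|v₀|) (|v₁|) with hM
  have key : ∀ (z : ℂ) (t : ℝ), v₀ ≤ z.im → z.im ≤ v₁ → |(|z.re| - t)| ≤ R →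
      ‖sFun b z‖ ≤ C * Real.exp (Real.pi * R * M) * Real.exp (Real.pi * t * z.im) := by
    intro z t h1 h2 h3
    refine (hC z h1 h2).trans ?_
    rw [mul_assoc C, ← Real.exp_add]
    gcongr
    have h4 : |z.im| ≤ M := by
      rw [abs_le]
      constructor
      · linarith [neg_abs_le v₀, le_max_left (|v₀|) (|v₁|)]
      · linarith [le_abs_self v₁, le_max_right (|v₀|) (|v₁|)]
    have h5 : (|z.re| - t) * z.im ≤ R * M := by
      refine (le_abs_self _).trans ?_
      rw [abs_mul]
      gcongr
      exact (abs_nonneg _).trans h3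
    nlinarith [mul_le_mul_of_nonneg_left h5 Real.pi_pos.le]
  set K := C * Real.exp (Real.pi * R * M) with hK
  refine ⟨∏ _j : Fin 4, (K * K), fun a c x h => ?_⟩
  rw [sProd, norm_prod, Finset.mul_sum, Real.exp_sum, ← Finset.prod_mul_distrib]
  refine Finset.prod_le_prod (fun _ _ => norm_nonneg _) fun j _ => ?_
  obtain ⟨h1, h2, h3, h4, h5, h6⟩ := h j
  have e1 : |(|(x + a j).re| - |x.re|)| ≤ R := by
    refine (abs_abs_sub_abs_le_abs_sub _ _).trans ?_
    simpa using h5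
  have e2 : |(|(-x + c j).re| - |x.re|)| ≤ R := by
    rw [← abs_neg x.re]
    refine (abs_abs_sub_abs_le_abs_sub _ _).trans ?_
    simpa using h6
  have k1 := key _ _ h1 h2 e1
  have k2 := key _ _ h3 h4 e2
  rw [norm_mul]
  calc _ ≤ _ := mul_le_mul k1 k2 (norm_nonneg _) ((norm_nonneg _).trans k1)
    _ = _ := by
      rw [mul_mul_mul_comm, ← Real.exp_add]
      congr 2
      simp
      ring

theorem differentiableAt_sProd {b : ℝ} (hb : 0 < b) {a c : ℂ → Fin 4 → ℂ} {x : ℂ → ℂ} {ζ : ℂ}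
    (ha : ∀ j, DifferentiableAt ℂ (fun ζ => a ζ j) ζ)
    (hc : ∀ j, DifferentiableAt ℂ (fun ζ => c ζ j) ζ) (hx : DifferentiableAt ℂ x ζ)
    (h1 : ∀ j, -(Qpar b / 2) < (x ζ + a ζ j).im) (h2 : ∀ j, -(Qpar b / 2) < (-x ζ + c ζ j).im) :
    DifferentiableAt ℂ (fun ζ => sProd b (a ζ) (c ζ) (x ζ)) ζ := by
  unfold sProd
  refine DifferentiableAt.fun_finsetProd fun j _ => DifferentiableAt.mul ?_ ?_
  · exact DifferentiableAt.comp (f := fun ζ => x ζ + a ζ j) ζ (differentiableAt_sFun hb (h1 j))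
      (hx.add (ha j))
  · exact DifferentiableAt.comp (f := fun ζ => -x ζ + c ζ j) ζ (differentiableAt_sFun hb (h2 j))
      (hx.neg.add (hc j))

/-- The integral of `sProd` along the line `Im x = -h`. -/
def sInt (b : ℝ) (a c : Fin 4 → ℂ) (h : ℝ) : ℂ := ∫ x : ℝ, sProd b a c (x - Complex.I * h)

/-- The line `Im x = -h` lies between the two sequences of poles of `sProd`. -/
def Separates (b : ℝ) (a c : Fin 4 → ℂ) (h : ℝ) : Prop :=
  ∀ j, -(Qpar b / 2) < -h + (a j).im ∧ -(Qpar b / 2) < h + (c j).im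

theorem exists_lt_forall_lt {ι : Type*} [Finite ι] {l : ℝ} {g : ι → ℝ} (hg : ∀ j, l < g j) :
    ∃ v, l < v ∧ ∀ j, v < g j := by
  have h : ∀ᶠ v in 𝓝[>] l, ∀ j, v < g j :=
    eventually_all.2 fun j => (gt_mem_nhds (hg j)).filter_mono nhdsWithin_le_nhds
  obtain ⟨v, hv1, hv2⟩ := (h.and self_mem_nhdsWithin).exists
  exact ⟨v, hv2, hv1⟩

theorem exists_forall_lt {ι : Type*} [Finite ι] (g : ι → ℝ) : ∃ v, ∀ j, g j < v :=
  (eventually_all.2 fun j => eventually_gt_atTop (g j)).exists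

/-- Uniform exponential decay in a strip for parameters near a given point. -/
theorem eventually_norm_sProd_le {b : ℝ} (hb : 0 < b) {a c : ℂ → Fin 4 → ℂ} {ζ₀ : ℂ} {h₀ h₁ : ℝ}
    (ha : ∀ j, ContinuousAt (fun ζ => a ζ j) ζ₀) (hc : ∀ j, ContinuousAt (fun ζ => c ζ j) ζ₀)
    (hs₀ : Separates b (a ζ₀) (c ζ₀) h₀) (hs₁ : Separates b (a ζ₀) (c ζ₀) h₁) :
    ∃ C, ∀ᶠ ζ in 𝓝 ζ₀, ∀ x : ℂ, -h₁ ≤ x.im → x.im ≤ -h₀ →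
      ‖sProd b (a ζ) (c ζ) x‖ ≤
        C * Real.exp (Real.pi * |x.re| * ∑ j, ((a ζ j).im + (c ζ j).im)) := by
  -- Separation is strict, so there are lower bounds v₁, v₂ > -Q/2 with room to spare; these, with
  -- upper bounds on the other quantities, persist for nearby parameters.
  obtain ⟨v₁, hv₁, hva⟩ := exists_lt_forall_lt fun j => (hs₁ j).1
  obtain ⟨v₂, hv₂, hvc⟩ := exists_lt_forall_lt fun j => (hs₀ j).2
  obtain ⟨w₁, hw₁⟩ := exists_forall_lt fun j => -h₀ + (a ζ₀ j).im
  obtain ⟨w₂, hw₂⟩ := exists_forall_lt fun j => h₁ + (c ζ₀ j).im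
  obtain ⟨R₁, hR₁⟩ := exists_forall_lt fun j => |(a ζ₀ j).re|
  obtain ⟨R₂, hR₂⟩ := exists_forall_lt fun j => |(c ζ₀ j).re|
  obtain ⟨C, hC⟩ := norm_sProd_le hb (lt_min hv₁ hv₂) (max w₁ w₂) (max R₁ R₂)
  refine ⟨C, ?_⟩
  have hev : ∀ᶠ ζ in 𝓝 ζ₀, ∀ j, v₁ < -h₁ + (a ζ j).im ∧ v₂ < h₀ + (c ζ j).im ∧
      -h₀ + (a ζ j).im < w₁ ∧ h₁ + (c ζ j).im < w₂ ∧ |(a ζ j).re| < R₁ ∧ |(c ζ j).re| < R₂ := by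
    refine eventually_all.2 fun j => ?_
    have ima : ContinuousAt (fun ζ => (a ζ j).im) ζ₀ := Complex.continuous_im.continuousAt.comp (ha j)
    have imc : ContinuousAt (fun ζ => (c ζ j).im) ζ₀ := Complex.continuous_im.continuousAt.comp (hc j)
    have rea : ContinuousAt (fun ζ => |(a ζ j).re|) ζ₀ :=
      (Complex.continuous_re.continuousAt.comp (ha j)).abs
    have hrc : ContinuousAt (fun ζ => |(c ζ j).re|) ζ₀ :=
      (Complex.continuous_re.continuousAt.comp (hc j)).abs
    filter_upwards [(continuousAt_const.add ima).eventually (lt_mem_nhds (hva j)),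
      (continuousAt_const.add imc).eventually (lt_mem_nhds (hvc j)),
      (continuousAt_const.add ima).eventually (gt_mem_nhds (hw₁ j)),
      (continuousAt_const.add imc).eventually (gt_mem_nhds (hw₂ j)),
      rea.eventually (gt_mem_nhds (hR₁ j)), hrc.eventually (gt_mem_nhds (hR₂ j))] with ζ e1 e2 e3 e4 e5 e6
    exact ⟨e1, e2, e3, e4, e5, e6⟩
  filter_upwards [hev] with ζ hζ x hx1 hx2
  refine hC _ _ _ fun j => ?_
  obtain ⟨e1, e2, e3, e4, e5, e6⟩ := hζ j
  simp only [Complex.add_im, Complex.neg_im]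
  have m1 := min_le_left v₁ v₂
  have m2 := min_le_right v₁ v₂
  have m3 := le_max_left w₁ w₂
  have m4 := le_max_right w₁ w₂
  exact ⟨by linarith, by linarith, by linarith, by linarith, e5.le.trans (le_max_left _ _),
    e6.le.trans (le_max_right _ _)⟩

theorem Separates.im_lt {b : ℝ} {a c : Fin 4 → ℂ} {h₀ h₁ : ℝ} (hs₀ : Separates b a c h₀)
    (hs₁ : Separates b a c h₁) {z : ℂ} (h1 : -h₁ ≤ z.im) (h2 : z.im ≤ -h₀) (j : Fin 4) :
    -(Qpar b / 2) < (z + a j).im ∧ -(Qpar b / 2) < (-z + c j).im := by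
  have e1 := (hs₁ j).1
  have e2 := (hs₀ j).2
  simp only [Complex.add_im, Complex.neg_im]
  exact ⟨by linarith, by linarith⟩

theorem norm_sProd_strip_le {b : ℝ} (hb : 0 < b) {a c : Fin 4 → ℂ} {h₀ h₁ : ℝ}
    (hs₀ : Separates b a c h₀) (hs₁ : Separates b a c h₁) :
    ∃ C, ∀ x : ℂ, -h₁ ≤ x.im → x.im ≤ -h₀ →
      ‖sProd b a c x‖ ≤ C * Real.exp (-(-(Real.pi * ∑ j, ((a j).im + (c j).im))) * |x.re|) := by
  obtain ⟨C, hC⟩ := eventually_norm_sProd_le hb (a := fun _ => a) (c := fun _ => c) (ζ₀ := 0)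
    (fun _ => continuousAt_const) (fun _ => continuousAt_const) hs₀ hs₁
  refine ⟨C, fun x h1 h2 => (hC.self_of_nhds x h1 h2).trans (le_of_eq ?_)⟩
  congr 2
  ring

theorem line_eq (x h : ℝ) : (x - Complex.I * h : ℂ) = x + (-h : ℝ) * Complex.I := by
  push_cast; ring

theorem integrable_sProd {b : ℝ} (hb : 0 < b) {a c : Fin 4 → ℂ} {h : ℝ} (hs : Separates b a c h)
    (hsum : ∑ j, ((a j).im + (c j).im) < 0) :
    Integrable (fun x : ℝ => sProd b a c (x - Complex.I * h)) := by
  obtain ⟨C, hC⟩ := norm_sProd_strip_le hb hs hs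
  simp only [line_eq]
  refine integrable_horizontal (C := C) (c := -(Real.pi * ∑ j, ((a j).im + (c j).im)))
    (neg_pos.2 (mul_neg_of_pos_of_neg Real.pi_pos hsum)) ?_ ?_
  · intro z hz
    exact differentiableAt_sProd hb (a := fun _ => a) (c := fun _ => c) (x := fun z => z)
      (by fun_prop) (by fun_prop) (by fun_prop) (fun j => (hs.im_lt hs hz.ge hz.le j).1)
      (fun j => (hs.im_lt hs hz.ge hz.le j).2)
  · intro z hz
    exact hC z hz.ge hz.le

theorem sInt_eq_of_separates {b : ℝ} (hb : 0 < b) {a c : Fin 4 → ℂ} {h₀ h₁ : ℝ}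
    (hs₀ : Separates b a c h₀) (hs₁ : Separates b a c h₁)
    (hsum : ∑ j, ((a j).im + (c j).im) < 0) : sInt b a c h₀ = sInt b a c h₁ := by
  wlog h01 : h₀ ≤ h₁ generalizing h₀ h₁
  · exact (this hs₁ hs₀ (by linarith)).symm
  obtain ⟨C, hC⟩ := norm_sProd_strip_le hb hs₀ hs₁
  have hmem : ∀ z : ℂ, z.im ∈ uIcc (-h₀) (-h₁) → -h₁ ≤ z.im ∧ z.im ≤ -h₀ := by
    intro z hz
    rwa [uIcc_of_ge (by linarith), mem_Icc] at hz
  unfold sInt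
  simp only [line_eq]
  refine integral_horizontal_eq (C := C) (c := -(Real.pi * ∑ j, ((a j).im + (c j).im)))
    (neg_pos.2 (mul_neg_of_pos_of_neg Real.pi_pos hsum)) ?_ ?_
  · intro z hz
    obtain ⟨e1, e2⟩ := hmem z hz
    exact differentiableAt_sProd hb (a := fun _ => a) (c := fun _ => c) (x := fun z => z)
      (by fun_prop) (by fun_prop) (by fun_prop) (fun j => (hs₀.im_lt hs₁ e1 e2 j).1)
      (fun j => (hs₀.im_lt hs₁ e1 e2 j).2)
  · intro z hz
    obtain ⟨e1, e2⟩ := hmem z hz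
    exact hC z e1 e2

/-- Constancy of the sum of imaginary parts makes the exponential decay rate the same for all
parameters, so one integrable function dominates locally. -/
theorem differentiableOn_sInt {b : ℝ} (hb : 0 < b) {a c : ℂ → Fin 4 → ℂ} {U : Set ℂ}
    (hU : IsOpen U) {h S : ℝ} (ha : ∀ j, DifferentiableOn ℂ (fun ζ => a ζ j) U)
    (hc : ∀ j, DifferentiableOn ℂ (fun ζ => c ζ j) U)
    (hs : ∀ ζ ∈ U, Separates b (a ζ) (c ζ) h) (hS : S < 0)
    (hsum : ∀ ζ ∈ U, ∑ j, ((a ζ j).im + (c ζ j).im) = S) :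
    DifferentiableOn ℂ (fun ζ => sInt b (a ζ) (c ζ) h) U := by
  have hline : ∀ x : ℝ, ((x : ℂ) - Complex.I * h).im = -h := fun x => by simp
  refine differentiableOn_integral_of_dominated hU ?_ ?_ ?_
  · intro ζ hζ
    exact (integrable_sProd hb (hs ζ hζ) (by rw [hsum ζ hζ]; exact hS)).aestronglyMeasurable
  · refine Eventually.of_forall fun x ζ hζ => DifferentiableAt.differentiableWithinAt ?_
    have hn := hU.mem_nhds hζ
    exact differentiableAt_sProd hb (x := fun _ => (x - Complex.I * h : ℂ))
      (fun j => (ha j).differentiableAt hn)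
      (fun j => (hc j).differentiableAt hn) (by fun_prop)
      (fun j => ((hs ζ hζ).im_lt (hs ζ hζ) (hline x).ge (hline x).le j).1)
      (fun j => ((hs ζ hζ).im_lt (hs ζ hζ) (hline x).ge (hline x).le j).2)
  · intro ζ₀ hζ₀
    have hn := hU.mem_nhds hζ₀
    obtain ⟨C, hC⟩ := eventually_norm_sProd_le hb
      (fun j => ((ha j).differentiableAt hn).continuousAt)
      (fun j => ((hc j).differentiableAt hn).continuousAt) (hs ζ₀ hζ₀) (hs ζ₀ hζ₀)
    obtain ⟨r, hr, hball⟩ := Metric.eventually_nhds_iff_ball.1 hC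
    refine ⟨r, hr, fun x => C * Real.exp (-(-(Real.pi * S)) * |x|), (integrable_exp_neg_mul_abs
      (neg_pos.2 (mul_neg_of_pos_of_neg Real.pi_pos hS))).const_mul C,
      Eventually.of_forall fun x ζ hζ => ?_⟩
    refine (hball ζ hζ.1 _ (hline x).ge (hline x).le).trans (le_of_eq ?_)
    rw [hsum ζ hζ.2]
    congr 2
    simp
    ring

/-! ### The trigonometric telescoping identity -/

/-- The rational identity behind the telescoping of the integrand, in exponential variables. -/
theorem laurent_telescoping {S Q W U P X : ℂ} (c ct : ℂ) (hS : S ≠ 0) (hQ : Q ≠ 0) (hW : W ≠ 0)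
    (hU : U ≠ 0) (hP : P ≠ 0) (hX : X ≠ 0) (h1 : S ^ 2 - 1 ≠ 0) (h2 : S ^ 2 * Q ^ 2 - 1 ≠ 0)
    (h3 : Q ^ 2 - S ^ 2 ≠ 0) :
    -((S * Q * W + (S * Q * W)⁻¹) / 2 + (P + P⁻¹) / 2) *
      ((S * Q / U + (S * Q / U)⁻¹) / 2 + c) /
      ((S ^ 2 - 1) / (2 * S) * ((S ^ 2 * Q ^ 2 - 1) / (2 * S * Q))) *
      ((X * W * Q / S + (X * W * Q / S)⁻¹) / 2 - (Q + Q⁻¹) / 2) +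
    ((Q * W / S + (Q * W / S)⁻¹) / 2 + (P + P⁻¹) / 2) *
      ((Q / (S * U) + (Q / (S * U))⁻¹) / 2 + c) /
      ((S ^ 2 - 1) / (2 * S) * ((Q ^ 2 - S ^ 2) / (2 * S * Q))) *
      ((X * W * Q * S + (X * W * Q * S)⁻¹) / 2 - (Q + Q⁻¹) / 2) +
    (-(P * U * Q + (P * U * Q)⁻¹) + ((Q * P * S + (Q * P * S)⁻¹) / 2 + (W + W⁻¹) / 2) *
      ((Q * U * S + (Q * U * S)⁻¹) / 2 + c) /
        ((S ^ 2 - 1) / (2 * S) * ((S ^ 2 * Q ^ 2 - 1) / (2 * S * Q))) -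
      ((Q * P / S + (Q * P / S)⁻¹) / 2 + (W + W⁻¹) / 2) *
      ((Q * U / S + (Q * U / S)⁻¹) / 2 + c) /
        ((S ^ 2 - 1) / (2 * S) * ((Q ^ 2 - S ^ 2) / (2 * S * Q))) - 2 * ct) *
      ((X * W * Q ^ 2 + (X * W * Q ^ 2)⁻¹) / 2 - (S + S⁻¹) / 2) =
    -2 * ((X * Q + (X * Q)⁻¹) / 2 + (P + P⁻¹) / 2) *
      ((X * U * W * Q + (X * U * W * Q)⁻¹) / 2 + c) +
    2 * ((X * W * Q ^ 2 + (X * W * Q ^ 2)⁻¹) / 2 - (S + S⁻¹) / 2) *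
      ((X * U + (X * U)⁻¹) / 2 - ct) := by
  field_simp
  ring

/-- Product-to-sum, with the exponential of the sum recorded as a monomial Z. The hyperbolic cosine
of the difference stays a symbol, which suits θ₀ and σ_t since they enter only through cosh. -/
theorem cosh_mul_cosh_of_exp {a b Z : ℂ} {c : ℂ} (h₁ : Complex.exp (a + b) = Z)
    (h₂ : Complex.cosh (a - b) = c) :
    Complex.cosh a * Complex.cosh b = ((Z + Z⁻¹) / 2 + c) / 2 := by
  rw [← h₁, ← h₂, ← Complex.exp_neg, ← Complex.cosh, Complex.cosh_add, Complex.cosh_sub]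
  ring

theorem sinh_mul_sinh_of_exp {a b Z : ℂ} {c : ℂ} (h₁ : Complex.exp (a + b) = Z)
    (h₂ : Complex.cosh (a - b) = c) :
    Complex.sinh a * Complex.sinh b = ((Z + Z⁻¹) / 2 - c) / 2 := by
  rw [← h₁, ← h₂, ← Complex.exp_neg, ← Complex.cosh, Complex.cosh_add, Complex.cosh_sub]
  ring

theorem cosh_of_exp {a Z : ℂ} (h : Complex.exp a = Z) : Complex.cosh a = (Z + Z⁻¹) / 2 := by
  rw [← h, ← Complex.exp_neg, ← Complex.cosh]

theorem sinh_of_exp {a Z : ℂ} (h : Complex.exp a = Z) : Complex.sinh a = (Z - Z⁻¹) / 2 := by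
  rw [← h, ← Complex.exp_neg, ← Complex.sinh]

/-- The shifts of the arguments of `E(±σ + ·)` in the prefactor of the fusion kernel. -/
def edgeShift (t0 t1 : ℝ) (tt ti : ℂ) : Fin 4 → ℂ := ![t0 - tt, -t0 - tt, t1 + ti, -t1 + ti]

/-- The coefficient of the shift `σ ↦ σ + ib` in the difference equation for the integral. -/
def intCoeff (b : ℝ) (a : Fin 4 → ℂ) (σ : ℂ) : ℂ :=
  -4 * (∏ j, Complex.cosh (Real.pi * b * (σ + a j + Complex.I * b / 2))) /
    (Complex.sinh (Real.pi * b * (2 * σ)) * Complex.sinh (Real.pi * b * (2 * σ + Complex.I * b)))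

/-- One of the two summands of the potential `H_F^0`. -/
def potentialTerm (b t0 t1 : ℝ) (tt ti σ : ℂ) : ℂ :=
  (Complex.cosh (Real.pi * b * (ti - Complex.I * b / 2 - t1 - σ)) *
    Complex.cosh (Real.pi * b * (-ti - Complex.I * b / 2 - t1 - σ))) *
  (Complex.cosh (Real.pi * b * (t0 - Complex.I * b / 2 - tt - σ)) *
    Complex.cosh (Real.pi * b * (-t0 - Complex.I * b / 2 - tt - σ))) /
  (Complex.sinh (Real.pi * b * (2 * σ)) * Complex.sinh (Real.pi * b * (2 * σ + Complex.I * b)))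

/-- The potential `H_F^0` for complex `θ_t`, `θ_∞`. -/
def potential (b t0 t1 : ℝ) (tt ti σ : ℂ) : ℂ :=
  -2 * Complex.cosh (Real.pi * b * (2 * (t1 + tt + Complex.I * b / 2))) +
    4 * (potentialTerm b t0 t1 tt ti σ + potentialTerm b t0 t1 tt ti (-σ))

theorem sinh_ne_zero_of_re {z : ℂ} (hz : z.re ≠ 0) : Complex.sinh z ≠ 0 := by
  intro h
  rw [Complex.sinh, div_eq_zero_iff, or_iff_left two_ne_zero, sub_eq_zero] at h
  have h2 := congrArg norm h
  rw [Complex.norm_exp, Complex.norm_exp, Real.exp_eq_exp, Complex.neg_re] at h2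
  exact hz (by linarith)

theorem sinh_two_ne_zero {b : ℝ} (hb : 0 < b) {σ : ℂ} (hσ : σ.re ≠ 0) :
    Complex.sinh (Real.pi * b * (2 * σ)) ≠ 0 := by
  refine sinh_ne_zero_of_re ?_
  rw [← Complex.ofReal_mul, Complex.re_ofReal_mul]
  have := Real.pi_pos
  simp only [Complex.mul_re, Complex.re_ofNat, Complex.im_ofNat, zero_mul, sub_zero]
  have := mul_pos this hb
  exact mul_ne_zero this.ne' (mul_ne_zero two_ne_zero hσ)

theorem sinh_two_add_ne_zero {b : ℝ} (hb : 0 < b) {σ : ℂ} (hσ : σ.re ≠ 0) :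
    Complex.sinh (Real.pi * b * (2 * σ + Complex.I * b)) ≠ 0 := by
  have h := sinh_two_ne_zero hb (σ := σ + Complex.I * b / 2) (by simpa using hσ)
  rwa [show 2 * (σ + Complex.I * b / 2) = 2 * σ + Complex.I * b by ring] at h

/-- What remains of the telescoping of the integrand after the common s_b factors are taken out: the
left side comes from the operator in σ, the right side from the discrete derivative in x. In
exponential variables it becomes `laurent_telescoping`; Re σ ≠ 0 keeps the denominators nonzero. -/
theorem trig_telescoping {b : ℝ} (hb : 0 < b) (t0 t1 st : ℝ) (tt ti x : ℂ) {σ : ℂ}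
    (hσ : σ.re ≠ 0) :
    intCoeff b (edgeShift t0 t1 tt ti) σ *
        (Complex.sinh (Real.pi * b * (x + ti - σ)) *
          Complex.sinh (Real.pi * b * (x + Complex.I * b + ti - σ))) +
      intCoeff b (edgeShift t0 t1 tt ti) (-σ) *
        (Complex.sinh (Real.pi * b * (x + ti + σ)) *
          Complex.sinh (Real.pi * b * (x + Complex.I * b + ti + σ))) +
      (potential b t0 t1 tt ti σ - 2 * Complex.cosh (Real.pi * b * (2 * st))) *
        (Complex.sinh (Real.pi * b * (x + Complex.I * b + ti + σ)) *
          Complex.sinh (Real.pi * b * (x + Complex.I * b + ti - σ))) =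
    -4 * ((Complex.cosh (Real.pi * b * (x + t1 + Complex.I * b / 2)) *
          Complex.cosh (Real.pi * b * (x - t1 + Complex.I * b / 2))) *
        (Complex.cosh (Real.pi * b * (x + t0 + ti + tt + Complex.I * b / 2)) *
          Complex.cosh (Real.pi * b * (x - t0 + ti + tt + Complex.I * b / 2)))) +
      4 * ((Complex.sinh (Real.pi * b * (x + Complex.I * b + ti + σ)) *
          Complex.sinh (Real.pi * b * (x + Complex.I * b + ti - σ))) *
        (Complex.sinh (Real.pi * b * (x + tt + st)) *
          Complex.sinh (Real.pi * b * (x + tt - st)))) := by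
  have n1 := sinh_two_ne_zero hb hσ
  have n2 := sinh_two_add_ne_zero hb hσ
  have n3 := sinh_two_add_ne_zero hb (σ := -σ) (by simpa using hσ)
  have m3 : Complex.sinh (Real.pi * b * (2 * -σ)) = -Complex.sinh (Real.pi * b * (2 * σ)) := by
    rw [← Complex.sinh_neg]; congr 1; ring
  unfold intCoeff potential potentialTerm edgeShift
  simp only [Fin.prod_univ_four, Matrix.cons_val_zero, Matrix.cons_val_one, Matrix.cons_val]
  rw [m3]
  -- From here p = πb and β = ib are independent symbols; the identity does not use their relation.
  generalize hp : (Real.pi * b : ℂ) = p at *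
  generalize Complex.I * (b : ℂ) = β at *
  set S := Complex.exp (p * (2 * σ)) with hS
  set Q := Complex.exp (p * β) with hQ
  set W := Complex.exp (p * (2 * ti)) with hW
  set U := Complex.exp (p * (2 * tt)) with hU
  set P := Complex.exp (p * (2 * t1)) with hP
  set X := Complex.exp (p * (2 * x)) with hX
  have hS0 : S ≠ 0 := Complex.exp_ne_zero _
  have hQ0 : Q ≠ 0 := Complex.exp_ne_zero _
  have hW0 : W ≠ 0 := Complex.exp_ne_zero _
  have hU0 : U ≠ 0 := Complex.exp_ne_zero _
  have hP0 : P ≠ 0 := Complex.exp_ne_zero _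
  have hX0 : X ≠ 0 := Complex.exp_ne_zero _
  have d1 : Complex.sinh (p * (2 * σ)) = (S ^ 2 - 1) / (2 * S) := by
    rw [sinh_of_exp hS.symm]; field_simp
  have d2 : Complex.sinh (p * (2 * σ + β)) = (S ^ 2 * Q ^ 2 - 1) / (2 * S * Q) := by
    rw [sinh_of_exp (Z := S * Q) (by rw [hS, hQ, ← Complex.exp_add]; ring_nf)]; field_simp
  have d3 : Complex.sinh (p * (2 * -σ + β)) = (Q ^ 2 - S ^ 2) / (2 * S * Q) := by
    rw [sinh_of_exp (Z := Q / S) (by rw [hS, hQ, ← Complex.exp_sub]; ring_nf)]; field_simp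
  rw [d1] at n1
  rw [d2] at n2
  rw [d3] at n3
  have h1 : S ^ 2 - 1 ≠ 0 := fun h => n1 (by rw [h, zero_div])
  have h2 : S ^ 2 * Q ^ 2 - 1 ≠ 0 := fun h => n2 (by rw [h, zero_div])
  have h3 : Q ^ 2 - S ^ 2 ≠ 0 := fun h => n3 (by rw [h, zero_div])
  have key := laurent_telescoping (Complex.cosh (p * (2 * t0))) (Complex.cosh (p * (2 * st)))
    hS0 hQ0 hW0 hU0 hP0 hX0 h1 h2 h3
  have cP : Complex.cosh (p * (2 * t1)) = (P + P⁻¹) / 2 := cosh_of_exp hP.symm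
  have cQ : Complex.cosh (p * β) = (Q + Q⁻¹) / 2 := cosh_of_exp hQ.symm
  have cW : Complex.cosh (p * (2 * ti)) = (W + W⁻¹) / 2 := cosh_of_exp hW.symm
  have cS : Complex.cosh (p * (2 * σ)) = (S + S⁻¹) / 2 := cosh_of_exp hS.symm
  have cQ' : ∀ a, a = -(p * β) → Complex.cosh a = (Q + Q⁻¹) / 2 := fun a ha => by
    rw [ha, Complex.cosh_neg, cQ]
  have a1 : Complex.cosh (p * (σ + (t1 + ti) + β / 2)) * Complex.cosh (p * (σ + (-t1 + ti) + β / 2)) =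
      ((S * Q * W + (S * Q * W)⁻¹) / 2 + (P + P⁻¹) / 2) / 2 :=
    cosh_mul_cosh_of_exp (by simp only [hS, hQ, hW, ← Complex.exp_add]; ring_nf)
      (by rw [← cP]; ring_nf)
  have a2 : Complex.cosh (p * (σ + (t0 - tt) + β / 2)) * Complex.cosh (p * (σ + (-t0 - tt) + β / 2)) =
      ((S * Q / U + (S * Q / U)⁻¹) / 2 + Complex.cosh (p * (2 * t0))) / 2 :=
    cosh_mul_cosh_of_exp (by simp only [hS, hQ, hU, ← Complex.exp_add, ← Complex.exp_sub]; ring_nf)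
      (by ring_nf)
  have b1 : Complex.cosh (p * (-σ + (t1 + ti) + β / 2)) *
      Complex.cosh (p * (-σ + (-t1 + ti) + β / 2)) =
      ((Q * W / S + (Q * W / S)⁻¹) / 2 + (P + P⁻¹) / 2) / 2 :=
    cosh_mul_cosh_of_exp (by simp only [hS, hQ, hW, ← Complex.exp_add, ← Complex.exp_sub]; ring_nf)
      (by rw [← cP]; ring_nf)
  have b2 : Complex.cosh (p * (-σ + (t0 - tt) + β / 2)) *
      Complex.cosh (p * (-σ + (-t0 - tt) + β / 2)) =
      ((Q / (S * U) + (Q / (S * U))⁻¹) / 2 + Complex.cosh (p * (2 * t0))) / 2 :=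
    cosh_mul_cosh_of_exp (by simp only [hS, hQ, hU, ← Complex.exp_add, ← Complex.exp_sub]; ring_nf)
      (by ring_nf)
  have e1 : Complex.cosh (p * (ti - β / 2 - t1 - σ)) * Complex.cosh (p * (-ti - β / 2 - t1 - σ)) =
      ((Q * P * S + (Q * P * S)⁻¹) / 2 + (W + W⁻¹) / 2) / 2 := by
    rw [mul_comm, ← Complex.cosh_neg, ← Complex.cosh_neg (p * (ti - β / 2 - t1 - σ))]
    exact cosh_mul_cosh_of_exp (by simp only [hS, hQ, hP, ← Complex.exp_add]; ring_nf)
      (by rw [← cW]; ring_nf)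
  have e2 : Complex.cosh (p * (t0 - β / 2 - tt - σ)) * Complex.cosh (p * (-t0 - β / 2 - tt - σ)) =
      ((Q * U * S + (Q * U * S)⁻¹) / 2 + Complex.cosh (p * (2 * t0))) / 2 := by
    rw [mul_comm, ← Complex.cosh_neg, ← Complex.cosh_neg (p * (t0 - β / 2 - tt - σ))]
    exact cosh_mul_cosh_of_exp (by simp only [hS, hQ, hU, ← Complex.exp_add]; ring_nf)
      (by ring_nf)
  have f1 : Complex.cosh (p * (ti - β / 2 - t1 - -σ)) *
      Complex.cosh (p * (-ti - β / 2 - t1 - -σ)) =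
      ((Q * P / S + (Q * P / S)⁻¹) / 2 + (W + W⁻¹) / 2) / 2 := by
    rw [mul_comm, ← Complex.cosh_neg, ← Complex.cosh_neg (p * (ti - β / 2 - t1 - -σ))]
    exact cosh_mul_cosh_of_exp
      (by simp only [hS, hQ, hP, ← Complex.exp_add, ← Complex.exp_sub]; ring_nf)
      (by rw [← cW]; ring_nf)
  have f2 : Complex.cosh (p * (t0 - β / 2 - tt - -σ)) *
      Complex.cosh (p * (-t0 - β / 2 - tt - -σ)) =
      ((Q * U / S + (Q * U / S)⁻¹) / 2 + Complex.cosh (p * (2 * t0))) / 2 := by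
    rw [mul_comm, ← Complex.cosh_neg, ← Complex.cosh_neg (p * (t0 - β / 2 - tt - -σ))]
    exact cosh_mul_cosh_of_exp
      (by simp only [hS, hQ, hU, ← Complex.exp_add, ← Complex.exp_sub]; ring_nf)
      (by ring_nf)
  have g1 : Complex.cosh (p * (2 * (t1 + tt + β / 2))) = (P * U * Q + (P * U * Q)⁻¹) / 2 :=
    cosh_of_exp (by simp only [hP, hQ, hU, ← Complex.exp_add]; ring_nf)
  have k1 : Complex.sinh (p * (x + ti - σ)) * Complex.sinh (p * (x + β + ti - σ)) =
      ((X * W * Q / S + (X * W * Q / S)⁻¹) / 2 - (Q + Q⁻¹) / 2) / 2 :=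
    sinh_mul_sinh_of_exp
      (by simp only [hX, hS, hQ, hW, ← Complex.exp_add, ← Complex.exp_sub]; ring_nf)
      (cQ' _ (by ring))
  have k2 : Complex.sinh (p * (x + ti + σ)) * Complex.sinh (p * (x + β + ti + σ)) =
      ((X * W * Q * S + (X * W * Q * S)⁻¹) / 2 - (Q + Q⁻¹) / 2) / 2 :=
    sinh_mul_sinh_of_exp (by simp only [hX, hS, hQ, hW, ← Complex.exp_add]; ring_nf)
      (cQ' _ (by ring))
  have k3 : Complex.sinh (p * (x + β + ti + σ)) * Complex.sinh (p * (x + β + ti - σ)) =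
      ((X * W * Q ^ 2 + (X * W * Q ^ 2)⁻¹) / 2 - (S + S⁻¹) / 2) / 2 :=
    sinh_mul_sinh_of_exp (by simp only [hX, hQ, hW, sq, ← Complex.exp_add]; ring_nf)
      (by rw [← cS]; ring_nf)
  have l1 : Complex.cosh (p * (x + t1 + β / 2)) * Complex.cosh (p * (x - t1 + β / 2)) =
      ((X * Q + (X * Q)⁻¹) / 2 + (P + P⁻¹) / 2) / 2 :=
    cosh_mul_cosh_of_exp (by simp only [hX, hQ, ← Complex.exp_add]; ring_nf)
      (by rw [← cP]; ring_nf)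
  have l2 : Complex.cosh (p * (x + t0 + ti + tt + β / 2)) *
      Complex.cosh (p * (x - t0 + ti + tt + β / 2)) =
      ((X * U * W * Q + (X * U * W * Q)⁻¹) / 2 + Complex.cosh (p * (2 * t0))) / 2 :=
    cosh_mul_cosh_of_exp (by simp only [hX, hQ, hU, hW, ← Complex.exp_add]; ring_nf)
      (by ring_nf)
  have l3 : Complex.sinh (p * (x + tt + st)) * Complex.sinh (p * (x + tt - st)) =
      ((X * U + (X * U)⁻¹) / 2 - Complex.cosh (p * (2 * st))) / 2 :=
    sinh_mul_sinh_of_exp (by simp only [hX, hU, ← Complex.exp_add]; ring_nf) (by ring_nf)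
  rw [mul_assoc (_ * _) (Complex.cosh (p * (σ + (t1 + ti) + β / 2))),
    mul_assoc (_ * _) (Complex.cosh (p * (-σ + (t1 + ti) + β / 2))),
    a1, a2, b1, b2, e1, e2, f1, f2, g1, k1, k2, k3, l1, l2, l3, d1, d2, d3]
  simp only [neg_mul, div_neg] at key ⊢
  linear_combination (1 / 2) * key

/-! ### The difference equation for the integral -/

/-- The part i/(2b) of iQ/2 adds iπ/2 to the argument of cosh, which therefore becomes i sinh. -/
theorem sFun_step_sinh {b : ℝ} (hb : 0 < b) {y z w : ℂ} (hz : z = -y - Complex.I * Qpar b / 2)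
    (hw : w = z + Complex.I * b) (him : -(Qpar b / 2) < z.im) :
    sFun b w = sStepConst b * Complex.I * Complex.sinh (Real.pi * b * y) * sFun b z := by
  have hbC : (b : ℂ) ≠ 0 := by exact_mod_cast hb.ne'
  rw [hw, sFun_step hb him]
  rw [show (Real.pi * b * (z + Complex.I * b / 2) : ℂ) =
    -(Real.pi * b * y + (Real.pi / 2 : ℂ) * Complex.I) by
      rw [hz]; unfold Qpar; push_cast; field_simp; ring,
    Complex.cosh_neg, Complex.cosh_add, Complex.cosh_mul_I, Complex.sinh_mul_I,
    Complex.cos_pi_div_two, Complex.sin_pi_div_two]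
  ring

theorem sFun_step_cosh {b : ℝ} (hb : 0 < b) {y z w : ℂ} (hz : y = z + Complex.I * b / 2)
    (hw : w = z + Complex.I * b) (him : -(Qpar b / 2) < z.im) :
    sFun b w = sStepConst b * Complex.cosh (Real.pi * b * y) * sFun b z := by
  rw [hw, sFun_step hb him, hz]

/-- The shifts in the numerator of the integrand of the fusion kernel. -/
def numShift (t0 t1 : ℝ) (tt ti : ℂ) : Fin 4 → ℂ := ![t1, -t1, t0 + ti + tt, -t0 + ti + tt]

/-- The shifts in the denominator of the integrand of the fusion kernel; `r` is an additional shift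
of the pair that depends on `σ_t`. -/
def denShift (b st : ℝ) (tt ti σ r : ℂ) : Fin 4 → ℂ :=
  ![-(Complex.I * Qpar b / 2) - ti - σ, -(Complex.I * Qpar b / 2) - ti + σ,
    -(Complex.I * Qpar b / 2) - tt - st + r, -(Complex.I * Qpar b / 2) - tt + st + r]

theorem im_I_Qpar (b : ℝ) : (Complex.I * Qpar b / 2 : ℂ).im = Qpar b / 2 := by simp

/-- This is the decay rate of the integrand divided by π. The complex parts of θ_t and θ_∞ drop out,
and the rate stays negative for r = ib because b < Q. -/
theorem sum_im_shift (b t0 t1 st : ℝ) (tt ti σ r : ℂ) :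
    ∑ j, ((numShift t0 t1 tt ti j).im + (denShift b st tt ti σ r j).im) =
      -2 * Qpar b + 2 * r.im := by
  simp only [Fin.sum_univ_four, numShift, denShift, Matrix.cons_val_zero, Matrix.cons_val_one,
    Matrix.cons_val, Complex.add_im, Complex.sub_im, Complex.neg_im, Complex.ofReal_im, im_I_Qpar]
  ring

/-- The conditions come from the numerator, the σ_s pair and the σ_t pair. Raising Im `tt` while
lowering Im `ti` by the same amount relaxes the σ_s condition at the expense of the σ_t one; the
dual equation relies on this trade. -/
theorem separates_iff {b t0 t1 st : ℝ} {tt ti σ r : ℂ} {h : ℝ} (hsum : (tt + ti).im = 0) :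
    Separates b (numShift t0 t1 tt ti) (denShift b st tt ti σ r) h ↔
      h < Qpar b / 2 ∧ |σ.im| + ti.im < h ∧ tt.im < h + r.im := by
  rw [Complex.add_im] at hsum
  simp only [Separates, Fin.forall_fin_succ, numShift, denShift, IsEmpty.forall_iff,
    Matrix.cons_val_zero, Matrix.cons_val_succ, Complex.add_im, Complex.sub_im, Complex.neg_im,
    Complex.ofReal_im, im_I_Qpar]
  constructor
  · rintro ⟨⟨h1, h2⟩, ⟨h3, h4⟩, ⟨h5, h6⟩, ⟨h7, h8⟩, -⟩
    refine ⟨by linarith, ?_, by linarith⟩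
    rcases abs_cases σ.im with ⟨h, _⟩ | ⟨h, _⟩ <;> rw [h] <;> linarith
  · rintro ⟨h1, h2, h3⟩
    have := neg_abs_le σ.im
    have := le_abs_self σ.im
    refine ⟨⟨?_, ?_⟩, ⟨?_, ?_⟩, ⟨?_, ?_⟩, ⟨?_, ?_⟩, trivial⟩ <;> linarith

/-- The integral in the fusion kernel, for complex `θ_t`, `θ_∞`, along `Im x = -h`. -/
def fusionInt (b t0 t1 st h : ℝ) (tt ti σ : ℂ) : ℂ :=
  sInt b (numShift t0 t1 tt ti) (denShift b st tt ti σ 0) h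

theorem denShift_neg (b st : ℝ) (tt ti σ r : ℂ) (a : Fin 4 → ℂ) :
    sProd b a (denShift b st tt ti (-σ) r) = sProd b a (denShift b st tt ti σ r) := by
  ext x
  simp only [sProd, Fin.prod_univ_four, denShift, Matrix.cons_val_zero, Matrix.cons_val_one,
    Matrix.cons_val, sub_neg_eq_add, ← sub_eq_add_neg]
  ring

theorem fusionInt_neg (b t0 t1 st h : ℝ) (tt ti σ : ℂ) :
    fusionInt b t0 t1 st h tt ti (-σ) = fusionInt b t0 t1 st h tt ti σ := by
  unfold fusionInt sInt
  rw [denShift_neg]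

/-- All factors are reduced by one or two steps to the same eight values of s_b, each term
collecting k⁴. The discrete derivative uses r = ib: replacing x by x + ib undoes this shift in the
σ_t pair, so J(x + ib) has the σ_t factors of the integrand itself. -/
theorem sProd_telescoping {b : ℝ} (hb : 0 < b) (t0 t1 st : ℝ) {tt ti σ x : ℂ} (hσ : σ.re ≠ 0)
    {h : ℝ} (hh : h < Qpar b / 2) (hti : |σ.im| + b + ti.im < h) (htt : tt.im < h)
    (hsum : (tt + ti).im = 0) (hx : x.im = -h) :
    sStepConst b ^ 2 * (intCoeff b (edgeShift t0 t1 tt ti) σ *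
        sProd b (numShift t0 t1 tt ti) (denShift b st tt ti (σ + Complex.I * b) 0) x +
      intCoeff b (edgeShift t0 t1 tt ti) (-σ) *
        sProd b (numShift t0 t1 tt ti) (denShift b st tt ti (σ - Complex.I * b) 0) x +
      (potential b t0 t1 tt ti σ - 2 * Complex.cosh (Real.pi * b * (2 * st))) *
        sProd b (numShift t0 t1 tt ti) (denShift b st tt ti σ 0) x) =
    4 * (sProd b (numShift t0 t1 tt ti) (denShift b st tt ti σ (Complex.I * b))
          (x + Complex.I * b) -
        sProd b (numShift t0 t1 tt ti) (denShift b st tt ti σ (Complex.I * b)) x) := by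
  have htrig := trig_telescoping hb t0 t1 st tt ti x hσ
  have hσ1 := neg_abs_le σ.im
  have hσ2 := le_abs_self σ.im
  rw [Complex.add_im] at hsum
  have hI : (Complex.I * b : ℂ).im = b := by simp
  have im1 : -(Qpar b / 2) < (-x + (-(Complex.I * Qpar b / 2) - ti - (σ + Complex.I * b))).im := by
    simp only [Complex.add_im, Complex.sub_im, Complex.neg_im, im_I_Qpar, hx, hI]; linarith
  have im2 : -(Qpar b / 2) < (-x + (-(Complex.I * Qpar b / 2) - ti + (σ - Complex.I * b))).im := by
    simp only [Complex.add_im, Complex.sub_im, Complex.neg_im, im_I_Qpar, hx, hI]; linarith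
  have im3 : -(Qpar b / 2) < (-x + (-(Complex.I * Qpar b / 2) - ti - σ)).im := by
    simp only [Complex.add_im, Complex.sub_im, Complex.neg_im, im_I_Qpar, hx]; linarith
  have im4 : -(Qpar b / 2) < (-x + (-(Complex.I * Qpar b / 2) - ti + σ)).im := by
    simp only [Complex.add_im, Complex.sub_im, Complex.neg_im, im_I_Qpar, hx]; linarith
  have im5 : -(Qpar b / 2) < (-x + (-(Complex.I * Qpar b / 2) - tt - st + 0)).im := by
    simp only [Complex.add_im, Complex.sub_im, Complex.neg_im, im_I_Qpar, hx, Complex.ofReal_im,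
      Complex.zero_im]
    linarith
  have im6 : -(Qpar b / 2) < (-x + (-(Complex.I * Qpar b / 2) - tt + st + 0)).im := by
    simp only [Complex.add_im, Complex.sub_im, Complex.neg_im, im_I_Qpar, hx, Complex.ofReal_im,
      Complex.zero_im]
    linarith
  have im7 : -(Qpar b / 2) < (x + t1).im := by
    simp only [Complex.add_im, hx, Complex.ofReal_im]; linarith
  have im8 : -(Qpar b / 2) < (x + -t1).im := by
    simp only [Complex.add_im, Complex.neg_im, hx, Complex.ofReal_im]; linarith
  have im9 : -(Qpar b / 2) < (x + (t0 + ti + tt)).im := by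
    simp only [Complex.add_im, hx, Complex.ofReal_im]; linarith
  have im10 : -(Qpar b / 2) < (x + (-t0 + ti + tt)).im := by
    simp only [Complex.add_im, Complex.neg_im, hx, Complex.ofReal_im]; linarith
  -- the functions on the line, in terms of the most shifted ones
  have e1 : sFun b (-x + (-(Complex.I * Qpar b / 2) - ti - σ)) = _ :=
    sFun_step_sinh hb (y := x + Complex.I * b + ti + σ) (by ring) (by ring) im1
  have e2 : sFun b (-x + (-(Complex.I * Qpar b / 2) - ti + σ)) = _ :=
    sFun_step_sinh hb (y := x + Complex.I * b + ti - σ) (by ring) (by ring) im2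
  have e3 : sFun b (-x + (-(Complex.I * Qpar b / 2) - ti - (σ - Complex.I * b))) = _ :=
    sFun_step_sinh hb (y := x + ti + σ) (by ring) (by ring) im3
  have e4 : sFun b (-x + (-(Complex.I * Qpar b / 2) - ti + (σ + Complex.I * b))) = _ :=
    sFun_step_sinh hb (y := x + ti - σ) (by ring) (by ring) im4
  have e5 : sFun b (-x + (-(Complex.I * Qpar b / 2) - tt - st + Complex.I * b)) = _ :=
    sFun_step_sinh hb (y := x + tt + st) (by ring) (by ring) im5
  have e6 : sFun b (-x + (-(Complex.I * Qpar b / 2) - tt + st + Complex.I * b)) = _ :=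
    sFun_step_sinh hb (y := x + tt - st) (by ring) (by ring) im6
  have e7 : sFun b (x + Complex.I * b + t1) = _ :=
    sFun_step_cosh hb (y := x + t1 + Complex.I * b / 2) rfl (by ring) im7
  have e8 : sFun b (x + Complex.I * b + -t1) = _ :=
    sFun_step_cosh hb (y := x - t1 + Complex.I * b / 2) (by ring) (by ring) im8
  have e9 : sFun b (x + Complex.I * b + (t0 + ti + tt)) = _ :=
    sFun_step_cosh hb (y := x + t0 + ti + tt + Complex.I * b / 2) (by ring) (by ring) im9
  have e10 : sFun b (x + Complex.I * b + (-t0 + ti + tt)) = _ :=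
    sFun_step_cosh hb (y := x - t0 + ti + tt + Complex.I * b / 2) (by ring) (by ring) im10
  have g1 : -(x + Complex.I * b) + (-(Complex.I * Qpar b / 2) - ti - σ) =
    -x + (-(Complex.I * Qpar b / 2) - ti - (σ + Complex.I * b)) := by ring
  have g2 : -(x + Complex.I * b) + (-(Complex.I * Qpar b / 2) - ti + σ) =
    -x + (-(Complex.I * Qpar b / 2) - ti + (σ - Complex.I * b)) := by ring
  have g3 : -(x + Complex.I * b) + (-(Complex.I * Qpar b / 2) - tt - st + Complex.I * b) =
    -x + (-(Complex.I * Qpar b / 2) - tt - st + 0) := by ring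
  have g4 : -(x + Complex.I * b) + (-(Complex.I * Qpar b / 2) - tt + st + Complex.I * b) =
    -x + (-(Complex.I * Qpar b / 2) - tt + st + 0) := by ring
  simp only [sProd, Fin.prod_univ_four, numShift, denShift, Matrix.cons_val_zero,
    Matrix.cons_val_one, Matrix.cons_val]
  rw [g1, g2, g3, g4, e3, e4, e5, e6, e7, e8, e9, e10, e1, e2]
  generalize sFun b (-x + (-(Complex.I * Qpar b / 2) - ti - (σ + Complex.I * b))) = s1
  generalize sFun b (-x + (-(Complex.I * Qpar b / 2) - ti + (σ - Complex.I * b))) = s2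
  generalize sFun b (-x + (-(Complex.I * Qpar b / 2) - tt - st + 0)) = s3
  generalize sFun b (-x + (-(Complex.I * Qpar b / 2) - tt + st + 0)) = s4
  generalize sFun b (x + t1) = s5
  generalize sFun b (x + -t1) = s6
  generalize sFun b (x + (t0 + ti + tt)) = s7
  generalize sFun b (x + (-t0 + ti + tt)) = s8
  have hI2 : Complex.I ^ 4 = 1 := Complex.I_pow_four
  have hI3 : Complex.I ^ 2 = -1 := Complex.I_sq
  generalize sStepConst b = k
  generalize intCoeff b (edgeShift t0 t1 tt ti) σ = A at *
  generalize intCoeff b (edgeShift t0 t1 tt ti) (-σ) = B at *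
  generalize potential b t0 t1 tt ti σ - 2 * Complex.cosh (Real.pi * b * (2 * st)) = D at *
  generalize Complex.sinh (Real.pi * b * (x + ti - σ)) = q1 at *
  generalize Complex.sinh (Real.pi * b * (x + Complex.I * b + ti - σ)) = q2 at *
  generalize Complex.sinh (Real.pi * b * (x + ti + σ)) = q3 at *
  generalize Complex.sinh (Real.pi * b * (x + Complex.I * b + ti + σ)) = q4 at *
  generalize Complex.sinh (Real.pi * b * (x + tt + st)) = q5 at *
  generalize Complex.sinh (Real.pi * b * (x + tt - st)) = q6 at *
  generalize Complex.cosh (Real.pi * b * (x + t1 + Complex.I * b / 2)) = c1 at *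
  generalize Complex.cosh (Real.pi * b * (x - t1 + Complex.I * b / 2)) = c2 at *
  generalize Complex.cosh (Real.pi * b * (x + t0 + ti + tt + Complex.I * b / 2)) = c3 at *
  generalize Complex.cosh (Real.pi * b * (x - t0 + ti + tt + Complex.I * b / 2)) = c4 at *
  linear_combination (k ^ 4 * Complex.I ^ 2 * (s1 * s2 * s3 * s4 * s5 * s6 * s7 * s8)) * htrig +
    (4 * k ^ 4 * (s1 * s2 * s3 * s4 * s5 * s6 * s7 * s8) * (q2 * q4 * q5 * q6) * (Complex.I ^ 2) -
      4 * k ^ 4 * (s1 * s2 * s3 * s4 * s5 * s6 * s7 * s8) * (c1 * c2 * c3 * c4)) * hI3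

/-- Integrate the telescoping identity. The poles of J are separated by both lines, at depths h and
h - b, so the two integrals on the right cancel, and then the nonzero constant k² is divided out. -/
theorem fusionInt_difference {b : ℝ} (hb : 0 < b) (t0 t1 st : ℝ) {tt ti σ : ℂ} (hσ : σ.re ≠ 0)
    {h : ℝ} (hh : h < Qpar b / 2) (hti : |σ.im| + b + ti.im < h) (htt : tt.im < h)
    (hsum : (tt + ti).im = 0) :
    intCoeff b (edgeShift t0 t1 tt ti) σ *
        fusionInt b t0 t1 st h tt ti (σ + Complex.I * b) +
      intCoeff b (edgeShift t0 t1 tt ti) (-σ) *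
        fusionInt b t0 t1 st h tt ti (σ - Complex.I * b) +
      (potential b t0 t1 tt ti σ - 2 * Complex.cosh (Real.pi * b * (2 * st))) *
        fusionInt b t0 t1 st h tt ti σ = 0 := by
  have hb' : 0 < b⁻¹ := inv_pos.2 hb
  have hI : (Complex.I * b : ℂ).im = b := by simp
  have habs1 : |(σ + Complex.I * b).im| ≤ |σ.im| + b := by
    rw [Complex.add_im, hI]
    exact (abs_add_le _ _).trans (by rw [abs_of_pos hb])
  have habs2 : |(σ - Complex.I * b).im| ≤ |σ.im| + b := by
    rw [Complex.sub_im, hI]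
    exact (abs_sub _ _).trans (by rw [abs_of_pos hb])
  have sep : ∀ σ' : ℂ, |σ'.im| ≤ |σ.im| + b →
      Separates b (numShift t0 t1 tt ti) (denShift b st tt ti σ' 0) h := fun σ' hσ' =>
    (separates_iff hsum).2 ⟨hh, by linarith, by simpa using htt⟩
  have hint : ∀ σ' : ℂ, |σ'.im| ≤ |σ.im| + b → Integrable fun x : ℝ =>
      sProd b (numShift t0 t1 tt ti) (denShift b st tt ti σ' 0) (x - Complex.I * h) := by
    intro σ' hσ'
    refine integrable_sProd hb (sep σ' hσ') ?_
    rw [sum_im_shift]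
    have := Qpar_pos hb
    simp
    linarith
  have hneg : ∑ j, ((numShift t0 t1 tt ti j).im +
      (denShift b st tt ti σ (Complex.I * b) j).im) < 0 := by
    rw [sum_im_shift, hI]
    unfold Qpar
    linarith
  have sep1 : Separates b (numShift t0 t1 tt ti) (denShift b st tt ti σ (Complex.I * b)) h :=
    (separates_iff hsum).2 ⟨hh, by linarith, by rw [hI]; linarith⟩
  -- Raising the line by b uses up the margin b for the σ_s pair, and the shift r = ib makes up for
  -- it in the σ_t pair.
  have sep2 : Separates b (numShift t0 t1 tt ti) (denShift b st tt ti σ (Complex.I * b)) (h - b) :=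
    (separates_iff hsum).2 ⟨by linarith, by linarith, by rw [hI]; linarith⟩
  have hshift := sInt_eq_of_separates hb sep1 sep2 hneg
  have i1 := integrable_sProd hb sep1 hneg
  have i2 := integrable_sProd hb sep2 hneg
  have hline : ∀ x : ℝ, ((x : ℂ) - Complex.I * (h - b : ℝ)) = x - Complex.I * h + Complex.I * b :=
    fun x => by push_cast; ring
  unfold sInt at hshift
  simp only [hline] at hshift i2
  have key := integral_congr_ae (μ := volume) (Eventually.of_forall fun x : ℝ =>
    sProd_telescoping hb t0 t1 st hσ hh hti htt hsum
      (x := (x : ℂ) - Complex.I * h) (by simp))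
  have j1 := (hint _ habs1).const_mul (intCoeff b (edgeShift t0 t1 tt ti) σ)
  have j2 := (hint _ habs2).const_mul (intCoeff b (edgeShift t0 t1 tt ti) (-σ))
  have j3 := (hint σ (by linarith)).const_mul
    (potential b t0 t1 tt ti σ - 2 * Complex.cosh (Real.pi * b * (2 * st)))
  have hA := integral_add (j1.add j2) j3
  have hB := integral_add j1 j2
  simp only [Pi.add_apply] at hA
  rw [integral_const_mul, integral_const_mul, integral_sub i2 i1, ← hshift, sub_self, mul_zero,
    hA, hB, integral_const_mul, integral_const_mul,
    integral_const_mul] at key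
  exact (mul_eq_zero.1 key).resolve_left (pow_ne_zero 2 (sStepConst_ne_zero b))

/-! ### Conjugation by the prefactor -/

/-- The part of the prefactor of the fusion kernel that depends on `σ = σ_s`. -/
def edgeFactor (b : ℝ) (a : Fin 4 → ℂ) (σ : ℂ) : ℂ :=
  (∏ j, (hyperbolicE b b⁻¹ (a j + σ) * hyperbolicE b b⁻¹ (a j - σ))) *
    (hyperbolicE b b⁻¹ (-(Complex.I * Qpar b / 2) - 2 * σ) *
      hyperbolicE b b⁻¹ (-(Complex.I * Qpar b / 2) + 2 * σ))⁻¹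

/-- The coefficient `H_F^+` for complex `θ_t`, `θ_∞`. -/
def shiftCoeff (b : ℝ) (a : Fin 4 → ℂ) (σ : ℂ) : ℂ :=
  4 * (Real.pi : ℂ) ^ 2 *
    (Complex.Gamma (1 + 2 * b ^ 2 - 2 * Complex.I * b * σ) *
      Complex.Gamma (b ^ 2 - 2 * Complex.I * b * σ) *
      Complex.Gamma (-2 * Complex.I * b * σ) *
      Complex.Gamma (1 + b ^ 2 - 2 * Complex.I * b * σ)) *
    ∏ j, ((Complex.Gamma (b * Qpar b / 2 - Complex.I * b * (σ + a j)))⁻¹ *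
        (Complex.Gamma (b * Qpar b / 2 - Complex.I * b * (σ - a j)))⁻¹)

theorem edgeFactor_neg (b : ℝ) (a : Fin 4 → ℂ) (σ : ℂ) :
    edgeFactor b a (-σ) = edgeFactor b a σ := by
  unfold edgeFactor
  simp only [sub_neg_eq_add, mul_neg, ← sub_eq_add_neg]
  congr 1
  · exact Finset.prod_congr rfl fun j _ => mul_comm _ _
  · rw [mul_comm]

/-- The ratio of the exponential factors of `E` under the shift `σ ↦ σ + ib`. -/
def expRatio (b : ℝ) (σ : ℂ) : ℂ :=
  Complex.exp (Complex.I * b * (2 * σ + Complex.I * b) * Real.log b)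

/-- Raising a + σ by ib produces a reciprocal Gamma, which pairs with the first factor on the left
by reflection to give cosh/π. The second factor on the left is the one needed to return from a - σ -
ib to a - σ. -/
theorem gamma_mul_hyperbolicE_shift {b : ℝ} (hb : 0 < b) (a σ : ℂ) :
    (Complex.Gamma (b * Qpar b / 2 - Complex.I * b * (σ + a)))⁻¹ *
        (Complex.Gamma (b * Qpar b / 2 - Complex.I * b * (σ - a)))⁻¹ *
      (hyperbolicE b b⁻¹ (a + (σ + Complex.I * b)) * hyperbolicE b b⁻¹ (a - (σ + Complex.I * b))) =
    expRatio b σ * (Complex.cosh (Real.pi * b * (σ + a + Complex.I * b / 2)) / Real.pi) *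
      (hyperbolicE b b⁻¹ (a + σ) * hyperbolicE b b⁻¹ (a - σ)) := by
  have hbC : (b : ℂ) ≠ 0 := by exact_mod_cast hb.ne'
  set u := a + σ + Complex.I * b / 2 with hu
  set v := a - σ - Complex.I * b / 2 with hv
  have h1 := hyperbolicE_step hb u
  have h2 := hyperbolicE_step hb v
  rw [show u + Complex.I * b / 2 = a + (σ + Complex.I * b) by rw [hu]; ring,
    show u - Complex.I * b / 2 = a + σ by rw [hu]; ring] at h1
  rw [show v + Complex.I * b / 2 = a - σ by rw [hv]; ring,
    show v - Complex.I * b / 2 = a - (σ + Complex.I * b) by rw [hv]; ring] at h2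
  have g1 : (b * Qpar b / 2 - Complex.I * b * (σ + a) : ℂ) = 1 / 2 - Complex.I * b * u := by
    rw [hu]; unfold Qpar; push_cast; field_simp; ring_nf; simp only [Complex.I_sq]; ring
  have g2 : (b * Qpar b / 2 - Complex.I * b * (σ - a) : ℂ) = 1 / 2 + Complex.I * b * v := by
    rw [hv]; unfold Qpar; push_cast; field_simp; ring_nf; simp only [Complex.I_sq]; ring
  have h3 := Gamma_inv_mul_Gamma_inv (Complex.I * b * u)
  rw [show (Real.pi : ℂ) * (Complex.I * b * u) =
      Real.pi * b * (σ + a + Complex.I * b / 2) * Complex.I by rw [hu]; ring,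
    Complex.cos_mul_I] at h3
  have h4 : eStepFactor b u = expRatio b σ * eStepFactor b v := by
    unfold eStepFactor expRatio
    rw [← Complex.exp_add]
    congr 1
    rw [hu, hv]
    ring
  rw [g1, g2, h1, h2, eStep, eStep, h4, ← h3]
  ring

/-- Here 2σ moves by 2ib, so each E takes two steps and four Gamma values appear; two of them are on
the left. -/
theorem inv_hyperbolicE_shift {b : ℝ} (hb : 0 < b) (σ : ℂ) :
    Complex.Gamma (1 + 2 * b ^ 2 - 2 * Complex.I * b * σ) *
        Complex.Gamma (1 + b ^ 2 - 2 * Complex.I * b * σ) *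
      (hyperbolicE b b⁻¹ (-(Complex.I * Qpar b / 2) - 2 * (σ + Complex.I * b)) *
        hyperbolicE b b⁻¹ (-(Complex.I * Qpar b / 2) + 2 * (σ + Complex.I * b)))⁻¹ =
    (expRatio b σ ^ 4)⁻¹ * (Complex.Gamma (1 + 2 * Complex.I * b * σ) *
        Complex.Gamma (1 - b ^ 2 + 2 * Complex.I * b * σ)) *
      (hyperbolicE b b⁻¹ (-(Complex.I * Qpar b / 2) - 2 * σ) *
        hyperbolicE b b⁻¹ (-(Complex.I * Qpar b / 2) + 2 * σ))⁻¹ := by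
  have hbC : (b : ℂ) ≠ 0 := by exact_mod_cast hb.ne'
  set q : ℂ := -(Complex.I * Qpar b / 2) with hq
  have h1 := hyperbolicE_step hb (q - 2 * σ - Complex.I * b / 2)
  have h2 := hyperbolicE_step hb (q - 2 * σ - 3 * Complex.I * b / 2)
  have h3 := hyperbolicE_step hb (q + 2 * σ + Complex.I * b / 2)
  have h4 := hyperbolicE_step hb (q + 2 * σ + 3 * Complex.I * b / 2)
  rw [show q - 2 * σ - Complex.I * b / 2 + Complex.I * b / 2 = q - 2 * σ by ring,
    show q - 2 * σ - Complex.I * b / 2 - Complex.I * b / 2 =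
      q - 2 * σ - 3 * Complex.I * b / 2 + Complex.I * b / 2 by ring, h2,
    show q - 2 * σ - 3 * Complex.I * b / 2 - Complex.I * b / 2 = q - 2 * (σ + Complex.I * b) by
      ring] at h1
  rw [show q + 2 * σ + 3 * Complex.I * b / 2 + Complex.I * b / 2 = q + 2 * (σ + Complex.I * b) by
      ring,
    show q + 2 * σ + 3 * Complex.I * b / 2 - Complex.I * b / 2 =
      q + 2 * σ + Complex.I * b / 2 + Complex.I * b / 2 by ring, h3,
    show q + 2 * σ + Complex.I * b / 2 - Complex.I * b / 2 = q + 2 * σ by ring] at h4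
  have g1 : 1 / 2 + Complex.I * b * (q - 2 * σ - Complex.I * b / 2) =
      1 + b ^ 2 - 2 * Complex.I * b * σ := by
    rw [hq]; unfold Qpar; push_cast; field_simp; ring_nf; simp only [Complex.I_sq]; ring
  have g2 : 1 / 2 + Complex.I * b * (q - 2 * σ - 3 * Complex.I * b / 2) =
      1 + 2 * b ^ 2 - 2 * Complex.I * b * σ := by
    rw [hq]; unfold Qpar; push_cast; field_simp; ring_nf; simp only [Complex.I_sq]; ring
  have g3 : 1 / 2 + Complex.I * b * (q + 2 * σ + Complex.I * b / 2) =
      1 + 2 * Complex.I * b * σ := by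
    rw [hq]; unfold Qpar; push_cast; field_simp; ring_nf; simp only [Complex.I_sq]; ring
  have g4 : 1 / 2 + Complex.I * b * (q + 2 * σ + 3 * Complex.I * b / 2) =
      1 - b ^ 2 + 2 * Complex.I * b * σ := by
    rw [hq]; unfold Qpar; push_cast; field_simp; ring_nf; simp only [Complex.I_sq]; ring
  have hf : eStepFactor b (q + 2 * σ + Complex.I * b / 2) *
      eStepFactor b (q + 2 * σ + 3 * Complex.I * b / 2) =
      expRatio b σ ^ 4 * (eStepFactor b (q - 2 * σ - Complex.I * b / 2) *
        eStepFactor b (q - 2 * σ - 3 * Complex.I * b / 2)) := by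
    unfold eStepFactor expRatio
    rw [← Complex.exp_nat_mul, ← Complex.exp_add, ← Complex.exp_add, ← Complex.exp_add]
    congr 1
    push_cast
    ring
  have n1 : eStepFactor b (q - 2 * σ - Complex.I * b / 2) ≠ 0 := Complex.exp_ne_zero _
  have n2 : eStepFactor b (q - 2 * σ - 3 * Complex.I * b / 2) ≠ 0 := Complex.exp_ne_zero _
  have n3 : expRatio b σ ≠ 0 := Complex.exp_ne_zero _
  rw [h1, h4]
  simp only [eStep, g1, g2, g3, g4]
  generalize hyperbolicE b b⁻¹ (q - 2 * (σ + Complex.I * b)) = D1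
  generalize hyperbolicE b b⁻¹ (q + 2 * σ) = D2
  rw [show D1 * (eStepFactor b (q + 2 * σ + 3 * Complex.I * b / 2) *
      (Complex.Gamma (1 - b ^ 2 + 2 * Complex.I * b * σ))⁻¹ *
      (eStepFactor b (q + 2 * σ + Complex.I * b / 2) *
      (Complex.Gamma (1 + 2 * Complex.I * b * σ))⁻¹ * D2)) =
      (eStepFactor b (q + 2 * σ + Complex.I * b / 2) *
        eStepFactor b (q + 2 * σ + 3 * Complex.I * b / 2)) *
      (D1 * (Complex.Gamma (1 - b ^ 2 + 2 * Complex.I * b * σ))⁻¹ *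
      (Complex.Gamma (1 + 2 * Complex.I * b * σ))⁻¹ * D2) by ring, hf]
  simp only [mul_inv, inv_inv]
  ring

theorem Gamma_reflection_product (b : ℝ) (σ : ℂ) :
    Complex.Gamma (1 + 2 * Complex.I * b * σ) * Complex.Gamma (-2 * Complex.I * b * σ) *
      (Complex.Gamma (1 - b ^ 2 + 2 * Complex.I * b * σ) *
        Complex.Gamma (b ^ 2 - 2 * Complex.I * b * σ)) =
    -(Real.pi ^ 2 / (Complex.sinh (Real.pi * b * (2 * σ)) *
      Complex.sinh (Real.pi * b * (2 * σ + Complex.I * b)))) := by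
  have h1 := Complex.Gamma_mul_Gamma_one_sub (-2 * Complex.I * b * σ)
  have h2 := Complex.Gamma_mul_Gamma_one_sub (b ^ 2 - 2 * Complex.I * b * σ)
  rw [show (1 : ℂ) - -2 * Complex.I * b * σ = 1 + 2 * Complex.I * b * σ by ring,
    show (Real.pi : ℂ) * (-2 * Complex.I * b * σ) = -(Real.pi * b * (2 * σ) * Complex.I) by ring,
    Complex.sin_neg, Complex.sin_mul_I] at h1
  rw [show (1 : ℂ) - (b ^ 2 - 2 * Complex.I * b * σ) = 1 - b ^ 2 + 2 * Complex.I * b * σ by ring,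
    show (Real.pi : ℂ) * (b ^ 2 - 2 * Complex.I * b * σ) =
      -(Real.pi * b * (2 * σ + Complex.I * b) * Complex.I) by
      ring_nf; simp only [Complex.I_sq]; ring,
    Complex.sin_neg, Complex.sin_mul_I] at h2
  rw [mul_comm (Complex.Gamma (1 + 2 * Complex.I * b * σ)),
    mul_comm (Complex.Gamma (1 - b ^ 2 + 2 * Complex.I * b * σ)), h1, h2, div_mul_div_comm,
    ← div_neg]
  congr 1
  · ring
  · linear_combination (Complex.sinh (Real.pi * b * (2 * σ)) *
      Complex.sinh (Real.pi * b * (2 * σ + Complex.I * b))) * Complex.I_sq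

/-- The four numerator pairs give hyperbolic cosines, and the two reflections of
`Gamma_reflection_product` give the hyperbolic sines of `intCoeff`. The exponential factors cancel:
each of the four pairs contributes one `expRatio`, and the denominator its inverse fourth power. -/
theorem shiftCoeff_mul_edgeFactor {b : ℝ} (hb : 0 < b) (a : Fin 4 → ℂ) (σ : ℂ) :
    shiftCoeff b a σ * edgeFactor b a (σ + Complex.I * b) =
      intCoeff b a σ * edgeFactor b a σ := by
  have hpi : (Real.pi : ℂ) ≠ 0 := by exact_mod_cast Real.pi_ne_zero
  have n3 : expRatio b σ ≠ 0 := Complex.exp_ne_zero _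
  have h1 : (∏ j, ((Complex.Gamma (b * Qpar b / 2 - Complex.I * b * (σ + a j)))⁻¹ *
        (Complex.Gamma (b * Qpar b / 2 - Complex.I * b * (σ - a j)))⁻¹)) *
      ∏ j, (hyperbolicE b b⁻¹ (a j + (σ + Complex.I * b)) *
        hyperbolicE b b⁻¹ (a j - (σ + Complex.I * b))) =
      expRatio b σ ^ 4 * ((∏ j, Complex.cosh (Real.pi * b * (σ + a j + Complex.I * b / 2))) /
        Real.pi ^ 4) * ∏ j, (hyperbolicE b b⁻¹ (a j + σ) * hyperbolicE b b⁻¹ (a j - σ)) := by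
    rw [← Finset.prod_mul_distrib, Finset.prod_congr rfl fun j _ =>
      gamma_mul_hyperbolicE_shift hb (a j) σ, Finset.prod_mul_distrib, Finset.prod_mul_distrib,
      Finset.prod_div_distrib]
    simp
  have h2 := inv_hyperbolicE_shift hb σ
  have h3 := Gamma_reflection_product b σ
  unfold shiftCoeff edgeFactor intCoeff
  generalize (∏ j, ((Complex.Gamma (b * Qpar b / 2 - Complex.I * b * (σ + a j)))⁻¹ *
        (Complex.Gamma (b * Qpar b / 2 - Complex.I * b * (σ - a j)))⁻¹)) = p1 at *
  generalize ∏ j, (hyperbolicE b b⁻¹ (a j + (σ + Complex.I * b)) *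
        hyperbolicE b b⁻¹ (a j - (σ + Complex.I * b))) = p2 at *
  generalize (∏ j, Complex.cosh (Real.pi * b * (σ + a j + Complex.I * b / 2))) = p3 at *
  generalize ∏ j, (hyperbolicE b b⁻¹ (a j + σ) * hyperbolicE b b⁻¹ (a j - σ)) = p4 at *
  generalize (hyperbolicE b b⁻¹ (-(Complex.I * Qpar b / 2) - 2 * (σ + Complex.I * b)) *
        hyperbolicE b b⁻¹ (-(Complex.I * Qpar b / 2) + 2 * (σ + Complex.I * b)))⁻¹ = p5 at *
  generalize (hyperbolicE b b⁻¹ (-(Complex.I * Qpar b / 2) - 2 * σ) *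
        hyperbolicE b b⁻¹ (-(Complex.I * Qpar b / 2) + 2 * σ))⁻¹ = p6 at *
  calc _ = 4 * (Real.pi : ℂ) ^ 2 * (Complex.Gamma (b ^ 2 - 2 * Complex.I * b * σ) *
        Complex.Gamma (-2 * Complex.I * b * σ)) * (p1 * p2) *
        (Complex.Gamma (1 + 2 * b ^ 2 - 2 * Complex.I * b * σ) *
        Complex.Gamma (1 + b ^ 2 - 2 * Complex.I * b * σ) * p5) := by ring
    _ = 4 * (Real.pi : ℂ) ^ 2 * (p3 / Real.pi ^ 4 * p4) * p6 * (expRatio b σ ^ 4 *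
        (expRatio b σ ^ 4)⁻¹) *
        (Complex.Gamma (1 + 2 * Complex.I * b * σ) * Complex.Gamma (-2 * Complex.I * b * σ) *
      (Complex.Gamma (1 - b ^ 2 + 2 * Complex.I * b * σ) *
        Complex.Gamma (b ^ 2 - 2 * Complex.I * b * σ))) := by rw [h1, h2]; ring
    _ = _ := by
      rw [h3, mul_inv_cancel₀ (pow_ne_zero 4 n3)]
      field_simp

/-- The fusion kernel for complex `θ_t`, `θ_∞`, up to a factor independent of `σ = σ_s`, in terms
of the integral along `Im x = -h`. -/
def kernelFun (b t0 t1 st h : ℝ) (tt ti σ : ℂ) : ℂ :=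
  edgeFactor b (edgeShift t0 t1 tt ti) σ * fusionInt b t0 t1 st h tt ti σ

theorem kernelFun_neg (b t0 t1 st h : ℝ) (tt ti σ : ℂ) :
    kernelFun b t0 t1 st h tt ti (-σ) = kernelFun b t0 t1 st h tt ti σ := by
  unfold kernelFun
  rw [edgeFactor_neg, fusionInt_neg]

/-- E, s_b and Q are symmetric in b and 1/b, so `kernelFun_difference` with period 1/b speaks of the
same function. -/
theorem kernelFun_inv (b t0 t1 st h : ℝ) (tt ti σ : ℂ) :
    kernelFun b⁻¹ t0 t1 st h tt ti σ = kernelFun b t0 t1 st h tt ti σ := by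
  unfold kernelFun edgeFactor fusionInt sInt denShift sProd
  rw [hyperbolicE_inv, Qpar_inv, sFun_inv]

theorem kernelFun_difference {b : ℝ} (hb : 0 < b) (t0 t1 st : ℝ) {tt ti σ : ℂ} (hσ : σ.re ≠ 0)
    {h : ℝ} (hh : h < Qpar b / 2) (hti : |σ.im| + b + ti.im < h) (htt : tt.im < h)
    (hsum : (tt + ti).im = 0) :
    shiftCoeff b (edgeShift t0 t1 tt ti) σ * kernelFun b t0 t1 st h tt ti (σ + Complex.I * b) +
      shiftCoeff b (edgeShift t0 t1 tt ti) (-σ) *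
        kernelFun b t0 t1 st h tt ti (σ - Complex.I * b) +
      potential b t0 t1 tt ti σ * kernelFun b t0 t1 st h tt ti σ =
    2 * Complex.cosh (Real.pi * b * (2 * st)) * kernelFun b t0 t1 st h tt ti σ := by
  have h1 := shiftCoeff_mul_edgeFactor hb (edgeShift t0 t1 tt ti) σ
  have h2 := shiftCoeff_mul_edgeFactor hb (edgeShift t0 t1 tt ti) (-σ)
  -- Evenness of the edge factor turns the identity at -σ into the one for the downward shift σ -
  -- ib.
  rw [edgeFactor_neg, show -σ + Complex.I * b = -(σ - Complex.I * b) by ring, edgeFactor_neg] at h2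
  have h3 := fusionInt_difference hb t0 t1 st hσ hh hti htt hsum
  unfold kernelFun
  linear_combination (fusionInt b t0 t1 st h tt ti (σ + Complex.I * b)) * h1 +
    (fusionInt b t0 t1 st h tt ti (σ - Complex.I * b)) * h2 +
    (edgeFactor b (edgeShift t0 t1 tt ti) σ) * h3

/-! ### Continuation by a three-term recurrence -/

/-- The values `F(ρ + (n-1) ib)` of a solution of `F(σ + ib) = A(σ) F(σ) + B(σ) F(σ - ib)` with
initial values taken from `K`. -/
def stepChain (b : ℝ) (A B K : ℂ → ℂ) : ℕ → ℂ → ℂ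
  | 0, ρ => K (ρ - Complex.I * b)
  | 1, ρ => K ρ
  | n + 2, ρ => A (ρ + n * (Complex.I * b)) * stepChain b A B K (n + 1) ρ +
      B (ρ + n * (Complex.I * b)) * stepChain b A B K n ρ

/-- If K satisfies the recurrence at ρ, the first computed value is K(ρ + ib), so starting one step
higher yields the same sequence. This glues neighbouring strips of the continuation. -/
theorem stepChain_succ_eq {b : ℝ} {A B K : ℂ → ℂ} {ρ : ℂ}
    (h : K (ρ + Complex.I * b) = A ρ * K ρ + B ρ * K (ρ - Complex.I * b)) (n : ℕ) :
    stepChain b A B K (n + 1) ρ = stepChain b A B K n (ρ + Complex.I * b) := by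
  induction n using Nat.strong_induction_on with
  | _ n ih =>
    match n with
    | 0 => simp [stepChain]
    | 1 => simp [stepChain, h]
    | n + 2 =>
      rw [stepChain, ih (n + 1) (by omega), ih n (by omega), stepChain,
        show ρ + ((n + 1 : ℕ) : ℂ) * (Complex.I * b) =
          ρ + Complex.I * b + n * (Complex.I * b) by push_cast; ring]

theorem stepChain_eq_of_recurrence {b : ℝ} {A B K : ℂ → ℂ} {ρ : ℂ} (n : ℕ)
    (h : ∀ k : ℕ, k + 1 < n → K (ρ + k * (Complex.I * b) + Complex.I * b) =
      A (ρ + k * (Complex.I * b)) * K (ρ + k * (Complex.I * b)) +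
        B (ρ + k * (Complex.I * b)) * K (ρ + k * (Complex.I * b) - Complex.I * b)) :
    stepChain b A B K n ρ = K (ρ + (n - 1) * (Complex.I * b)) := by
  induction n using Nat.strong_induction_on with
  | _ n ih =>
    match n with
    | 0 => rw [stepChain]; congr 1; push_cast; ring
    | 1 => rw [stepChain]; congr 1; push_cast; ring
    | n + 2 =>
      rw [stepChain, ih (n + 1) (by omega) fun k hk => h k (by omega),
        ih n (by omega) fun k hk => h k (by omega),
        show ρ + (((n + 2 : ℕ) : ℂ) - 1) * (Complex.I * b) =
          ρ + n * (Complex.I * b) + Complex.I * b by push_cast; ring,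
        h n (by omega)]
      congr 3
      · push_cast; ring
      · ring

theorem differentiableOn_stepChain_param {b : ℝ} {A B K : ℂ → ℂ → ℂ} {U : Set ℂ} {ρ : ℂ}
    (hA : ∀ k : ℕ, DifferentiableOn ℂ (fun w => A w (ρ + k * (Complex.I * b))) U)
    (hB : ∀ k : ℕ, DifferentiableOn ℂ (fun w => B w (ρ + k * (Complex.I * b))) U)
    (hK : DifferentiableOn ℂ (fun w => K w ρ) U)
    (hK' : DifferentiableOn ℂ (fun w => K w (ρ - Complex.I * b)) U) (n : ℕ) :
    DifferentiableOn ℂ (fun w => stepChain b (A w) (B w) (K w) n ρ) U := by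
  induction n using Nat.strong_induction_on with
  | _ n ih =>
    match n with
    | 0 => exact hK'
    | 1 => exact hK
    | n + 2 =>
      exact ((hA n).mul (ih (n + 1) (by omega))).add ((hB n).mul (ih n (by omega)))

section Continuation

variable {b c : ℝ} {A B K : ℂ → ℂ}

/-- The window b - c < Im ρ < c places both initial points ρ and ρ - ib in the strip where K is
analytic. -/
theorem stepChain_meromorphicAt (hA : ∀ z, MeromorphicAt A z) (hB : ∀ z, MeromorphicAt B z)
    (hK : ∀ z : ℂ, |z.im| < c → AnalyticAt ℂ K z) {ρ : ℂ} (h1 : b - c < ρ.im) (h2 : ρ.im < c)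
    (hb : 0 < b) (n : ℕ) : MeromorphicAt (stepChain b A B K n) ρ := by
  induction n using Nat.strong_induction_on with
  | _ n ih =>
    match n with
    | 0 =>
      refine (AnalyticAt.fun_comp (g := K) (f := fun ρ => ρ - Complex.I * b)
        (hK _ ?_) (by fun_prop)).meromorphicAt
      simp only [Complex.sub_im, Complex.mul_im, Complex.I_re, Complex.I_im, Complex.ofReal_im,
        Complex.ofReal_re]
      rw [abs_lt]; constructor <;> linarith
    | 1 => exact (hK _ (abs_lt.2 ⟨by linarith, h2⟩)).meromorphicAt
    | n + 2 =>
      have e : AnalyticAt ℂ (fun ρ : ℂ => ρ + n * (Complex.I * b)) ρ := by fun_prop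
      exact (((hA _).comp_analyticAt e).mul (ih (n + 1) (by omega))).add
        (((hB _).comp_analyticAt e).mul (ih n (by omega)))

theorem stepChain_analyticAt (hA : ∀ z : ℂ, z.re ≠ 0 → b - c < z.im → AnalyticAt ℂ A z)
    (hB : ∀ z : ℂ, z.re ≠ 0 → b - c < z.im → AnalyticAt ℂ B z)
    (hK : ∀ z : ℂ, |z.im| < c → AnalyticAt ℂ K z) {ρ : ℂ} (hρ : ρ.re ≠ 0) (h1 : b - c < ρ.im)
    (h2 : ρ.im < c) (hb : 0 < b) (n : ℕ) : AnalyticAt ℂ (stepChain b A B K n) ρ := by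
  induction n using Nat.strong_induction_on with
  | _ n ih =>
    match n with
    | 0 =>
      refine AnalyticAt.fun_comp (g := K) (f := fun ρ => ρ - Complex.I * b) (hK _ ?_) (by fun_prop)
      simp only [Complex.sub_im, Complex.mul_im, Complex.I_re, Complex.I_im, Complex.ofReal_im,
        Complex.ofReal_re]
      rw [abs_lt]; constructor <;> linarith
    | 1 => exact hK _ (abs_lt.2 ⟨by linarith, h2⟩)
    | n + 2 =>
      have e : AnalyticAt ℂ (fun ρ : ℂ => ρ + n * (Complex.I * b)) ρ := by fun_prop
      have e1 : (ρ + n * (Complex.I * b)).re ≠ 0 := by simpa using hρ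
      have e2 : b - c < (ρ + n * (Complex.I * b)).im := by
        have : 0 ≤ (n : ℝ) * b := by positivity
        simp
        linarith
      exact ((AnalyticAt.fun_comp (f := fun ρ : ℂ => ρ + n * (Complex.I * b)) (hA _ e1 e2) e).mul (ih (n + 1) (by omega))).add
        ((AnalyticAt.fun_comp (f := fun ρ : ℂ => ρ + n * (Complex.I * b)) (hB _ e1 e2) e).mul (ih n (by omega)))

/-- The continuation of `K` to `Im σ ≥ 0` by means of the recurrence, and then to `ℂ` by
symmetry. -/
def stepExtend (b : ℝ) (A B K : ℂ → ℂ) (σ : ℂ) : ℂ :=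
  if 0 ≤ σ.im then
    stepChain b A B K (⌊σ.im / b⌋₊ + 1) (σ - ⌊σ.im / b⌋₊ * (Complex.I * b))
  else
    stepChain b A B K (⌊-σ.im / b⌋₊ + 1) (-σ - ⌊-σ.im / b⌋₊ * (Complex.I * b))

theorem stepExtend_of_mem (hb : 0 < b) {σ : ℂ} {n : ℕ} (h1 : n * b ≤ σ.im)
    (h2 : σ.im < (n + 1) * b) :
    stepExtend b A B K σ = stepChain b A B K (n + 1) (σ - n * (Complex.I * b)) := by
  have h0 : 0 ≤ σ.im := le_trans (by positivity) h1
  have hf : ⌊σ.im / b⌋₊ = n := by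
    rw [Nat.floor_eq_iff (by positivity), le_div_iff₀ hb, div_lt_iff₀ hb]
    exact ⟨h1, h2⟩
  rw [stepExtend, if_pos h0, hf]

theorem stepExtend_neg (hb : 0 < b) (hK : ∀ z, K (-z) = K z) (σ : ℂ) :
    stepExtend b A B K (-σ) = stepExtend b A B K σ := by
  rcases lt_trichotomy σ.im 0 with h | h | h
  · rw [stepExtend, if_pos (by simpa using h.le), stepExtend, if_neg (by linarith)]
    simp
  · rw [stepExtend_of_mem hb (n := 0) (by simp [h]) (by simp [h, hb]),
      stepExtend_of_mem hb (n := 0) (by simp [h]) (by simp [h, hb])]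
    simp [stepChain, hK]
  · rw [stepExtend, if_neg (by simpa using h), stepExtend, if_pos h.le]
    simp

theorem stepExtend_eq_of_abs_im_lt (hb : 0 < b) (hK : ∀ z, K (-z) = K z) {σ : ℂ}
    (h : |σ.im| < b) : stepExtend b A B K σ = K σ := by
  have key : ∀ σ : ℂ, |σ.im| < b → 0 ≤ σ.im → stepExtend b A B K σ = K σ := by
    intro σ h h0
    rw [stepExtend_of_mem hb (n := 0) (by simpa using h0) (by simpa [abs_of_nonneg h0] using h)]
    simp [stepChain]
  rcases le_total 0 σ.im with h0 | h0
  · exact key σ h h0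
  · rw [← stepExtend_neg hb hK, key (-σ) (by simpa using h) (by simpa using h0), hK]

/-- Just below the seam Im z = nb the floor drops to n - 1, and `stepChain_succ_eq` compares the two
base points. The recurrence for K is then used slightly below the real axis, inside |Im| < c - b,
hence the need for b < c. -/
theorem stepExtend_eventuallyEq (hb : 0 < b) (hbc : b < c)
    (hrec : ∀ z : ℂ, z.re ≠ 0 → |z.im| < c - b →
      K (z + Complex.I * b) = A z * K z + B z * K (z - Complex.I * b))
    {n : ℕ} {σ : ℂ} (h1 : n * b ≤ σ.im) (h2 : σ.im < (n + 1) * b) (hn : 0 < σ.im) :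
    ∀ᶠ z in 𝓝 σ, z.re ≠ 0 →
      stepExtend b A B K z = stepChain b A B K (n + 1) (z - n * (Complex.I * b)) := by
  have t1 : ∀ᶠ z : ℂ in 𝓝 σ, z.im < (n + 1) * b :=
    Complex.continuous_im.continuousAt.eventually_lt_const h2
  -- The bound b makes the floor exactly n - 1 below the seam; c - b keeps the recurrence available
  -- there.
  have t2 : ∀ᶠ z : ℂ in 𝓝 σ, n * b - min b (c - b) < z.im :=
    Complex.continuous_im.continuousAt.eventually_const_lt (by
      have : 0 < min b (c - b) := lt_min hb (by linarith)
      linarith)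
  have t3 : ∀ᶠ z : ℂ in 𝓝 σ, 0 < z.im := Complex.continuous_im.continuousAt.eventually_const_lt hn
  filter_upwards [t1, t2, t3] with z e1 e2 e3 hz
  rcases le_or_gt (n * b) z.im with h | h
  · exact stepExtend_of_mem hb h e1
  · obtain ⟨m, rfl⟩ : ∃ m, n = m + 1 := by
      refine ⟨n - 1, ?_⟩
      have : n ≠ 0 := by
        rintro rfl
        simp at h
        linarith
      omega
    have m1 := min_le_left b (c - b)
    have m2 := min_le_right b (c - b)
    push_cast at h e2
    rw [stepExtend_of_mem hb (n := m) (by linarith) h, stepChain_succ_eq (hrec _ (by simpa using hz)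
      ?_) (m + 1)]
    · congr 1
      push_cast; ring
    · simp
      rw [abs_lt]
      constructor <;> linarith

theorem stepExtend_analyticAt (hb : 0 < b) (hbc : b < c)
    (hA : ∀ z : ℂ, z.re ≠ 0 → b - c < z.im → AnalyticAt ℂ A z)
    (hB : ∀ z : ℂ, z.re ≠ 0 → b - c < z.im → AnalyticAt ℂ B z)
    (hK : ∀ z : ℂ, |z.im| < c → AnalyticAt ℂ K z) (hKn : ∀ z, K (-z) = K z)
    (hrec : ∀ z : ℂ, z.re ≠ 0 → |z.im| < c - b →
      K (z + Complex.I * b) = A z * K z + B z * K (z - Complex.I * b))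
    {σ : ℂ} (hσ : σ.re ≠ 0 ∨ |σ.im| < b) : AnalyticAt ℂ (stepExtend b A B K) σ := by
  have small : ∀ σ : ℂ, |σ.im| < b → AnalyticAt ℂ (stepExtend b A B K) σ := by
    intro σ h
    refine (hK σ (by linarith)).congr ?_
    filter_upwards [Complex.continuous_im.abs.continuousAt.eventually_lt_const h] with z hz
    exact (stepExtend_eq_of_abs_im_lt hb hKn hz).symm
  have up : ∀ σ : ℂ, σ.re ≠ 0 → 0 < σ.im → AnalyticAt ℂ (stepExtend b A B K) σ := by
    intro σ hre him
    have h0 : 0 ≤ σ.im / b := by positivity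
    have h1 : ⌊σ.im / b⌋₊ * b ≤ σ.im := (le_div_iff₀ hb).1 (Nat.floor_le h0)
    have h2 : σ.im < (⌊σ.im / b⌋₊ + 1) * b := (div_lt_iff₀ hb).1 (Nat.lt_floor_add_one _)
    set n := ⌊σ.im / b⌋₊
    have hs := stepChain_analyticAt (ρ := σ - n * (Complex.I * b)) hA hB hK (by simpa using hre)
      (by simp; linarith) (by simp; linarith) hb (n + 1)
    refine (AnalyticAt.fun_comp (f := fun z => z - n * (Complex.I * b)) hs (by fun_prop)).congr ?_
    filter_upwards [stepExtend_eventuallyEq hb hbc hrec h1 h2 him,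
      Complex.continuous_re.continuousAt.eventually_ne hre] with z hz hz'
    exact (hz hz').symm
  rcases hσ with hσ | hσ
  · rcases lt_trichotomy σ.im 0 with h | h | h
    · have := AnalyticAt.fun_comp (f := fun z : ℂ => -z) (x := σ)
        (up (-σ) (by simpa using hσ) (by simpa using h)) (by fun_prop)
      simpa only [stepExtend_neg hb hKn] using this
    · exact small σ (by simpa [h] using hb)
    · exact up σ hσ h
  · exact small σ hσ

theorem frequently_re_ne_zero (z : ℂ) : ∃ᶠ y in 𝓝[≠] z, y.re ≠ 0 := by
  have ht : Tendsto (fun x : ℝ => z + x) (𝓝[≠] 0) (𝓝[≠] z) := by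
    refine tendsto_nhdsWithin_of_tendsto_nhds_of_eventually_within _ ?_ ?_
    · have : ContinuousAt (fun x : ℝ => z + (x : ℂ)) 0 := by fun_prop
      simpa using this.tendsto.mono_left nhdsWithin_le_nhds
    · filter_upwards [self_mem_nhdsWithin] with x hx
      simpa using hx
  refine ht.frequently (Eventually.frequently ?_)
  rcases eq_or_ne z.re 0 with h | h
  · filter_upwards [self_mem_nhdsWithin] with x hx
    simpa [h] using hx
  · have : ContinuousAt (fun x : ℝ => (z + (x : ℂ)).re) 0 := by fun_prop
    exact (this.eventually_ne (by simpa using h)).filter_mono nhdsWithin_le_nhds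

/-- On the imaginary axis the recurrence is not assumed, so the pieces need not match pointwise at a
seam. They are meromorphic and agree off the axis, hence agree on a punctured neighbourhood. -/
theorem stepExtend_meromorphicAt (hb : 0 < b) (hbc : b < c)
    (hA : ∀ z, MeromorphicAt A z) (hB : ∀ z, MeromorphicAt B z)
    (hK : ∀ z : ℂ, |z.im| < c → AnalyticAt ℂ K z) (hKn : ∀ z, K (-z) = K z)
    (hrec : ∀ z : ℂ, z.re ≠ 0 → |z.im| < c - b →
      K (z + Complex.I * b) = A z * K z + B z * K (z - Complex.I * b)) (σ : ℂ) :
    MeromorphicAt (stepExtend b A B K) σ := by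
  have up : ∀ σ : ℂ, 0 < σ.im → MeromorphicAt (stepExtend b A B K) σ := by
    intro σ him
    have h0 : 0 ≤ σ.im / b := by positivity
    have h1 : ⌊σ.im / b⌋₊ * b ≤ σ.im := (le_div_iff₀ hb).1 (Nat.floor_le h0)
    have h2 : σ.im < (⌊σ.im / b⌋₊ + 1) * b := (div_lt_iff₀ hb).1 (Nat.lt_floor_add_one _)
    set n := ⌊σ.im / b⌋₊
    have hs : ∀ n : ℕ, ∀ ρ : ℂ, b - c < ρ.im - n * b → ρ.im - n * b < c → ∀ m,
        MeromorphicAt (fun z => stepChain b A B K m (z - n * (Complex.I * b))) ρ :=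
      fun n ρ e1 e2 m =>
        (stepChain_meromorphicAt hA hB hK (by simpa using e1) (by simpa using e2) hb
          m).comp_analyticAt (g := fun z => z - n * (Complex.I * b)) (by fun_prop)
    have hs1 := hs n σ (by linarith) (by linarith) (n + 1)
    refine hs1.congr ?_
    rcases h1.lt_or_eq with h1' | h1'
    · filter_upwards [nhdsWithin_le_nhds (Complex.continuous_im.continuousAt.eventually_const_lt
        h1'), nhdsWithin_le_nhds (Complex.continuous_im.continuousAt.eventually_lt_const
        h2)] with z e1 e2
      exact (stepExtend_of_mem hb e1.le e2).symm
    · obtain ⟨m, hm⟩ : ∃ m, n = m + 1 := by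
        refine ⟨n - 1, ?_⟩
        have : n ≠ 0 := by
          intro h
          rw [h] at h1'
          simp at h1'
          linarith
        omega
      have hmb : (n : ℝ) * b = m * b + b := by rw [hm]; push_cast; ring
      have hs2 := hs m σ (by linarith) (by linarith) (m + 1)
      have hev : (fun z => stepChain b A B K (n + 1) (z - n * (Complex.I * b))) =ᶠ[𝓝[≠] σ]
          fun z => stepChain b A B K (m + 1) (z - m * (Complex.I * b)) := by
        rw [← hs1.frequently_eq_iff_eventuallyEq hs2]
        have t : ∀ᶠ z : ℂ in 𝓝[≠] σ, |z.im - n * b| < c - b := by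
          have : ContinuousAt (fun z : ℂ => |z.im - n * b|) σ := by fun_prop
          exact nhdsWithin_le_nhds (this.eventually_lt_const (by rw [h1']; simpa using hbc))
        refine ((frequently_re_ne_zero σ).and_eventually t).mono ?_
        rintro z ⟨hz, hz'⟩
        rw [stepChain_succ_eq (hrec _ (by simpa using hz) (by simpa using hz')) n, hm]
        congr 1
        push_cast; ring
      have t1 : ∀ᶠ z : ℂ in 𝓝[≠] σ, z.im < (n + 1) * b :=
        nhdsWithin_le_nhds (Complex.continuous_im.continuousAt.eventually_lt_const h2)
      have t2 : ∀ᶠ z : ℂ in 𝓝[≠] σ, m * b < z.im :=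
        nhdsWithin_le_nhds (Complex.continuous_im.continuousAt.eventually_const_lt (by linarith))
      filter_upwards [hev, t1, t2] with z e e1 e2
      rcases le_or_gt (n * b) z.im with h | h
      · exact (stepExtend_of_mem hb h e1).symm
      · rw [e]
        exact (stepExtend_of_mem hb e2.le (by linarith)).symm
  rcases lt_trichotomy σ.im 0 with h | h | h
  · have := (up (-σ) (by simpa using h)).comp_analyticAt (g := fun z : ℂ => -z) (x := σ)
      (by fun_prop)
    refine this.congr (Eventually.of_forall fun z => ?_)
    exact stepExtend_neg hb hKn z
  · refine ((hK σ (by simpa [h] using hb.trans hbc)).meromorphicAt).congr ?_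
    have t : ∀ᶠ z : ℂ in 𝓝[≠] σ, |z.im| < b :=
      nhdsWithin_le_nhds (Complex.continuous_im.abs.continuousAt.eventually_lt_const
        (by simpa [h] using hb))
    filter_upwards [t] with z hz
    exact (stepExtend_eq_of_abs_im_lt hb hKn hz).symm
  · exact up σ h

end Continuation

/-! ### Regularity and non-vanishing of the coefficients -/

theorem ne_neg_nat_of_im {z : ℂ} (hz : z.im ≠ 0) (m : ℕ) : z ≠ -m := by
  rintro rfl
  simp at hz

theorem ne_neg_nat_of_re {z : ℂ} (hz : 0 < z.re) (m : ℕ) : z ≠ -m := by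
  rintro rfl
  simp at hz
  have : (0 : ℝ) ≤ m := by positivity
  linarith

theorem meromorphicAt_Gamma (z : ℂ) : MeromorphicAt Complex.Gamma z := by
  have h := (Complex.differentiable_one_div_Gamma.analyticAt z).meromorphicAt.inv
  exact h.congr (Eventually.of_forall fun s => inv_inv _)

theorem numerator_arg_im_ne_zero {b : ℝ} (hb : 0 < b) {σ : ℂ} (hσ : σ.re ≠ 0) :
    (1 + 2 * b ^ 2 - 2 * Complex.I * b * σ).im ≠ 0 ∧ (b ^ 2 - 2 * Complex.I * b * σ).im ≠ 0 ∧
      (-2 * Complex.I * b * σ).im ≠ 0 ∧ (1 + b ^ 2 - 2 * Complex.I * b * σ).im ≠ 0 := by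
  have h2 : (b ^ 2 : ℂ).im = 0 := by rw [← Complex.ofReal_pow, Complex.ofReal_im]
  simp [h2, hσ, hb.ne', Complex.mul_im]

theorem denominator_arg_re (b : ℝ) (σ a : ℂ) :
    (b * Qpar b / 2 - Complex.I * b * (σ + a) : ℂ).re = b * (Qpar b / 2 + σ.im + a.im) := by
  rw [← Complex.ofReal_mul, show ((b * Qpar b : ℝ) : ℂ) / 2 = ((b * Qpar b / 2 : ℝ) : ℂ) by
    push_cast; ring, Complex.sub_re, Complex.ofReal_re]
  simp [Complex.mul_re]
  ring

theorem denominator_arg_re_pos {b : ℝ} (hb : 0 < b) {σ a : ℂ} (h : |a.im| < Qpar b / 2 + σ.im) :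
    0 < (b * Qpar b / 2 - Complex.I * b * (σ + a) : ℂ).re ∧
      0 < (b * Qpar b / 2 - Complex.I * b * (σ - a) : ℂ).re := by
  rw [sub_eq_add_neg σ, denominator_arg_re, denominator_arg_re, Complex.neg_im]
  rw [abs_lt] at h
  exact ⟨mul_pos hb (by linarith), mul_pos hb (by linarith)⟩

/-- For Re σ ≠ 0 the numerator Gamma arguments are not real, and the bound on the shifts gives the
other arguments positive real part, so no factor vanishes. This allows solving the difference
equation for F(σ + ib). -/
theorem shiftCoeff_ne_zero {b : ℝ} (hb : 0 < b) {a : Fin 4 → ℂ} {σ : ℂ} (hσ : σ.re ≠ 0)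
    (ha : ∀ j, |(a j).im| < Qpar b / 2 + σ.im) : shiftCoeff b a σ ≠ 0 := by
  obtain ⟨h1, h2, h3, h4⟩ := numerator_arg_im_ne_zero hb hσ
  have hpi : (Real.pi : ℂ) ≠ 0 := by exact_mod_cast Real.pi_ne_zero
  unfold shiftCoeff
  refine mul_ne_zero (mul_ne_zero (mul_ne_zero (by norm_num) (pow_ne_zero _ hpi)) ?_) ?_
  · exact mul_ne_zero (mul_ne_zero (mul_ne_zero (Complex.Gamma_ne_zero (ne_neg_nat_of_im h1))
      (Complex.Gamma_ne_zero (ne_neg_nat_of_im h2))) (Complex.Gamma_ne_zero (ne_neg_nat_of_im h3)))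
      (Complex.Gamma_ne_zero (ne_neg_nat_of_im h4))
  · refine Finset.prod_ne_zero_iff.2 fun j _ => ?_
    obtain ⟨e1, e2⟩ := denominator_arg_re_pos hb (ha j)
    exact mul_ne_zero (inv_ne_zero (Complex.Gamma_ne_zero (ne_neg_nat_of_re e1)))
      (inv_ne_zero (Complex.Gamma_ne_zero (ne_neg_nat_of_re e2)))

theorem differentiableAt_shiftCoeff {b : ℝ} (hb : 0 < b) {a : ℂ → Fin 4 → ℂ} {σ : ℂ → ℂ} {ζ : ℂ}
    (ha : ∀ j, DifferentiableAt ℂ (fun ζ => a ζ j) ζ) (hσ : DifferentiableAt ℂ σ ζ)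
    (hre : (σ ζ).re ≠ 0) : DifferentiableAt ℂ (fun ζ => shiftCoeff b (a ζ) (σ ζ)) ζ := by
  obtain ⟨h1, h2, h3, h4⟩ := numerator_arg_im_ne_zero hb hre
  have hG : ∀ {f : ℂ → ℂ}, DifferentiableAt ℂ f ζ → (f ζ).im ≠ 0 →
      DifferentiableAt ℂ (fun ζ => Complex.Gamma (f ζ)) ζ := fun {f} hf him =>
    DifferentiableAt.comp ζ (Complex.differentiableAt_Gamma _ (ne_neg_nat_of_im him)) hf
  have hG' : ∀ {f : ℂ → ℂ}, DifferentiableAt ℂ f ζ →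
      DifferentiableAt ℂ (fun ζ => (Complex.Gamma (f ζ))⁻¹) ζ := fun {f} hf =>
    DifferentiableAt.comp (g := fun s => (Complex.Gamma s)⁻¹) ζ
      (Complex.differentiable_one_div_Gamma (f ζ)) hf
  unfold shiftCoeff
  refine DifferentiableAt.mul (DifferentiableAt.mul (differentiableAt_const _) ?_) ?_
  · exact (((hG (by fun_prop) h1).mul (hG (by fun_prop) h2)).mul (hG (by fun_prop) h3)).mul
      (hG (by fun_prop) h4)
  · refine DifferentiableAt.fun_finsetProd fun j _ => ?_
    have := ha j
    exact (hG' (by fun_prop)).mul (hG' (by fun_prop))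

/-- The scalar k is taken to be 1 and -1, for the coefficients at σ and at -σ. -/
theorem meromorphicAt_shiftCoeff (b : ℝ) (a : Fin 4 → ℂ) (k : ℂ) (z : ℂ) :
    MeromorphicAt (fun z => shiftCoeff b a (k * z)) z := by
  have hG : ∀ {f : ℂ → ℂ}, AnalyticAt ℂ f z → MeromorphicAt (fun ζ => Complex.Gamma (f ζ)) z :=
    fun {f} hf => (meromorphicAt_Gamma _).comp_analyticAt hf
  unfold shiftCoeff
  simp only [Fin.prod_univ_four]
  have e1 : ∀ c : ℂ, MeromorphicAt (fun z => (Complex.Gamma (b * Qpar b / 2 -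
      Complex.I * b * (k * z + c)))⁻¹) z := fun c => (hG (by fun_prop)).inv
  have e2 : ∀ c : ℂ, MeromorphicAt (fun z => (Complex.Gamma (b * Qpar b / 2 -
      Complex.I * b * (k * z - c)))⁻¹) z := fun c => (hG (by fun_prop)).inv
  exact ((MeromorphicAt.const _ _).mul ((((hG (by fun_prop)).mul (hG (by fun_prop))).mul
    (hG (by fun_prop))).mul (hG (by fun_prop)))).mul
    (((((e1 _).mul (e2 _)).mul ((e1 _).mul (e2 _))).mul ((e1 _).mul (e2 _))).mul
      ((e1 _).mul (e2 _)))

theorem differentiableAt_potential {b : ℝ} (hb : 0 < b) (t0 t1 : ℝ) {tt ti σ : ℂ → ℂ} {ζ : ℂ}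
    (htt : DifferentiableAt ℂ tt ζ) (hti : DifferentiableAt ℂ ti ζ) (hσ : DifferentiableAt ℂ σ ζ)
    (hre : (σ ζ).re ≠ 0) :
    DifferentiableAt ℂ (fun ζ => potential b t0 t1 (tt ζ) (ti ζ) (σ ζ)) ζ := by
  have hre' : (-σ ζ).re ≠ 0 := by simpa using hre
  have h1 := sinh_two_ne_zero hb hre
  have h2 := sinh_two_add_ne_zero hb hre
  have h3 := sinh_two_ne_zero hb hre'
  have h4 := sinh_two_add_ne_zero hb hre'
  unfold potential potentialTerm
  fun_prop (disch := first | exact mul_ne_zero h1 h2 | exact mul_ne_zero h3 h4)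

theorem meromorphicAt_potential (b t0 t1 : ℝ) (tt ti z : ℂ) :
    MeromorphicAt (fun z => potential b t0 t1 tt ti z) z := by
  unfold potential potentialTerm
  have h1 : ∀ {f : ℂ → ℂ}, AnalyticAt ℂ f z → MeromorphicAt (fun ζ => Complex.cosh (f ζ)) z :=
    fun {f} hf => (Complex.differentiable_cosh.analyticAt _).meromorphicAt.comp_analyticAt hf
  have h2 : ∀ {f : ℂ → ℂ}, AnalyticAt ℂ f z → MeromorphicAt (fun ζ => Complex.sinh (f ζ)) z :=
    fun {f} hf => (Complex.differentiable_sinh.analyticAt _).meromorphicAt.comp_analyticAt hf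
  refine (MeromorphicAt.const _ _).add ((MeromorphicAt.const _ _).mul (.add (.div ?_ ?_)
    (.div ?_ ?_)))
  · exact ((h1 (by fun_prop)).mul (h1 (by fun_prop))).mul ((h1 (by fun_prop)).mul
      (h1 (by fun_prop)))
  · exact (h2 (by fun_prop)).mul (h2 (by fun_prop))
  · exact ((h1 (by fun_prop)).mul (h1 (by fun_prop))).mul ((h1 (by fun_prop)).mul
      (h1 (by fun_prop)))
  · exact (h2 (by fun_prop)).mul (h2 (by fun_prop))

theorem differentiableAt_edgeFactor {b : ℝ} (hb : 0 < b) {a : ℂ → Fin 4 → ℂ} {σ : ℂ → ℂ} {ζ : ℂ}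
    (ha : ∀ j, DifferentiableAt ℂ (fun ζ => a ζ j) ζ) (hσ : DifferentiableAt ℂ σ ζ)
    (him : |(σ ζ).im| < Qpar b / 2) :
    DifferentiableAt ℂ (fun ζ => edgeFactor b (a ζ) (σ ζ)) ζ := by
  have hE : ∀ {f : ℂ → ℂ}, DifferentiableAt ℂ f ζ →
      DifferentiableAt ℂ (fun ζ => hyperbolicE b b⁻¹ (f ζ)) ζ := fun {f} hf =>
    DifferentiableAt.comp ζ (differentiable_hyperbolicE hb (f ζ)) hf
  rw [abs_lt] at him
  unfold edgeFactor
  refine DifferentiableAt.mul ?_ (DifferentiableAt.inv ((hE (by fun_prop)).mul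
    (hE (by fun_prop))) (mul_ne_zero ?_ ?_))
  · refine DifferentiableAt.fun_finsetProd fun j _ => ?_
    have := ha j
    exact (hE (by fun_prop)).mul (hE (by fun_prop))
  · refine hyperbolicE_ne_zero_of_im_lt hb ?_
    rw [Complex.sub_im, Complex.neg_im, im_I_Qpar]
    have : (b + b⁻¹) = Qpar b := rfl
    simp
    linarith
  · refine hyperbolicE_ne_zero_of_im_lt hb ?_
    rw [Complex.add_im, Complex.neg_im, im_I_Qpar]
    have : (b + b⁻¹) = Qpar b := rfl
    simp
    linarith

/-- All arguments depend on one variable ζ, so that holomorphy in σ and in the deformation parameter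
are both instances. -/
theorem differentiableOn_kernelFun {b : ℝ} (hb : 0 < b) (t0 t1 st : ℝ) {tt ti σ : ℂ → ℂ}
    {U : Set ℂ} (hU : IsOpen U) (htt : DifferentiableOn ℂ tt U) (hti : DifferentiableOn ℂ ti U)
    (hσ : DifferentiableOn ℂ σ U) {h : ℝ} (hh : h < Qpar b / 2)
    (h0 : ∀ ζ ∈ U, |(σ ζ).im| < Qpar b / 2) (h1 : ∀ ζ ∈ U, |(σ ζ).im| + (ti ζ).im < h)
    (h2 : ∀ ζ ∈ U, (tt ζ).im < h) (hsum : ∀ ζ ∈ U, (tt ζ + ti ζ).im = 0) :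
    DifferentiableOn ℂ (fun ζ => kernelFun b t0 t1 st h (tt ζ) (ti ζ) (σ ζ)) U := by
  unfold kernelFun
  refine DifferentiableOn.mul (fun ζ hζ => ?_) ?_
  · have d1 := htt.differentiableAt (hU.mem_nhds hζ)
    have d2 := hti.differentiableAt (hU.mem_nhds hζ)
    refine (differentiableAt_edgeFactor hb (fun j => ?_) (hσ.differentiableAt (hU.mem_nhds hζ))
      (h0 ζ hζ)).differentiableWithinAt
    fin_cases j <;> simp [edgeShift] <;> fun_prop
  · unfold fusionInt
    refine differentiableOn_sInt hb hU (S := -2 * Qpar b) (fun j => ?_) (fun j => ?_) (fun ζ hζ => ?_)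
      (by linarith [Qpar_pos hb]) (fun ζ hζ => ?_)
    · fin_cases j <;> simp [numShift] <;> fun_prop
    · fin_cases j <;> simp [denShift] <;> fun_prop
    · rw [separates_iff (hsum ζ hζ)]
      exact ⟨hh, h1 ζ hζ, by simpa using h2 ζ hζ⟩
    · rw [sum_im_shift]; simp

/-- The coefficient of `F(σ)` in the recurrence `F(σ + ib) = A(σ) F(σ) + B(σ) F(σ - ib)` that is
equivalent to the difference equation. -/
def stepA (b t0 t1 st : ℝ) (tt ti σ : ℂ) : ℂ :=
  (2 * Complex.cosh (Real.pi * b * (2 * st)) - potential b t0 t1 tt ti σ) *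
    (shiftCoeff b (edgeShift t0 t1 tt ti) σ)⁻¹

/-- The coefficient of `F(σ - ib)` in the recurrence. -/
def stepB (b t0 t1 : ℝ) (tt ti σ : ℂ) : ℂ :=
  -shiftCoeff b (edgeShift t0 t1 tt ti) (-σ) * (shiftCoeff b (edgeShift t0 t1 tt ti) σ)⁻¹

theorem abs_im_edgeShift (t0 t1 : ℝ) {tt ti : ℂ} (hsum : (tt + ti).im = 0) (j : Fin 4) :
    |(edgeShift t0 t1 tt ti j).im| = |ti.im| := by
  rw [Complex.add_im] at hsum
  have : -tt.im = ti.im := by linarith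
  fin_cases j <;> simp [edgeShift, ← this]

theorem kernelFun_step {b : ℝ} (hb : 0 < b) (t0 t1 st : ℝ) {tt ti σ : ℂ} (hσ : σ.re ≠ 0)
    {h : ℝ} (hh : h < Qpar b / 2) (hti : |σ.im| + b + ti.im < h) (htt : tt.im < h)
    (hsum : (tt + ti).im = 0) (hpos : |ti.im| < Qpar b / 2 + σ.im) :
    kernelFun b t0 t1 st h tt ti (σ + Complex.I * b) =
      stepA b t0 t1 st tt ti σ * kernelFun b t0 t1 st h tt ti σ +
        stepB b t0 t1 tt ti σ * kernelFun b t0 t1 st h tt ti (σ - Complex.I * b) := by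
  have h1 := kernelFun_difference hb t0 t1 st hσ hh hti htt hsum
  have h2 : shiftCoeff b (edgeShift t0 t1 tt ti) σ ≠ 0 :=
    shiftCoeff_ne_zero hb hσ fun j => by rwa [abs_im_edgeShift t0 t1 hsum]
  unfold stepA stepB
  generalize Complex.cosh (Real.pi * b * (2 * st)) = q at *
  field_simp
  linear_combination h1

theorem differentiableAt_stepA {b : ℝ} (hb : 0 < b) (t0 t1 st : ℝ) {tt ti σ : ℂ → ℂ} {ζ : ℂ}
    (htt : DifferentiableAt ℂ tt ζ) (hti : DifferentiableAt ℂ ti ζ) (hσ : DifferentiableAt ℂ σ ζ)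
    (hre : (σ ζ).re ≠ 0) (hsum : (tt ζ + ti ζ).im = 0)
    (hpos : |(ti ζ).im| < Qpar b / 2 + (σ ζ).im) :
    DifferentiableAt ℂ (fun ζ => stepA b t0 t1 st (tt ζ) (ti ζ) (σ ζ)) ζ := by
  refine ((differentiableAt_const _).sub (differentiableAt_potential hb t0 t1 htt hti hσ hre)).mul
    (DifferentiableAt.inv (differentiableAt_shiftCoeff hb (fun j => ?_) hσ hre)
      (shiftCoeff_ne_zero hb hre fun j => by rwa [abs_im_edgeShift t0 t1 hsum]))
  fin_cases j <;> simp [edgeShift] <;> fun_prop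

theorem differentiableAt_stepB {b : ℝ} (hb : 0 < b) (t0 t1 : ℝ) {tt ti σ : ℂ → ℂ} {ζ : ℂ}
    (htt : DifferentiableAt ℂ tt ζ) (hti : DifferentiableAt ℂ ti ζ) (hσ : DifferentiableAt ℂ σ ζ)
    (hre : (σ ζ).re ≠ 0) (hsum : (tt ζ + ti ζ).im = 0)
    (hpos : |(ti ζ).im| < Qpar b / 2 + (σ ζ).im) :
    DifferentiableAt ℂ (fun ζ => stepB b t0 t1 (tt ζ) (ti ζ) (σ ζ)) ζ := by
  have ha : ∀ j, DifferentiableAt ℂ (fun ζ => edgeShift t0 t1 (tt ζ) (ti ζ) j) ζ := by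
    intro j
    fin_cases j <;> simp [edgeShift] <;> fun_prop
  exact (differentiableAt_shiftCoeff hb ha hσ.neg (by simpa using hre)).fun_neg.mul
    (DifferentiableAt.inv (differentiableAt_shiftCoeff hb ha hσ hre)
      (shiftCoeff_ne_zero hb hre fun j => by rwa [abs_im_edgeShift t0 t1 hsum]))

theorem meromorphicAt_stepA (b t0 t1 st : ℝ) (tt ti z : ℂ) :
    MeromorphicAt (stepA b t0 t1 st tt ti) z := by
  have h := meromorphicAt_shiftCoeff b (edgeShift t0 t1 tt ti) 1 z
  simp only [one_mul] at h
  exact ((MeromorphicAt.const _ _).sub (meromorphicAt_potential b t0 t1 tt ti z)).mul h.inv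

theorem meromorphicAt_stepB (b t0 t1 : ℝ) (tt ti z : ℂ) :
    MeromorphicAt (stepB b t0 t1 tt ti) z := by
  have h := meromorphicAt_shiftCoeff b (edgeShift t0 t1 tt ti) 1 z
  have h' := meromorphicAt_shiftCoeff b (edgeShift t0 t1 tt ti) (-1) z
  simp only [one_mul, neg_mul] at h h'
  exact h'.neg.mul h.inv

/-! ### Translation of the given definitions -/

theorem sum_signs {M : Type*} [AddCommMonoid M] (f : ℤ → M) : ∑ k ∈ signs, f k = f 1 + f (-1) :=
  Finset.sum_pair (by decide)

theorem prod_signs {M : Type*} [CommMonoid M] (f : ℤ → M) : ∏ k ∈ signs, f k = f 1 * f (-1) :=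
  Finset.prod_pair (by decide)

theorem HFplus_eq (b : ℝ) (θ : Momenta) (σ : ℂ) :
    HFplus b θ σ = shiftCoeff b (edgeShift θ.th0 θ.th1 θ.tht θ.thinf) σ := by
  unfold HFplus shiftCoeff
  simp only [prod_signs, Fin.prod_univ_four, edgeShift, Matrix.cons_val_zero, Matrix.cons_val_one,
    Matrix.cons_val, div_eq_mul_inv, mul_inv]
  push_cast
  ring_nf

theorem HFzero_eq (b : ℝ) (θ : Momenta) (σ : ℂ) :
    HFzero b θ σ = potential b θ.th0 θ.th1 θ.tht θ.thinf σ := by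
  unfold HFzero potential potentialTerm
  simp only [prod_signs, sum_signs]
  push_cast
  ring_nf

theorem fusionIntegrand_eq (b : ℝ) (θ : Momenta) (σs x : ℂ) (σt : ℝ) :
    fusionIntegrand b θ σs σt x =
      sProd b (numShift θ.th0 θ.th1 θ.tht θ.thinf) (denShift b σt θ.tht θ.thinf σs 0) x := by
  unfold fusionIntegrand sProd
  simp only [prod_signs, Fin.prod_univ_four, numShift, denShift, Matrix.cons_val_zero,
    Matrix.cons_val_one, Matrix.cons_val, div_eq_mul_inv, mul_inv, ← sFun_neg]
  push_cast
  ring_nf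

theorem separates_real {b h σ : ℝ} (θ : Momenta) (σt : ℝ) (h0 : 0 < h) (h1 : h < Qpar b / 2) :
    Separates b (numShift θ.th0 θ.th1 θ.tht θ.thinf) (denShift b σt θ.tht θ.thinf σ 0) h := by
  rw [separates_iff (by simp)]
  simpa using ⟨h1, h0⟩

theorem sum_im_shift_neg {b : ℝ} (hb : 0 < b) (t0 t1 st : ℝ) (tt ti σ : ℂ) :
    ∑ j, ((numShift t0 t1 tt ti j).im + (denShift b st tt ti σ 0 j).im) < 0 := by
  rw [sum_im_shift]
  have := Qpar_pos hb
  simp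
  linarith

/-- The factor of the fusion kernel that does not depend on `σ_s`. -/
def fusionConst (b : ℝ) (θ : Momenta) (σt : ℝ) : ℂ :=
  (∏ ε ∈ signs, ∏ ε' ∈ signs,
    (gFun b (ε * θ.th1 + θ.tht + ε' * σt) * gFun b (ε * θ.th0 - θ.thinf + ε' * σt))) *
  ∏ ε ∈ signs, (gFun b (-(Complex.I * Qpar b / 2) + 2 * ε * σt))⁻¹

theorem fusionPrefactor_eq (b : ℝ) (θ : Momenta) (σs : ℂ) (σt : ℝ) :
    fusionPrefactor b θ σs σt =
      fusionConst b θ σt * edgeFactor b (edgeShift θ.th0 θ.th1 θ.tht θ.thinf) σs := by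
  unfold fusionPrefactor fusionConst edgeFactor
  simp only [div_eq_mul_inv, Finset.prod_mul_distrib]
  have h1 : (∏ ε ∈ signs, ∏ ε' ∈ signs, (gFun b (ε * θ.th0 + θ.tht + ε' * σs) *
      gFun b (ε * θ.th1 - θ.thinf + ε' * σs))⁻¹) =
      (∏ j, hyperbolicE b b⁻¹ (edgeShift θ.th0 θ.th1 θ.tht θ.thinf j + σs)) *
      ∏ j, hyperbolicE b b⁻¹ (edgeShift θ.th0 θ.th1 θ.tht θ.thinf j - σs) := by
    simp only [prod_signs, Fin.prod_univ_four, gFun, one_div, mul_inv, inv_inv, edgeShift,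
      Matrix.cons_val_zero, Matrix.cons_val_one, Matrix.cons_val]
    push_cast
    ring_nf
  have h2 : (∏ ε ∈ signs, gFun b (Complex.I * Qpar b * 2⁻¹ + 2 * ε * σs)) =
      (hyperbolicE b b⁻¹ (-(Complex.I * Qpar b * 2⁻¹) - 2 * σs) *
        hyperbolicE b b⁻¹ (-(Complex.I * Qpar b * 2⁻¹) + 2 * σs))⁻¹ := by
    simp only [prod_signs, gFun, one_div, mul_inv]
    push_cast
    ring_nf
  rw [h1, h2]
  ring

theorem ponsotTeschner_eq (b : ℝ) (θ : Momenta) (h : ℝ) (σs : ℂ) (σt : ℝ) :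
    ponsotTeschner b θ h σs σt =
      fusionConst b θ σt * kernelFun b θ.th0 θ.th1 σt h θ.tht θ.thinf σs := by
  unfold ponsotTeschner kernelFun fusionInt sInt
  simp only [fusionPrefactor_eq, fusionIntegrand_eq, mul_assoc]

theorem integrable_fusionIntegrand {b : ℝ} (hb : 0 < b) (θ : Momenta) (σs σt : ℝ) {h : ℝ}
    (h0 : 0 < h) (h1 : h < Qpar b / 2) :
    Integrable (fun x : ℝ => fusionIntegrand b θ σs σt (x - Complex.I * h)) := by
  simp only [fusionIntegrand_eq]
  exact integrable_sProd hb (separates_real θ σt h0 h1) (sum_im_shift_neg hb _ _ _ _ _ _)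

theorem kernelFun_eq_of_real {b : ℝ} (hb : 0 < b) (θ : Momenta) (σs σt : ℝ) {h h' : ℝ}
    (h0 : 0 < h) (h1 : h < Qpar b / 2) (h0' : 0 < h') (h1' : h' < Qpar b / 2) :
    kernelFun b θ.th0 θ.th1 σt h θ.tht θ.thinf σs =
      kernelFun b θ.th0 θ.th1 σt h' θ.tht θ.thinf σs := by
  unfold kernelFun fusionInt
  rw [sInt_eq_of_separates hb (separates_real θ σt h0 h1) (separates_real θ σt h0' h1')
    (sum_im_shift_neg hb _ _ _ _ _ _)]

/-! ### The deformed kernel and the meromorphic continuation in σ_s -/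

/-- The kernel with `θ_t`, `θ_∞` replaced by `θ_t + w`, `θ_∞ - w`. -/
def kernelParam (b : ℝ) (θ : Momenta) (σt h : ℝ) (w σ : ℂ) : ℂ :=
  kernelFun b θ.th0 θ.th1 σt h (θ.tht + w) (θ.thinf - w) σ

/-- The coefficient `stepA` with `θ_t`, `θ_∞` replaced by `θ_t + w`, `θ_∞ - w`. -/
def paramA (b : ℝ) (θ : Momenta) (σt : ℝ) (w σ : ℂ) : ℂ :=
  stepA b θ.th0 θ.th1 σt (θ.tht + w) (θ.thinf - w) σ

/-- The coefficient `stepB` with `θ_t`, `θ_∞` replaced by `θ_t + w`, `θ_∞ - w`. -/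
def paramB (b : ℝ) (θ : Momenta) (w σ : ℂ) : ℂ :=
  stepB b θ.th0 θ.th1 (θ.tht + w) (θ.thinf - w) σ

/-- The kernel as a meromorphic function on `ℂ`, up to a factor independent of `σ`. -/
def kernelExtend (b : ℝ) (θ : Momenta) (σt h : ℝ) : ℂ → ℂ :=
  stepExtend b (paramA b θ σt 0) (paramB b θ 0) (kernelParam b θ σt h 0)

section

variable {b h : ℝ} (θ : Momenta) (σt : ℝ)

theorem sum_im_param (θ : Momenta) (w : ℂ) :
    ((θ.tht + w : ℂ) + (θ.thinf - w)).im = 0 := by simp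

theorem kernelParam_neg (w σ : ℂ) : kernelParam b θ σt h w (-σ) = kernelParam b θ σt h w σ :=
  kernelFun_neg ..

theorem kernelParam_step (hb : 0 < b) (hh : h < Qpar b / 2) {w σ : ℂ} (hσ : σ.re ≠ 0)
    (h1 : |σ.im| + b - w.im < h) (h2 : w.im < h) (h3 : |w.im| < Qpar b / 2 + σ.im) :
    kernelParam b θ σt h w (σ + Complex.I * b) =
      paramA b θ σt w σ * kernelParam b θ σt h w σ +
        paramB b θ w σ * kernelParam b θ σt h w (σ - Complex.I * b) :=
  kernelFun_step hb _ _ _ hσ hh (by simp; linarith) (by simpa using h2) (sum_im_param θ w)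
    (by simpa using h3)

theorem differentiableOn_kernelParam (hb : 0 < b) (hh : h < Qpar b / 2) {U : Set ℂ}
    (hU : IsOpen U) {w σ : ℂ → ℂ} (hw : DifferentiableOn ℂ w U) (hσ : DifferentiableOn ℂ σ U)
    (h0 : ∀ ζ ∈ U, |(σ ζ).im| < Qpar b / 2) (h1 : ∀ ζ ∈ U, |(σ ζ).im| - (w ζ).im < h)
    (h2 : ∀ ζ ∈ U, (w ζ).im < h) :
    DifferentiableOn ℂ (fun ζ => kernelParam b θ σt h (w ζ) (σ ζ)) U :=
  differentiableOn_kernelFun hb _ _ _ hU (by fun_prop) (by fun_prop) hσ hh h0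
    (fun ζ hζ => by simpa [← sub_eq_add_neg] using h1 ζ hζ) (fun ζ hζ => by simpa using h2 ζ hζ)
    (fun ζ _ => sum_im_param θ _)

theorem differentiableOn_paramA (hb : 0 < b) {U : Set ℂ}
    (hU : IsOpen U) {w σ : ℂ → ℂ} (hw : DifferentiableOn ℂ w U) (hσ : DifferentiableOn ℂ σ U)
    (h0 : ∀ ζ ∈ U, (σ ζ).re ≠ 0) (h1 : ∀ ζ ∈ U, |(w ζ).im| < Qpar b / 2 + (σ ζ).im) :
    DifferentiableOn ℂ (fun ζ => paramA b θ σt (w ζ) (σ ζ)) U := by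
  intro ζ hζ
  have e1 := hw.differentiableAt (hU.mem_nhds hζ)
  have e2 : |(θ.thinf - w ζ).im| < Qpar b / 2 + (σ ζ).im := by simpa using h1 ζ hζ
  unfold paramA
  exact (differentiableAt_stepA hb _ _ _ (tt := fun ζ => θ.tht + w ζ)
    (ti := fun ζ => θ.thinf - w ζ) (σ := σ) (e1.const_add _) (e1.const_sub _)
    (hσ.differentiableAt (hU.mem_nhds hζ)) (h0 ζ hζ) (sum_im_param θ (w ζ))
    e2).differentiableWithinAt

theorem differentiableOn_paramB (hb : 0 < b) {U : Set ℂ}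
    (hU : IsOpen U) {w σ : ℂ → ℂ} (hw : DifferentiableOn ℂ w U) (hσ : DifferentiableOn ℂ σ U)
    (h0 : ∀ ζ ∈ U, (σ ζ).re ≠ 0) (h1 : ∀ ζ ∈ U, |(w ζ).im| < Qpar b / 2 + (σ ζ).im) :
    DifferentiableOn ℂ (fun ζ => paramB b θ (w ζ) (σ ζ)) U := by
  intro ζ hζ
  have e1 := hw.differentiableAt (hU.mem_nhds hζ)
  have e2 : |(θ.thinf - w ζ).im| < Qpar b / 2 + (σ ζ).im := by simpa using h1 ζ hζ
  unfold paramB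
  exact (differentiableAt_stepB hb _ _ (tt := fun ζ => θ.tht + w ζ)
    (ti := fun ζ => θ.thinf - w ζ) (σ := σ) (e1.const_add _) (e1.const_sub _)
    (hσ.differentiableAt (hU.mem_nhds hζ)) (h0 ζ hζ) (sum_im_param θ (w ζ))
    e2).differentiableWithinAt

theorem analyticAt_kernelParam (hb : 0 < b) (hh : h < Qpar b / 2) {σ : ℂ} (hσ : |σ.im| < h) :
    AnalyticAt ℂ (kernelParam b θ σt h 0) σ := by
  have hU : IsOpen {z : ℂ | |z.im| < h} := isOpen_lt (by fun_prop) (by fun_prop)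
  exact (differentiableOn_kernelParam θ σt hb hh hU (w := fun _ => 0) (σ := fun z => z)
    (by fun_prop) (by fun_prop) (fun z hz => lt_trans hz hh) (fun z hz => by simpa using hz)
    (fun z hz => by simpa using (abs_nonneg z.im).trans_lt hz)).analyticAt (hU.mem_nhds hσ)

theorem isOpen_re_ne_inter_im (c : ℝ) : IsOpen {z : ℂ | z.re ≠ 0 ∧ c < z.im} :=
  (isOpen_ne_fun Complex.continuous_re continuous_const).inter (isOpen_im_gt c)

theorem analyticAt_paramA (hb : 0 < b) (hh : h < Qpar b / 2) {σ : ℂ} (hσ : σ.re ≠ 0)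
    (him : b - h < σ.im) : AnalyticAt ℂ (paramA b θ σt 0) σ := by
  have hU := isOpen_re_ne_inter_im (b - h)
  exact (differentiableOn_paramA θ σt hb hU (w := fun _ => 0) (σ := fun z => z)
    (by fun_prop) (by fun_prop) (fun z hz => hz.1) (fun z hz => by
      have := hz.2
      simp
      linarith)).analyticAt (hU.mem_nhds ⟨hσ, him⟩)

theorem analyticAt_paramB (hb : 0 < b) (hh : h < Qpar b / 2) {σ : ℂ} (hσ : σ.re ≠ 0)
    (him : b - h < σ.im) : AnalyticAt ℂ (paramB b θ 0) σ := by
  have hU := isOpen_re_ne_inter_im (b - h)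
  exact (differentiableOn_paramB θ hb hU (w := fun _ => 0) (σ := fun z => z)
    (by fun_prop) (by fun_prop) (fun z hz => hz.1) (fun z hz => by
      have := hz.2
      simp
      linarith)).analyticAt (hU.mem_nhds ⟨hσ, him⟩)

theorem kernelParam_zero_step (hb : 0 < b) (hh : h < Qpar b / 2) {σ : ℂ} (hσ : σ.re ≠ 0)
    (h1 : |σ.im| < h - b) :
    kernelParam b θ σt h 0 (σ + Complex.I * b) =
      paramA b θ σt 0 σ * kernelParam b θ σt h 0 σ +
        paramB b θ 0 σ * kernelParam b θ σt h 0 (σ - Complex.I * b) := by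
  have := neg_abs_le σ.im
  have := abs_nonneg σ.im
  exact kernelParam_step θ σt hb hh hσ (by simp; linarith) (by simp; linarith)
    (by simp; linarith)

theorem meromorphicAt_kernelExtend (hb : 0 < b) (hbh : b < h) (hh : h < Qpar b / 2) (σ : ℂ) :
    MeromorphicAt (kernelExtend b θ σt h) σ :=
  stepExtend_meromorphicAt hb hbh (meromorphicAt_stepA _ _ _ _ _ _) (meromorphicAt_stepB _ _ _ _ _)
    (fun _ hz => analyticAt_kernelParam θ σt hb hh hz) (kernelParam_neg θ σt 0)
    (fun _ hz hz' => kernelParam_zero_step θ σt hb hh hz hz') σ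

theorem analyticAt_kernelExtend (hb : 0 < b) (hbh : b < h) (hh : h < Qpar b / 2) {σ : ℂ}
    (hσ : σ.re ≠ 0 ∨ |σ.im| < b) : AnalyticAt ℂ (kernelExtend b θ σt h) σ :=
  stepExtend_analyticAt hb hbh (fun _ hz hz' => analyticAt_paramA θ σt hb hh hz hz')
    (fun _ hz hz' => analyticAt_paramB θ hb hh hz hz')
    (fun _ hz => analyticAt_kernelParam θ σt hb hh hz) (kernelParam_neg θ σt 0)
    (fun _ hz hz' => kernelParam_zero_step θ σt hb hh hz hz') hσ

theorem kernelExtend_neg (hb : 0 < b) (σ : ℂ) :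
    kernelExtend b θ σt h (-σ) = kernelExtend b θ σt h σ :=
  stepExtend_neg hb (kernelParam_neg θ σt 0) σ

theorem kernelExtend_of_real (hb : 0 < b) (σ : ℝ) :
    kernelExtend b θ σt h σ = kernelFun b θ.th0 θ.th1 σt h θ.tht θ.thinf σ := by
  rw [kernelExtend, stepExtend_eq_of_abs_im_lt hb (kernelParam_neg θ σt 0) (by simpa using hb),
    kernelParam, add_zero, sub_zero]

theorem meromorphicOn_const_mul_kernelExtend (hb : 0 < b) (hbh : b < h) (hh : h < Qpar b / 2) :
    MeromorphicOn (fun σ => fusionConst b θ σt * kernelExtend b θ σt h σ) univ := fun σ _ =>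
  (MeromorphicAt.const _ _).fun_mul (meromorphicAt_kernelExtend θ σt hb hbh hh σ)

theorem analyticAt_const_mul_kernelExtend (hb : 0 < b) (hbh : b < h) (hh : h < Qpar b / 2) {σ : ℂ}
    (hσ : σ.re ≠ 0 ∨ |σ.im| < b) :
    AnalyticAt ℂ (fun σ => fusionConst b θ σt * kernelExtend b θ σt h σ) σ :=
  analyticAt_const.fun_mul (analyticAt_kernelExtend θ σt hb hbh hh hσ)

theorem toMeromorphicNFOn_eq_of_analyticAt {f : ℂ → ℂ} (hf : MeromorphicOn f univ) {z : ℂ}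
    (hz : AnalyticAt ℂ f z) : toMeromorphicNFOn f univ z = f z := by
  rw [toMeromorphicNFOn_eq_toMeromorphicNFAt hf (mem_univ z),
    toMeromorphicNFAt_eq_self.2 hz.meromorphicNFAt]

/-- Uniqueness of the continuation: both sides agree on the real line. The defining contour at depth
Q/4 is first moved to depth h, which is allowed for real σ_s. -/
theorem fusionKernel_eq_toMeromorphicNFOn (hb : 0 < b) (hbh : b < h) (hh : h < Qpar b / 2) :
    (fun σ => fusionKernel b θ σ σt) =
      toMeromorphicNFOn (fun σ => fusionConst b θ σt * kernelExtend b θ σt h σ) univ := by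
  have hm := meromorphicOn_const_mul_kernelExtend θ σt hb hbh hh
  unfold fusionKernel
  refine meromorphicContinuation_eq (z₀ := ((0 : ℝ) : ℂ)) (meromorphicNFOn_toMeromorphicNFOn _ _)
    (fun σ hσ => ?_) (frequently_nhdsNE_of_real (Eventually.of_forall fun x => Complex.ofReal_im x))
  have hσ : σ.im = 0 := hσ
  obtain ⟨s, rfl⟩ : ∃ s : ℝ, (s : ℂ) = σ := ⟨σ.re, Complex.ext (by simp) (by simp [hσ])⟩
  have hQ := Qpar_pos hb
  rw [toMeromorphicNFOn_eq_of_analyticAt hm (analyticAt_const_mul_kernelExtend θ σt hb hbh hh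
    (Or.inr (by simpa using hb))), kernelExtend_of_real θ σt hb, ponsotTeschner_eq,
    kernelFun_eq_of_real hb θ s σt (hb.trans hbh) hh (h' := Qpar b / 4) (by linarith)
      (by linarith)]

/-- Passing to normal form changes nothing at points of analyticity. These include σ_s ± iβ for real
nonzero σ_s, so the difference operator sees the recurrence values. -/
theorem fusionKernel_eq_kernelExtend (hb : 0 < b) (hbh : b < h) (hh : h < Qpar b / 2) {σ : ℂ}
    (hσ : σ.re ≠ 0 ∨ |σ.im| < b) :
    fusionKernel b θ σ σt = fusionConst b θ σt * kernelExtend b θ σt h σ := by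
  rw [congrFun (fusionKernel_eq_toMeromorphicNFOn θ σt hb hbh hh) σ,
    toMeromorphicNFOn_eq_of_analyticAt (meromorphicOn_const_mul_kernelExtend θ σt hb hbh hh)
      (analyticAt_const_mul_kernelExtend θ σt hb hbh hh hσ)]

/-- As b < h, the point σ + ib still lies in the strip where the integral formula holds, and one
step of the recurrence only reproduces it. -/
theorem kernelExtend_add_shift (hb : 0 < b) (hbh : b < h) (hh : h < Qpar b / 2) {σ : ℝ}
    (hσ : σ ≠ 0) :
    kernelExtend b θ σt h (σ + Complex.I * b) =
      kernelFun b θ.th0 θ.th1 σt h θ.tht θ.thinf (σ + Complex.I * b) := by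
  have h1 := kernelParam_zero_step θ σt hb hh (σ := σ) (by simpa using hσ)
    (by simpa using sub_pos.2 hbh)
  rw [kernelExtend, stepExtend_of_mem hb (n := 1) (by simp) (by simp; linarith),
    stepChain_succ_eq (n := 1)]
  · simp [stepChain, kernelParam]
  · simpa using h1

theorem kernelExtend_difference (hb : 0 < b) (hbh : b < h) (hh : h < Qpar b / 2) {σ : ℝ}
    (hσ : σ ≠ 0) :
    HF b θ (kernelExtend b θ σt h) σ =
      2 * Complex.cosh (2 * Real.pi * b * σt) * kernelExtend b θ σt h σ := by
  have h1 := kernelFun_difference hb θ.th0 θ.th1 σt (tt := θ.tht) (ti := θ.thinf) (σ := σ)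
    (by simpa using hσ) hh (by simpa using hbh) (by simpa using hb.trans hbh) (by simp)
  have h2 := kernelExtend_add_shift θ σt hb hbh hh hσ
  have h3 := kernelExtend_add_shift θ σt hb hbh hh (neg_ne_zero.2 hσ)
  rw [show ((-σ : ℝ) : ℂ) + Complex.I * b = -(σ - Complex.I * b) by push_cast; ring,
    kernelExtend_neg θ σt hb, kernelFun_neg] at h3
  rw [HF, HFplus_eq, HFplus_eq, HFzero_eq, h2, h3, kernelExtend_of_real θ σt hb, h1,
    show (Real.pi * b * (2 * σt) : ℂ) = 2 * Real.pi * b * σt by ring]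

/-! ### The dual equation, by continuation in the deformation parameter -/

/-- The continuation in `σ` of the kernel with parameter `w`, evaluated at `σ + ib⁻¹`. -/
def dualShift (b : ℝ) (θ : Momenta) (σt h : ℝ) (σ w : ℂ) : ℂ :=
  stepChain b (paramA b θ σt w) (paramB b θ w) (kernelParam b θ σt h w) (⌊b⁻¹ / b⌋₊ + 1)
    (σ + Complex.I * b⁻¹ - ⌊b⁻¹ / b⌋₊ * (Complex.I * b))

theorem floor_bounds (hb : 0 < b) :
    ⌊b⁻¹ / b⌋₊ * b ≤ b⁻¹ ∧ b⁻¹ < (⌊b⁻¹ / b⌋₊ + 1) * b :=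
  ⟨(le_div_iff₀ hb).1 (Nat.floor_le (by positivity)),
    (div_lt_iff₀ hb).1 (Nat.lt_floor_add_one _)⟩

theorem kernelExtend_dual_shift (hb : 0 < b) (σ : ℝ) :
    kernelExtend b θ σt h (σ + Complex.I * b⁻¹) = dualShift b θ σt h σ 0 := by
  obtain ⟨h1, h2⟩ := floor_bounds hb
  rw [kernelExtend, stepExtend_of_mem hb (n := ⌊b⁻¹ / b⌋₊) (by simpa using h1) (by simpa using h2)]
  rfl

theorem base_point_im (σ : ℝ) (n : ℕ) :
    ((σ : ℂ) + Complex.I * b⁻¹ - n * (Complex.I * b)).im = b⁻¹ - n * b := by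
  simp [-Complex.ofReal_inv]

theorem base_point_re (σ : ℝ) (n : ℕ) :
    ((σ : ℂ) + Complex.I * b⁻¹ - n * (Complex.I * b)).re = σ := by
  simp [-Complex.ofReal_inv]

/-- The initial points have |Im| ≤ b, so the integral formula there needs only b - Im w < h, which
Im w > -δ ensures. The coefficients are taken at points with Im ≥ 0, where |Im w| < Q/2 suffices. -/
theorem differentiableOn_dualShift (hb : 0 < b) (hh : h < Qpar b / 2) {δ : ℝ} (hδ : b + δ < h)
    (hδ0 : 0 < δ) {σ : ℝ} (hσ : σ ≠ 0) :
    DifferentiableOn ℂ (dualShift b θ σt h σ) {w | -δ < w.im ∧ w.im < h} := by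
  obtain ⟨h1, h2⟩ := floor_bounds hb
  set n := ⌊b⁻¹ / b⌋₊ with hn
  set ρ : ℂ := σ + Complex.I * b⁻¹ - n * (Complex.I * b) with hρ
  have hre : ρ.re ≠ 0 := by rw [hρ, base_point_re]; exact hσ
  have him0 : 0 ≤ ρ.im := by rw [hρ, base_point_im]; linarith
  have him1 : ρ.im < b := by rw [hρ, base_point_im]; linarith
  have hU : IsOpen {w : ℂ | -δ < w.im ∧ w.im < h} :=
    (isOpen_im_gt _).inter (isOpen_lt Complex.continuous_im continuous_const)
  have hk : ∀ k : ℕ, (ρ + k * (Complex.I * b)).re ≠ 0 ∧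
      0 ≤ (ρ + k * (Complex.I * b)).im := by
    intro k
    have : 0 ≤ (k : ℝ) * b := by positivity
    refine ⟨by simpa using hre, by simp; linarith⟩
  have hsmall : |(ρ - Complex.I * b).im| ≤ b := by
    simp
    rw [abs_le]
    constructor <;> linarith
  have hsmall' : |ρ.im| ≤ b := abs_le.2 ⟨by linarith, him1.le⟩
  have hw : ∀ w ∈ {w : ℂ | -δ < w.im ∧ w.im < h}, |w.im| < Qpar b / 2 := fun w hw =>
    abs_lt.2 ⟨by linarith [hw.1], by linarith [hw.2]⟩
  refine differentiableOn_stepChain_param (A := paramA b θ σt) (B := paramB b θ)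
    (K := kernelParam b θ σt h) (fun k => ?_) (fun k => ?_) ?_ ?_ _
  · exact differentiableOn_paramA θ σt hb hU (w := fun w => w) (σ := fun _ => _) (by fun_prop)
      (by fun_prop) (fun _ _ => (hk k).1) (fun w h => by linarith [(hk k).2, hw w h])
  · exact differentiableOn_paramB θ hb hU (w := fun w => w) (σ := fun _ => _) (by fun_prop)
      (by fun_prop) (fun _ _ => (hk k).1) (fun w h => by linarith [(hk k).2, hw w h])
  · exact differentiableOn_kernelParam θ σt hb hh hU (w := fun w => w) (σ := fun _ => ρ)
      (by fun_prop) (by fun_prop) (fun _ _ => by linarith) (fun w h => by linarith [h.1])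
      (fun w h => h.2)
  · exact differentiableOn_kernelParam θ σt hb hh hU (w := fun w => w)
      (σ := fun _ => ρ - Complex.I * b)
      (by fun_prop) (by fun_prop) (fun _ _ => by linarith) (fun w h => by linarith [h.1])
      (fun w h => h.2)

/-- For such w the integral formula itself reaches σ + i/b and satisfies the recurrence all along
the chain, so the iteration returns its value. -/
theorem dualShift_eq (hb : 0 < b) (hb1 : b < 1) (hh : h < Qpar b / 2) {σ : ℝ} (hσ : σ ≠ 0) {w : ℂ}
    (h1 : b⁻¹ - w.im < h) (h2 : w.im < h) :
    dualShift b θ σt h σ w = kernelParam b θ σt h w (σ + Complex.I * b⁻¹) := by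
  obtain ⟨f1, f2⟩ := floor_bounds hb
  have hb' : 1 < b⁻¹ := (one_lt_inv₀ hb).2 hb1
  have hQ : Qpar b = b + b⁻¹ := rfl
  unfold dualShift
  rw [stepChain_eq_of_recurrence]
  · congr 1
    push_cast
    ring
  · intro k hk
    -- The recurrence is applied at points with imaginary part at most 1/b - b, so that a further
    -- shift by b does not pass 1/b.
    have hk' : ((k : ℝ) + 1) * b ≤ ⌊b⁻¹ / b⌋₊ * b := by
      gcongr
      exact_mod_cast (by omega : k + 1 ≤ ⌊b⁻¹ / b⌋₊)
    have hk0 : 0 ≤ (k : ℝ) * b := by positivity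
    set ρ : ℂ := σ + Complex.I * b⁻¹ - ⌊b⁻¹ / b⌋₊ * (Complex.I * b) with hρ
    have e1 : (ρ + k * (Complex.I * b)).im = b⁻¹ - ⌊b⁻¹ / b⌋₊ * b + k * b := by
      rw [Complex.add_im, hρ, base_point_im]
      simp
    have e2 : (ρ + k * (Complex.I * b)).re = σ := by
      rw [Complex.add_re, hρ, base_point_re]
      simp
    refine kernelParam_step θ σt hb hh (by rwa [e2]) ?_ h2 ?_
    · rw [e1, abs_of_nonneg (by linarith)]
      linarith
    · rw [e1, abs_lt]
      constructor <;> linarith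

theorem kernelParam_dual_difference (hb : 0 < b) (hb1 : b < 1) (hh : h < Qpar b / 2) {σ : ℝ}
    (hσ : σ ≠ 0) {w : ℂ} (h1 : b⁻¹ - w.im < h) (h2 : w.im < h) :
    shiftCoeff b⁻¹ (edgeShift θ.th0 θ.th1 (θ.tht + w) (θ.thinf - w)) σ * dualShift b θ σt h σ w +
      shiftCoeff b⁻¹ (edgeShift θ.th0 θ.th1 (θ.tht + w) (θ.thinf - w)) (-σ) *
        dualShift b θ σt h (-σ : ℝ) w +
      (potential b⁻¹ θ.th0 θ.th1 (θ.tht + w) (θ.thinf - w) σ -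
        2 * Complex.cosh (2 * Real.pi * (b : ℂ)⁻¹ * σt)) * kernelParam b θ σt h w σ = 0 := by
  have h3 := kernelFun_difference (inv_pos.2 hb) θ.th0 θ.th1 σt (tt := θ.tht + w)
    (ti := θ.thinf - w) (σ := σ) (by simpa using hσ) (by rwa [Qpar_inv])
    (by simp; linarith) (by simpa using h2) (sum_im_param θ w)
  simp only [kernelFun_inv, Complex.ofReal_inv] at h3
  rw [dualShift_eq θ σt hb hb1 hh hσ h1 h2, dualShift_eq θ σt hb hb1 hh (neg_ne_zero.2 hσ) h1 h2,
    show ((-σ : ℝ) : ℂ) + Complex.I * (b⁻¹ : ℝ) = -(σ - Complex.I * (b⁻¹ : ℝ)) by push_cast; ring,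
    kernelParam_neg]
  rw [show (Real.pi * (b : ℂ)⁻¹ * (2 * σt) : ℂ) = 2 * Real.pi * (b : ℂ)⁻¹ * σt by ring] at h3
  unfold kernelParam
  simp only [Complex.ofReal_inv]
  linear_combination h3

/-- Identity theorem in w on the convex strip -δ < Im w < h: the left side is holomorphic there,
vanishes near i/(2b), hence vanishes at 0. -/
theorem kernelParam_dual_difference_zero (hb : 0 < b) (hb1 : b < 1) (hbh : b < h)
    (hbh' : b⁻¹ / 2 < h) (hh : h < Qpar b / 2) {σ : ℝ} (hσ : σ ≠ 0) :
    shiftCoeff b⁻¹ (edgeShift θ.th0 θ.th1 θ.tht θ.thinf) σ * dualShift b θ σt h σ 0 +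
      shiftCoeff b⁻¹ (edgeShift θ.th0 θ.th1 θ.tht θ.thinf) (-σ) * dualShift b θ σt h (-σ : ℝ) 0 +
      (potential b⁻¹ θ.th0 θ.th1 θ.tht θ.thinf σ -
        2 * Complex.cosh (2 * Real.pi * (b : ℂ)⁻¹ * σt)) * kernelParam b θ σt h 0 σ = 0 := by
  obtain ⟨δ, hδ0, hδ1⟩ := exists_between (sub_pos.2 hbh)
  have hδ : b + δ < h := by linarith
  have hσ' : (σ : ℂ).re ≠ 0 := by simpa using hσ
  have hσ'' : (-σ : ℂ).re ≠ 0 := by simpa using hσ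
  have hib : 0 < b⁻¹ := inv_pos.2 hb
  set U : Set ℂ := {w : ℂ | -δ < w.im ∧ w.im < h} with hUdef
  have hU : IsOpen U := (isOpen_im_gt _).inter (isOpen_lt Complex.continuous_im continuous_const)
  have hconv : Convex ℝ U :=
    (convex_halfSpace_im_gt (-δ)).inter (convex_halfSpace_im_lt h)
  have ha : ∀ w : ℂ, ∀ j, DifferentiableAt ℂ
      (fun w => edgeShift θ.th0 θ.th1 (θ.tht + w) (θ.thinf - w) j) w := by
    intro w j
    fin_cases j <;> simp [edgeShift] <;> fun_prop
  have hD : DifferentiableOn ℂ (fun w =>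
      shiftCoeff b⁻¹ (edgeShift θ.th0 θ.th1 (θ.tht + w) (θ.thinf - w)) σ * dualShift b θ σt h σ w +
      shiftCoeff b⁻¹ (edgeShift θ.th0 θ.th1 (θ.tht + w) (θ.thinf - w)) (-σ) *
        dualShift b θ σt h (-σ : ℝ) w +
      (potential b⁻¹ θ.th0 θ.th1 (θ.tht + w) (θ.thinf - w) σ -
        2 * Complex.cosh (2 * Real.pi * (b : ℂ)⁻¹ * σt)) * kernelParam b θ σt h w σ) U := by
    refine ((DifferentiableOn.mul (fun w _ => ?_) (differentiableOn_dualShift θ σt hb hh hδ hδ0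
      hσ)).add (DifferentiableOn.mul (fun w _ => ?_) (differentiableOn_dualShift θ σt hb hh hδ hδ0
      (neg_ne_zero.2 hσ)))).add (DifferentiableOn.mul (fun w _ => ?_) ?_)
    · exact (differentiableAt_shiftCoeff hib (ha w) (differentiableAt_const _)
        hσ').differentiableWithinAt
    · exact (differentiableAt_shiftCoeff hib (ha w) (differentiableAt_const _)
        hσ'').differentiableWithinAt
    · exact ((differentiableAt_potential hib _ _ (by fun_prop) (by fun_prop)
        (differentiableAt_const _) hσ').sub (differentiableAt_const _)).differentiableWithinAt
    · exact differentiableOn_kernelParam θ σt hb hh hU (w := fun w => w) (σ := fun _ => σ)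
        (by fun_prop) (by fun_prop) (fun _ _ => by simpa using Qpar_pos hb)
        (fun w hw => by have := hw.1; simp; linarith) (fun w hw => hw.2)
  -- At w = i/(2b) the conditions 1/b - Im w < h and Im w < h both read 1/(2b) < h.
  have hw₀ : (Complex.I * (b⁻¹ / 2 : ℝ)).im = b⁻¹ / 2 := by
    rw [Complex.mul_im, Complex.ofReal_re, Complex.ofReal_im]; simp
  have key := (hD.analyticOnNhd hU).eqOn_zero_of_preconnected_of_eventuallyEq_zero
    hconv.isPreconnected (z₀ := Complex.I * (b⁻¹ / 2 : ℝ))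
    ⟨by rw [hw₀]; linarith, by rw [hw₀]; exact hbh'⟩ ?_
    (show (0 : ℂ) ∈ U from ⟨by simpa using hδ0, by simpa using hb.trans hbh⟩)
  · simpa using key
  · have t1 : ∀ᶠ w : ℂ in 𝓝 (Complex.I * (b⁻¹ / 2 : ℝ)), w.im < h :=
      Complex.continuous_im.continuousAt.eventually_lt_const (by rw [hw₀]; exact hbh')
    have t2 : ∀ᶠ w : ℂ in 𝓝 (Complex.I * (b⁻¹ / 2 : ℝ)), b⁻¹ - h < w.im :=
      Complex.continuous_im.continuousAt.eventually_const_lt (by rw [hw₀]; linarith)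
    filter_upwards [t1, t2] with w e1 e2
    exact kernelParam_dual_difference θ σt hb hb1 hh hσ (by linarith) e1

theorem kernelExtend_dual_difference (hb : 0 < b) (hb1 : b < 1) (hbh : b < h)
    (hbh' : b⁻¹ / 2 < h) (hh : h < Qpar b / 2) {σ : ℝ} (hσ : σ ≠ 0) :
    HF b⁻¹ θ (kernelExtend b θ σt h) σ =
      2 * Complex.cosh (2 * Real.pi * (b : ℂ)⁻¹ * σt) * kernelExtend b θ σt h σ := by
  have h1 := kernelParam_dual_difference_zero θ σt hb hb1 hbh hbh' hh hσ
  have h2 := kernelExtend_dual_shift (h := h) θ σt hb σ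
  have h3 := kernelExtend_dual_shift (h := h) θ σt hb (-σ)
  rw [show ((-σ : ℝ) : ℂ) + Complex.I * (b⁻¹ : ℝ) = -(σ - Complex.I * (b⁻¹ : ℝ)) by push_cast; ring,
    kernelExtend_neg θ σt hb] at h3
  rw [HF, HFplus_eq, HFplus_eq, HFzero_eq, h2, h3,
    kernelExtend_of_real θ σt hb]
  simp only [kernelParam, add_zero, sub_zero] at h1
  linear_combination h1

end

end VirasoroFusion

end

/-! ### The theorem -/

theorem proposition4p2 (b : ℝ) (hb0 : 0 < b) (hb1 : b < 1) (θ : VirasoroFusion.Momenta) (σt : ℝ) :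
    -- the kernel is well defined: the integral converges absolutely on every horizontal line in
    -- the strip, and the kernel is the meromorphic function of `σ_s` given by it at real `σ_s`
    (MeromorphicNFOn (fun σ : ℂ => VirasoroFusion.fusionKernel b θ σ σt) Set.univ ∧
      ∀ (σs h : ℝ), 0 < h → h < VirasoroFusion.Qpar b / 2 →
        MeasureTheory.Integrable (fun x : ℝ =>
          VirasoroFusion.fusionIntegrand b θ σs σt (x - Complex.I * h)) ∧
        VirasoroFusion.fusionKernel b θ σs σt = VirasoroFusion.ponsotTeschner b θ h σs σt) ∧
    -- the pair of difference equations
    ∀ σs : ℝ, σs ≠ 0 →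
      VirasoroFusion.HF b θ (fun σ => VirasoroFusion.fusionKernel b θ σ σt) σs =
          2 * Complex.cosh (2 * Real.pi * b * σt) * VirasoroFusion.fusionKernel b θ σs σt ∧
      VirasoroFusion.HF b⁻¹ θ (fun σ => VirasoroFusion.fusionKernel b θ σ σt) σs =
          2 * Complex.cosh (2 * Real.pi * (b : ℂ)⁻¹ * σt) *
            VirasoroFusion.fusionKernel b θ σs σt := by
  have hib : 1 < b⁻¹ := (one_lt_inv₀ hb0).2 hb1
  have hQ : VirasoroFusion.Qpar b = b + b⁻¹ := rfl
  -- The contour depth l must exceed b for the first equation and 1/(2b) for the dual one; both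
  -- bounds are below Q/2 because 0 < b < 1.
  obtain ⟨l, hl1, hl2⟩ := exists_between (show max b (b⁻¹ / 2) < VirasoroFusion.Qpar b / 2 from
    max_lt (by linarith) (by linarith))
  obtain ⟨hbl, hbl'⟩ := max_lt_iff.1 hl1
  have heq : ∀ {σ : ℂ}, σ.re ≠ 0 ∨ |σ.im| < b →
      VirasoroFusion.fusionKernel b θ σ σt = VirasoroFusion.fusionConst b θ σt * VirasoroFusion.kernelExtend b θ σt l σ :=
    fun hσ => VirasoroFusion.fusionKernel_eq_kernelExtend θ σt hb0 hbl hl2 hσ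
  -- The factor `fusionConst` is independent of σ_s, and the three points σ_s, σ_s ± iβ have nonzero
  -- real part, so it passes through the operator for either period.
  have hHF : ∀ (β σs : ℝ), σs ≠ 0 → VirasoroFusion.HF β θ (fun σ => VirasoroFusion.fusionKernel b θ σ σt) σs =
      VirasoroFusion.fusionConst b θ σt * VirasoroFusion.HF β θ (VirasoroFusion.kernelExtend b θ σt l) σs := by
    intro β σs hσs
    unfold VirasoroFusion.HF
    simp only
    rw [heq (Or.inl (by simpa using hσs)), heq (Or.inl (by simpa using hσs)),
      heq (Or.inl (by simpa using hσs))]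
    ring
  refine ⟨⟨?_, fun σs h h0 h1 => ⟨VirasoroFusion.integrable_fusionIntegrand hb0 θ σs σt h0 h1, ?_⟩⟩,
    fun σs hσs => ⟨?_, ?_⟩⟩
  · rw [VirasoroFusion.fusionKernel_eq_toMeromorphicNFOn θ σt hb0 hbl hl2]
    exact meromorphicNFOn_toMeromorphicNFOn _ _
  · rw [heq (Or.inr (by simpa using hb0)), VirasoroFusion.kernelExtend_of_real θ σt hb0, VirasoroFusion.ponsotTeschner_eq,
      VirasoroFusion.kernelFun_eq_of_real hb0 θ σs σt (hb0.trans hbl) hl2 h0 h1]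
  · rw [hHF b σs hσs, heq (Or.inl (by simpa using hσs)),
      VirasoroFusion.kernelExtend_difference θ σt hb0 hbl hl2 hσs]
    ring
  · rw [hHF b⁻¹ σs hσs, heq (Or.inl (by simpa using hσs)),
      VirasoroFusion.kernelExtend_dual_difference θ σt hb0 hb1 hbl hbl' hl2 hσs]
    ring
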